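/- For a natural number $n$ and a real number $N$ write $n\sim N$ for $N<n\le 2N$. Let $N_1,\dots,N_7\ge 2$ and $\Delta>0$ be real numbers. For each of the four independent choices of the two signs $\pm,\pm$, let $\mathscr{A}_{\pm,\pm}(N_1,\dots,N_7;\Delta)$ be the number of $7$-tuples $(n_1,\dots,n_7)$ of positive integers with $n_j\sim N_j$ $(j=1,\dots,7)$ and $$0<\left|\sqrt{n_1}+\sqrt{n_2}+\sqrt{n_3}+\sqrt{n_4}\pm\sqrt{n_5}\pm\sqrt{n_6}-\sqrt{n_7}\right|<\Delta .$$ Then for every $\varepsilon>0$ there is a constant $C=C(\varepsilon)>0$, depending only on $\varepsilon$, such that for all real $N_1,\dots,N_7\ge 2$, all $\Delta>0$ and every choice of the signs, $$\mathscr{A}_{\pm,\pm}(N_1,\dots,N_7;\Delta)\le C\prod_{j=1}^{7}\left(\Delta^{1/7}N_j^{13/14}+N_j^{5/7}\right)N_j^{\varepsilon}.$$ -/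

import Mathlib

/-- The dyadic condition `n ∼ N`, for a natural number `n` and a real number `N`:
`N < n ≤ 2 N`. -/
def InDyadic (n : ℕ) (N : ℝ) : Prop :=
  N < (n : ℝ) ∧ (n : ℝ) ≤ 2 * N

/-- The form `√n₁ + √n₂ + √n₃ + √n₄ + σ √n₅ + τ √n₆ - √n₇`; the two free signs are
units of `ℤ`, that is, `1` or `-1`. The index `j ∈ {1, …, 7}` is `j - 1 : Fin 7`. -/
noncomputable def sqrtForm (σ τ : ℤˣ) (n : Fin 7 → ℕ) : ℝ :=
  √(n 0 : ℝ) + √(n 1 : ℝ) + √(n 2 : ℝ) + √(n 3 : ℝ)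
    + ((σ : ℤ) : ℝ) * √(n 4 : ℝ) + ((τ : ℤ) : ℝ) * √(n 5 : ℝ) - √(n 6 : ℝ)

/-- The solutions in positive integers `n_j ∼ N_j` of `0 < |sqrtForm σ τ n| < Δ`. -/
def sqrtSolutions (σ τ : ℤˣ) (N : Fin 7 → ℝ) (Δ : ℝ) : Set (Fin 7 → ℕ) :=
  {n | (∀ j, 0 < n j ∧ InDyadic (n j) (N j)) ∧
    0 < |sqrtForm σ τ n| ∧ |sqrtForm σ τ n| < Δ}

/-- There are finitely many solutions, so that `Set.ncard` really counts them. -/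
theorem sqrtSolutions_finite (σ τ : ℤˣ) (N : Fin 7 → ℝ) (Δ : ℝ) :
    (sqrtSolutions σ τ N Δ).Finite := by
  refine (Set.Finite.pi' (fun j => Set.finite_Iic ⌊2 * N j⌋₊)).subset ?_
  intro n hn j
  exact Nat.le_floor (hn.1 j).2.2

/-- The number of solutions. -/
noncomputable def sqrtCount (σ τ : ℤˣ) (N : Fin 7 → ℝ) (Δ : ℝ) : ℕ :=
  (sqrtSolutions σ τ N Δ).ncard

/-! A Gaussian majorant of the condition `|x| < Δ` turns the count into the mean of a product of
seven sums `rootSum` against a Gaussian in `z` of width about `1 / Δ`; the signs only conjugate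
factors. Hölder's inequality reduces this to the seventh moment of a single sum. Three of its
factors are bounded trivially by `2 N`, and there remains the fourth moment, which is `≪ N^ε (Δ
N^(7/2) + N²)` (`exists_gaussianMean_rootSum_pow_four_le`). Taking seventh roots gives the stated
factors.

The fourth moment counts near coincidences among the numbers `√a + √b`. With `s = a + b` and `h = a
- b` one has `(√a + √b)² = s + √(s² - h²)`, the larger root of `z² - 2 s z + h²`, so the object to
bound is the `energy` of these roots over a `latticeBox`. A point `z` is close to such a root
exactly when `(z + h² / z) / 2` is close to the integer `s`. A Fejér kernel detects this, and
Poisson summation over `h` turns the sum of kernels into `√z` times `dualForm`, an almost periodic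
function of `z` with nonnegative coefficients (`norm_kernelForm_sub_le`).

The energy is bounded by induction on the exponent. `EnergyBound γ` is the bound `δ Z³ + Z^(2 + γ)`
up to logarithms. Because the coefficients of `dualForm` are nonnegative, its Gaussian mean square
over a window of length `N` is at most that over a window of length `J ≤ N`
(`sqrt_mul_integral_dualForm_mono`). On the short window the Poisson step is reversed, so that the
mean square is controlled by energies of boxes of size about `J` at most, where `EnergyBound γ`
applies. The outcome is energy `≪ N³ / J + N² J^γ` at scale `1 / (4 J)`
(`energy_latticeBox_le_of_dyadic`), and the best `J` replaces `γ` by `γ / (1 + γ)`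
(`EnergyBound.step`). Starting from the trivial `γ = 1` the exponents are `1, 1/2, 1/3, …`,
eventually below any `ε`. -/

/-! ### Gaussian theta sums: size, variation with the parameter, Jacobi's transformation. -/

theorem summable_exp_neg_mul_int_sq {a : ℝ} (ha : 0 < a) :
    Summable fun n : ℤ => Real.exp (-Real.pi * a * (n : ℝ) ^ 2) := by
  have h := (summable_jacobiTheta₂_term_iff 0 (Complex.I * a)).2 (by simpa using ha)
  refine h.norm.congr fun n => ?_
  rw [norm_jacobiTheta₂_term]
  congr 1
  simp
  ring

/-- The Gaussian sum `∑ exp (-π n²)` over the integers. -/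
noncomputable def gaussianSum : ℝ := ∑' n : ℤ, Real.exp (-Real.pi * 1 * (n : ℝ) ^ 2)

theorem one_le_gaussianSum : 1 ≤ gaussianSum := by
  have h := (summable_exp_neg_mul_int_sq one_pos).le_tsum 0 (fun _ _ => (Real.exp_pos _).le)
  simpa [gaussianSum] using h

theorem tsum_exp_neg_mul_int_sq_mono {a b : ℝ} (ha : 0 < a) (hab : a ≤ b) :
    ∑' n : ℤ, Real.exp (-Real.pi * b * (n : ℝ) ^ 2) ≤
      ∑' n : ℤ, Real.exp (-Real.pi * a * (n : ℝ) ^ 2) := by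
  refine (summable_exp_neg_mul_int_sq (ha.trans_le hab)).tsum_le_tsum (fun n => ?_)
    (summable_exp_neg_mul_int_sq ha)
  apply Real.exp_le_exp.2
  have : Real.pi * a * (n : ℝ) ^ 2 ≤ Real.pi * b * (n : ℝ) ^ 2 := by
    gcongr
  linarith

/-- For `a ≤ 1` Jacobi's transformation gives `1 / √a` times the sum with parameter `1 / a ≥ 1`; for
`a ≥ 1` monotonicity suffices. -/
theorem tsum_exp_neg_mul_int_sq_le {a : ℝ} (ha : 0 < a) :
    ∑' n : ℤ, Real.exp (-Real.pi * a * (n : ℝ) ^ 2) ≤ gaussianSum * (1 + 1 / √a) := by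
  have hg := one_le_gaussianSum
  have hs : 0 < √a := Real.sqrt_pos.2 ha
  rcases le_total a 1 with h | h
  · rw [Real.tsum_exp_neg_mul_int_sq ha, ← Real.sqrt_eq_rpow]
    have h1 : ∑' n : ℤ, Real.exp (-Real.pi / a * (n : ℝ) ^ 2) ≤ gaussianSum := by
      have := tsum_exp_neg_mul_int_sq_mono one_pos ((one_le_div ha).2 h)
      refine le_trans (le_of_eq ?_) this
      congr 1
      ext n
      congr 1
      ring
    calc _ ≤ 1 / √a * gaussianSum := by gcongr
      _ ≤ _ := by
        have : 0 ≤ gaussianSum := by linarith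
        nlinarith
  · calc _ ≤ gaussianSum := tsum_exp_neg_mul_int_sq_mono one_pos h
      _ ≤ _ := by
        have : 0 < 1 / √a := by positivity
        nlinarith

theorem sq_mul_exp_neg_le {a : ℝ} (ha : 0 < a) (x : ℝ) :
    x ^ 2 * Real.exp (-Real.pi * a * x ^ 2) ≤
      1 / a * Real.exp (-Real.pi * (a / 2) * x ^ 2) := by
  have h1 : a * x ^ 2 ≤ Real.exp (Real.pi * (a / 2) * x ^ 2) := by
    have h3 := Real.pi_gt_three
    have h2 := Real.add_one_le_exp (Real.pi * (a / 2) * x ^ 2)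
    have : 0 ≤ a * x ^ 2 := by positivity
    nlinarith
  have h2 : x ^ 2 ≤ 1 / a * Real.exp (Real.pi * (a / 2) * x ^ 2) := by
    rw [div_mul_eq_mul_div, one_mul, le_div_iff₀ ha]
    linarith
  calc x ^ 2 * Real.exp (-Real.pi * a * x ^ 2)
      ≤ (1 / a * Real.exp (Real.pi * (a / 2) * x ^ 2)) * Real.exp (-Real.pi * a * x ^ 2) := by
        gcongr
    _ = _ := by
        rw [mul_assoc, ← Real.exp_add]
        congr 2
        ring

theorem summable_sq_mul_exp_neg {a : ℝ} (ha : 0 < a) :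
    Summable fun n : ℤ => (n : ℝ) ^ 2 * Real.exp (-Real.pi * a * (n : ℝ) ^ 2) :=
  Summable.of_nonneg_of_le (fun _ => by positivity) (fun n => sq_mul_exp_neg_le ha n)
    ((summable_exp_neg_mul_int_sq (half_pos ha)).mul_left _)

theorem tsum_sq_mul_exp_neg_le {a : ℝ} (ha : 0 < a) :
    ∑' n : ℤ, (n : ℝ) ^ 2 * Real.exp (-Real.pi * a * (n : ℝ) ^ 2) ≤
      1 / a * (gaussianSum * (1 + 1 / √(a / 2))) := by
  calc _ ≤ ∑' n : ℤ, 1 / a * Real.exp (-Real.pi * (a / 2) * (n : ℝ) ^ 2) :=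
        (summable_sq_mul_exp_neg ha).tsum_le_tsum (fun n => sq_mul_exp_neg_le ha n)
          ((summable_exp_neg_mul_int_sq (half_pos ha)).mul_left _)
    _ = 1 / a * ∑' n : ℤ, Real.exp (-Real.pi * (a / 2) * (n : ℝ) ^ 2) := tsum_mul_left
    _ ≤ _ := by
        gcongr
        exact tsum_exp_neg_mul_int_sq_le (half_pos ha)

theorem norm_cexp_neg_pi_mul (a : ℂ) (n : ℤ) :
    ‖Complex.exp (-Real.pi * a * (n : ℂ) ^ 2)‖ = Real.exp (-Real.pi * a.re * (n : ℝ) ^ 2) := by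
  rw [Complex.norm_exp]
  congr 1
  have : (-(Real.pi : ℂ) * a * (n : ℂ) ^ 2) = ((-Real.pi * (n : ℝ) ^ 2 : ℝ) : ℂ) * a := by
    push_cast
    ring
  rw [this, Complex.re_ofReal_mul]
  ring

theorem summable_cexp_neg_mul_int_sq {a : ℂ} (ha : 0 < a.re) :
    Summable fun n : ℤ => Complex.exp (-Real.pi * a * (n : ℂ) ^ 2) := by
  refine Summable.of_norm ?_
  simpa only [norm_cexp_neg_pi_mul] using summable_exp_neg_mul_int_sq ha

theorem norm_tsum_cexp_neg_le {a : ℂ} (ha : 0 < a.re) :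
    ‖∑' n : ℤ, Complex.exp (-Real.pi * a * (n : ℂ) ^ 2)‖ ≤ gaussianSum * (1 + 1 / √a.re) := by
  refine (norm_tsum_le_tsum_norm ?_).trans ?_
  · simpa only [norm_cexp_neg_pi_mul] using summable_exp_neg_mul_int_sq ha
  · simpa only [norm_cexp_neg_pi_mul] using tsum_exp_neg_mul_int_sq_le ha

theorem norm_exp_sub_exp_le (u v : ℂ) :
    ‖Complex.exp u - Complex.exp v‖ ≤ ‖u - v‖ * Real.exp (max u.re v.re) := by
  have key := Convex.norm_image_sub_le_of_norm_hasDerivWithin_le (f := Complex.exp)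
    (f' := Complex.exp) (s := {w : ℂ | w.re ≤ max u.re v.re})
    (C := Real.exp (max u.re v.re)) (x := v) (y := u)
    (fun x _ => (Complex.hasDerivAt_exp x).hasDerivWithinAt)
    (fun x hx => by rw [Complex.norm_exp]; exact Real.exp_le_exp.2 hx)
    (convex_halfSpace_re_le _) (by simp) (by simp)
  rw [mul_comm]
  exact key

/-- The mean value inequality on a half-plane costs a factor `n²` in each term, which half of the
Gaussian decay absorbs. -/
theorem norm_tsum_cexp_sub_le {u v : ℂ} {a : ℝ} (ha : 0 < a) (hu : a ≤ u.re) (hv : a ≤ v.re) :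
    ‖∑' n : ℤ, Complex.exp (-Real.pi * u * (n : ℂ) ^ 2) -
      ∑' n : ℤ, Complex.exp (-Real.pi * v * (n : ℂ) ^ 2)‖ ≤
      Real.pi * ‖u - v‖ * (1 / a * (gaussianSum * (1 + 1 / √(a / 2)))) := by
  have hsu := summable_cexp_neg_mul_int_sq (ha.trans_le hu)
  have hsv := summable_cexp_neg_mul_int_sq (ha.trans_le hv)
  have hb : ∀ n : ℤ, ‖Complex.exp (-Real.pi * u * (n : ℂ) ^ 2) -
      Complex.exp (-Real.pi * v * (n : ℂ) ^ 2)‖ ≤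
      Real.pi * ‖u - v‖ * ((n : ℝ) ^ 2 * Real.exp (-Real.pi * a * (n : ℝ) ^ 2)) := by
    intro n
    refine (norm_exp_sub_exp_le _ _).trans ?_
    have e1 : -(Real.pi : ℂ) * u * (n : ℂ) ^ 2 - -Real.pi * v * (n : ℂ) ^ 2 =
        ((-Real.pi * (n : ℝ) ^ 2 : ℝ) : ℂ) * (u - v) := by
      push_cast
      ring
    have e2 : ∀ w : ℂ, (-(Real.pi : ℂ) * w * (n : ℂ) ^ 2).re = -Real.pi * w.re * (n : ℝ) ^ 2 := by
      intro w
      have : (-(Real.pi : ℂ) * w * (n : ℂ) ^ 2) = ((-Real.pi * (n : ℝ) ^ 2 : ℝ) : ℂ) * w := by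
        push_cast
        ring
      rw [this, Complex.re_ofReal_mul]
      ring
    rw [e1, norm_mul, Complex.norm_real, e2, e2, Real.norm_eq_abs, abs_mul, abs_neg,
      abs_of_pos Real.pi_pos, abs_of_nonneg (sq_nonneg (n : ℝ))]
    have e3 : max (-Real.pi * u.re * (n : ℝ) ^ 2) (-Real.pi * v.re * (n : ℝ) ^ 2) ≤
        -Real.pi * a * (n : ℝ) ^ 2 := by
      have : 0 ≤ Real.pi * (n : ℝ) ^ 2 := by positivity
      exact max_le (by nlinarith) (by nlinarith)
    calc _ ≤ Real.pi * (n : ℝ) ^ 2 * ‖u - v‖ * Real.exp (-Real.pi * a * (n : ℝ) ^ 2) := by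
          gcongr
      _ = _ := by ring
  have hs := (summable_sq_mul_exp_neg ha).mul_left (Real.pi * ‖u - v‖)
  rw [← hsu.tsum_sub hsv]
  calc _ ≤ ∑' n : ℤ, Real.pi * ‖u - v‖ *
        ((n : ℝ) ^ 2 * Real.exp (-Real.pi * a * (n : ℝ) ^ 2)) :=
        tsum_of_norm_bounded hs.hasSum hb
    _ ≤ _ := by
        rw [tsum_mul_left]
        gcongr
        exact tsum_sq_mul_exp_neg_le ha

/-- Jacobi's transformation with the branch of the square root recorded only through `x ^ 2 = a` and
`0 ≤ x.re`. This is all that is needed to compare `x` with an explicit root by a difference of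
squares. -/
theorem exists_sqrt_mul_tsum_cexp {a : ℂ} (ha : 0 < a.re) :
    ∃ x : ℂ, x ^ 2 = a ∧ 0 ≤ x.re ∧
      x * ∑' n : ℤ, Complex.exp (-Real.pi * a * (n : ℂ) ^ 2) =
        ∑' n : ℤ, Complex.exp (-Real.pi * a⁻¹ * (n : ℂ) ^ 2) := by
  have ha0 : a ≠ 0 := fun h => by simp [h] at ha
  have hx0 : a ^ (1 / 2 : ℂ) ≠ 0 := by simp [Complex.cpow_eq_zero_iff, ha0]
  refine ⟨a ^ (1 / 2 : ℂ), ?_, ?_, ?_⟩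
  · rw [← Complex.cpow_nat_mul]
    simp
  · rw [Complex.cpow_def_of_ne_zero ha0, Complex.exp_re]
    have him : (Complex.log a * (1 / 2)).im = Complex.arg a / 2 := by
      have : (1 / 2 : ℂ) = ((1 / 2 : ℝ) : ℂ) := by norm_num
      rw [this, Complex.im_mul_ofReal, Complex.log_im]
      ring
    rw [him]
    refine mul_nonneg (Real.exp_pos _).le (Real.cos_nonneg_of_mem_Icc ⟨?_, ?_⟩)
    · linarith [Complex.neg_pi_lt_arg a]
    · linarith [Complex.arg_le_pi a]
  · rw [Complex.tsum_exp_neg_mul_int_sq ha, ← mul_assoc, mul_one_div_cancel hx0, one_mul]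
    simp_rw [div_eq_mul_inv]

/-! ### The chirp sum and its dual under Poisson summation. -/

/-- The parameter `lam / j² + i z / j` of the dual theta sum. -/
noncomputable def thetaParam (lam : ℝ) (j : ℕ) (z : ℝ) : ℂ :=
  ((lam / (j : ℝ) ^ 2 : ℝ) : ℂ) + ((z / (j : ℝ) : ℝ) : ℂ) * Complex.I

/-- The theta sum `∑ exp (-π lam l² / j² - π i z l² / j)`. -/
noncomputable def dualSum (lam : ℝ) (j : ℕ) (z : ℝ) : ℂ :=
  ∑' l : ℤ, Complex.exp (-Real.pi * thetaParam lam j z * (l : ℂ) ^ 2)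

/-- The parameter `lam / z² - i j / z` of the chirp sum. -/
noncomputable def chirpParam (lam : ℝ) (j : ℕ) (z : ℝ) : ℂ :=
  ((lam / z ^ 2 : ℝ) : ℂ) - (((j : ℝ) / z : ℝ) : ℂ) * Complex.I

/-- The Gaussian-weighted quadratic sum `∑ exp (-π lam h² / z² + π i j h² / z)`. -/
noncomputable def chirpSum (lam : ℝ) (j : ℕ) (z : ℝ) : ℂ :=
  ∑' h : ℤ, Complex.exp (-Real.pi * chirpParam lam j z * (h : ℂ) ^ 2)

theorem thetaParam_re (lam : ℝ) (j : ℕ) (z : ℝ) :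
    (thetaParam lam j z).re = lam / (j : ℝ) ^ 2 := by
  rw [thetaParam, Complex.add_re, Complex.ofReal_re, Complex.re_ofReal_mul]
  simp

theorem thetaParam_im (lam : ℝ) (j : ℕ) (z : ℝ) : (thetaParam lam j z).im = z / j := by
  rw [thetaParam, Complex.add_im, Complex.ofReal_im, Complex.im_ofReal_mul]
  simp

theorem chirpParam_re (lam : ℝ) (j : ℕ) (z : ℝ) : (chirpParam lam j z).re = lam / z ^ 2 := by
  rw [chirpParam, Complex.sub_re, Complex.ofReal_re, Complex.re_ofReal_mul]
  simp

section
variable {lam : ℝ} {j : ℕ} {z : ℝ}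

theorem thetaParam_re_pos (hlam : 1 ≤ lam) (hj : 1 ≤ j) : 0 < (thetaParam lam j z).re := by
  rw [thetaParam_re]
  have : (0 : ℝ) < j := by exact_mod_cast hj
  positivity

theorem div_le_norm_thetaParam : z / j ≤ ‖thetaParam lam j z‖ := by
  rw [← thetaParam_im lam j z]
  exact (le_abs_self _).trans (Complex.abs_im_le_norm _)

theorem thetaParam_inv_re (hlam : 1 ≤ lam) (hj : 1 ≤ j) :
    ((thetaParam lam j z)⁻¹).re = lam / (lam ^ 2 / (j : ℝ) ^ 2 + z ^ 2) := by
  have hj' : (0 : ℝ) < j := by exact_mod_cast hj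
  have hl : 0 < lam := by linarith
  rw [Complex.inv_re, Complex.normSq_apply, thetaParam_re, thetaParam_im]
  have : 0 < lam ^ 2 / (j : ℝ) ^ 2 + z ^ 2 := by positivity
  have h2 : 0 < lam / (j : ℝ) ^ 2 * (lam / (j : ℝ) ^ 2) + z / j * (z / j) := by
    have : 0 < lam / (j : ℝ) ^ 2 := by positivity
    nlinarith [mul_pos this this, mul_self_nonneg (z / j)]
  rw [div_eq_div_iff h2.ne' this.ne']
  field_simp

theorem norm_dualSum_le (hlam : 1 ≤ lam) (hj : 1 ≤ j) :
    ‖dualSum lam j z‖ ≤ 2 * gaussianSum * j := by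
  have hj' : (1 : ℝ) ≤ j := by exact_mod_cast hj
  have hg := one_le_gaussianSum
  refine (norm_tsum_cexp_neg_le (thetaParam_re_pos hlam hj)).trans ?_
  have h1 : 1 / √(thetaParam lam j z).re ≤ j := by
    rw [thetaParam_re, Real.sqrt_div (by linarith), Real.sqrt_sq (by linarith), one_div_div]
    exact div_le_self (by linarith) (Real.one_le_sqrt.2 hlam)
  nlinarith

theorem one_div_sqrt_thetaParam_inv_re_le {M : ℝ} (hlam : 1 ≤ lam) (hj : 1 ≤ j) (hz : 0 < z)
    (hlM : lam ≤ M) (hzM : z ≤ M) :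
    1 / √((thetaParam lam j z)⁻¹).re ≤ 2 * M := by
  have hj' : (1 : ℝ) ≤ j := by exact_mod_cast hj
  have hM : 0 < M := hz.trans_le hzM
  rw [thetaParam_inv_re hlam hj, ← Real.sqrt_one, ← Real.sqrt_div zero_le_one, one_div_div,
    Real.sqrt_le_left (by positivity)]
  rw [div_le_iff₀ (by linarith)]
  have h1 : lam ^ 2 / (j : ℝ) ^ 2 ≤ M ^ 2 :=
    (div_le_self (sq_nonneg _) (one_le_pow₀ hj')).trans (by gcongr)
  have h2 : z ^ 2 ≤ M ^ 2 := by gcongr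
  nlinarith [sq_nonneg M]

/-- Jacobi's transformation passes to the inverse parameter, whose real part is at least `1 / (4
M²)`, and the square root picked up has modulus at least `√(z / j)`. A common bound `M` for `lam`
and `z` serves both ranges `z ≤ lam` and `lam ≤ z`. -/
theorem norm_dualSum_le_sqrt {M : ℝ} (hlam : 1 ≤ lam) (hj : 1 ≤ j) (hz : 0 < z)
    (hlM : lam ≤ M) (hzM : z ≤ M) :
    ‖dualSum lam j z‖ ≤ 3 * gaussianSum * M * √(j / z) := by
  have hj' : (1 : ℝ) ≤ j := by exact_mod_cast hj
  have hg := one_le_gaussianSum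
  have hre := thetaParam_re_pos (z := z) hlam hj
  obtain ⟨x, hx, -, hxD⟩ := exists_sqrt_mul_tsum_cexp hre
  have hinv : 0 < ((thetaParam lam j z)⁻¹).re := by
    rw [thetaParam_inv_re hlam hj]
    positivity
  have h1 := norm_tsum_cexp_neg_le hinv
  rw [← hxD, norm_mul] at h1
  have h2 : √(z / j) ≤ ‖x‖ := by
    apply Real.sqrt_le_left (norm_nonneg x) |>.2
    rw [← norm_pow, hx]
    exact div_le_norm_thetaParam
  have h3 := one_div_sqrt_thetaParam_inv_re_le hlam hj hz hlM hzM
  have h4 : √(z / j) * √(j / z) = 1 := by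
    rw [← Real.sqrt_mul (by positivity)]
    rw [div_mul_div_cancel₀ (by positivity), div_self hz.ne', Real.sqrt_one]
  have h5 : √(z / j) * ‖dualSum lam j z‖ ≤ 3 * gaussianSum * M := by
    calc _ ≤ ‖x‖ * ‖dualSum lam j z‖ := by gcongr
      _ ≤ _ := h1
      _ ≤ gaussianSum * (1 + 2 * M) := by gcongr
      _ ≤ _ := by nlinarith
  calc ‖dualSum lam j z‖ = √(j / z) * (√(z / j) * ‖dualSum lam j z‖) := by
        rw [← mul_assoc, mul_comm √(j / z), h4, one_mul]
    _ ≤ √(j / z) * (3 * gaussianSum * M) := by gcongr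
    _ = _ := by ring

/-- The square root `(1 + i) / √2` of `i`. -/
noncomputable def sqrtI : ℂ := ((√2 / 2 : ℝ) : ℂ) * (1 + Complex.I)

theorem sqrtI_sq : sqrtI ^ 2 = Complex.I := by
  have h : ((√2 / 2 : ℝ) : ℂ) ^ 2 = 1 / 2 := by
    rw [← Complex.ofReal_pow, div_pow, Real.sq_sqrt (by norm_num)]
    norm_num
  rw [sqrtI, mul_pow, h]
  ring_nf
  rw [Complex.I_sq]
  ring

theorem sqrtI_re : sqrtI.re = √2 / 2 := by
  rw [sqrtI, Complex.re_ofReal_mul]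
  simp

theorem norm_sqrtI : ‖sqrtI‖ = 1 := by
  have h : ‖sqrtI‖ ^ 2 = 1 := by rw [← norm_pow, sqrtI_sq, Complex.norm_I]
  nlinarith [norm_nonneg sqrtI]

/-- The cross terms of `chirpParam * thetaParam` cancel: the product is `1 + lam² / (j² z²)`, so the
two parameters are inverse to each other up to a small relative error. -/
theorem norm_chirpParam_sub_le (hlam : 1 ≤ lam) (hj : 1 ≤ j) (hz : 0 < z) :
    ‖chirpParam lam j z - (thetaParam lam j z)⁻¹‖ ≤ lam ^ 2 / (j * z ^ 3) := by
  have hj' : (0 : ℝ) < j := by exact_mod_cast hj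
  have hre := thetaParam_re_pos (z := z) hlam hj
  have h0 : thetaParam lam j z ≠ 0 := fun h => by simp [h] at hre
  have h1 : chirpParam lam j z - (thetaParam lam j z)⁻¹ =
      ((lam ^ 2 / (z ^ 2 * (j : ℝ) ^ 2) : ℝ) : ℂ) * (thetaParam lam j z)⁻¹ := by
    rw [← sub_eq_zero]
    apply mul_right_cancel₀ h0
    rw [sub_mul, sub_mul, inv_mul_cancel₀ h0, mul_assoc, inv_mul_cancel₀ h0, thetaParam,
      chirpParam]
    have hjc : (j : ℂ) ≠ 0 := by exact_mod_cast hj'.ne'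
    have hzc : (z : ℂ) ≠ 0 := by exact_mod_cast hz.ne'
    push_cast
    field_simp
    ring_nf
    rw [Complex.I_sq]
    ring
  rw [h1, norm_mul, norm_inv, Complex.norm_real, Real.norm_of_nonneg (by positivity)]
  have h2 : ‖thetaParam lam j z‖⁻¹ ≤ (z / j)⁻¹ :=
    inv_anti₀ (by positivity) div_le_norm_thetaParam
  calc _ ≤ lam ^ 2 / (z ^ 2 * (j : ℝ) ^ 2) * (z / j)⁻¹ := by gcongr
    _ = _ := by field_simp

/-- Two approximations are made: `chirpParam` is replaced by the exact inverse of `thetaParam`, and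
the exact square root of `thetaParam` by that of its imaginary part `i z / j`. The assumption `lam ≤
z` keeps both parameters of real part at least `1 / (2 z²)`. -/
theorem norm_chirpSum_sub_le (hlam : 1 ≤ lam) (hj : 1 ≤ j) (hz : lam ≤ z) :
    ‖chirpSum lam j z - sqrtI * √(z / j) * dualSum lam j z‖ ≤
      25 * gaussianSum * lam ^ 2 / j := by
  have hj' : (1 : ℝ) ≤ j := by exact_mod_cast hj
  have hg := one_le_gaussianSum
  have hz1 : 1 ≤ z := hlam.trans hz
  have hz0 : 0 < z := by linarith
  have hre := thetaParam_re_pos (z := z) hlam hj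
  obtain ⟨x, hx, hxre, hxD⟩ := exists_sqrt_mul_tsum_cexp hre
  have ha : (0 : ℝ) < 1 / (2 * z ^ 2) := by positivity
  have hu : 1 / (2 * z ^ 2) ≤ (chirpParam lam j z).re := by
    rw [chirpParam_re, div_le_div_iff₀ (by positivity) (by positivity)]
    nlinarith [sq_nonneg z]
  have hv : 1 / (2 * z ^ 2) ≤ ((thetaParam lam j z)⁻¹).re := by
    rw [thetaParam_inv_re hlam hj, div_le_div_iff₀ (by positivity) (by positivity)]
    have h1 : lam ^ 2 / (j : ℝ) ^ 2 ≤ z ^ 2 :=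
      (div_le_self (sq_nonneg _) (one_le_pow₀ hj')).trans (by gcongr)
    nlinarith [sq_nonneg z]
  have h1 := norm_tsum_cexp_sub_le ha hu hv
  have h2 : ‖chirpSum lam j z - x * dualSum lam j z‖ ≤ 20 * gaussianSum * lam ^ 2 / j := by
    rw [dualSum, hxD]
    refine h1.trans ?_
    have e1 : √(1 / (2 * z ^ 2) / 2) = 1 / (2 * z) := by
      rw [show 1 / (2 * z ^ 2) / 2 = (1 / (2 * z)) ^ 2 by field_simp,
        Real.sqrt_sq (by positivity)]
    rw [e1, one_div_one_div, one_div_one_div]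
    have hp := Real.pi_lt_d2
    calc _ ≤ 3.15 * (lam ^ 2 / (j * z ^ 3)) * (2 * z ^ 2 * (gaussianSum * (3 * z))) := by
          gcongr
          · exact norm_chirpParam_sub_le hlam hj hz0
          · linarith
      _ = 18.9 * gaussianSum * lam ^ 2 / j := by
          field_simp
          norm_num
      _ ≤ _ := by
          gcongr
          norm_num
  have h3 : ‖x * dualSum lam j z - sqrtI * √(z / j) * dualSum lam j z‖ ≤
      5 * gaussianSum * lam ^ 2 / j := by
    rw [← sub_mul, norm_mul]
    set c : ℂ := sqrtI * √(z / j) with hc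
    have hc2 : c ^ 2 = ((z / j : ℝ) : ℂ) * Complex.I := by
      rw [hc, mul_pow, sqrtI_sq, ← Complex.ofReal_pow, Real.sq_sqrt (by positivity), mul_comm]
    have hcre : c.re = √2 / 2 * √(z / j) := by
      rw [hc, Complex.re_mul_ofReal, sqrtI_re]
    -- The squares of the two roots differ by the real part of `thetaParam`. As both roots have
    -- nonnegative real part, `x + c` is not small, so `x - c` is.
    have e1 : (x - c) * (x + c) = ((lam / (j : ℝ) ^ 2 : ℝ) : ℂ) := by
      have : (x - c) * (x + c) = x ^ 2 - c ^ 2 := by ring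
      rw [this, hx, hc2, thetaParam]
      ring
    have e2 : √2 / 2 * √(z / j) ≤ ‖x + c‖ := by
      rw [← hcre]
      refine le_trans ?_ (Complex.re_le_norm _)
      rw [Complex.add_re]
      linarith
    have e3 : ‖x - c‖ * ‖x + c‖ = lam / (j : ℝ) ^ 2 := by
      rw [← norm_mul, e1, Complex.norm_real, Real.norm_of_nonneg (by positivity)]
    have hs : 0 < √(z / j) := Real.sqrt_pos.2 (by positivity)
    have e4 : ‖x - c‖ * √(z / j) ≤ 1.5 * (lam / (j : ℝ) ^ 2) := by
      have e5 : ‖x - c‖ * (√2 / 2 * √(z / j)) ≤ lam / (j : ℝ) ^ 2 := by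
        rw [← e3]
        gcongr
      have e6 : (4 / 3 : ℝ) ≤ √2 := by
        apply Real.le_sqrt_of_sq_le
        norm_num
      have : 0 ≤ ‖x - c‖ * √(z / j) := by positivity
      nlinarith
    have e7 := norm_dualSum_le_sqrt hlam hj hz0 hz le_rfl
    have e8 : √(j / z) * (z * √(j / z)) = j := by
      rw [mul_left_comm, Real.mul_self_sqrt (by positivity)]
      field_simp
    have e9 : z * √(j / z) = j * √(z / j) := by
      rw [Real.sqrt_div (by positivity), Real.sqrt_div (by positivity)]
      have : √z ^ 2 = z := Real.sq_sqrt hz0.le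
      have : √(j : ℝ) ^ 2 = j := Real.sq_sqrt (by positivity)
      have : 0 < √z := Real.sqrt_pos.2 hz0
      have : 0 < √(j : ℝ) := Real.sqrt_pos.2 (by linarith)
      field_simp
      nlinarith
    calc ‖x - c‖ * ‖dualSum lam j z‖ ≤ ‖x - c‖ * (3 * gaussianSum * z * √(j / z)) := by gcongr
      _ = 3 * gaussianSum * j * (‖x - c‖ * √(z / j)) := by
          rw [mul_assoc _ z, e9]
          ring
      _ ≤ 3 * gaussianSum * j * (1.5 * (lam / (j : ℝ) ^ 2)) := by gcongr
      _ = 4.5 * gaussianSum * lam / j := by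
          field_simp
          norm_num
      _ ≤ 5 * gaussianSum * lam ^ 2 / j := by
          gcongr
          · norm_num
          · nlinarith
  calc _ ≤ 20 * gaussianSum * lam ^ 2 / j + 5 * gaussianSum * lam ^ 2 / j :=
        (norm_sub_le_norm_sub_add_norm_sub _ _ _).trans (add_le_add h2 h3)
    _ = _ := by ring

end

/-! ### The Fejér kernel as a detector of nearness to integers. -/

/-- The additive character `exp (2 π i x)`. -/
noncomputable def addExp (x : ℝ) : ℂ := Complex.exp ((2 * Real.pi * x : ℝ) * Complex.I)

theorem norm_addExp (x : ℝ) : ‖addExp x‖ = 1 := Complex.norm_exp_ofReal_mul_I _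

theorem addExp_sub_intCast (x : ℝ) (n : ℤ) : addExp (x - n) = addExp x := by
  rw [addExp, addExp, Complex.exp_eq_exp_iff_exists_int]
  refine ⟨-n, ?_⟩
  push_cast
  ring

theorem addExp_pow (x : ℝ) (j : ℕ) : addExp x ^ j = addExp (j * x) := by
  rw [addExp, addExp, ← Complex.exp_nat_mul]
  congr 1
  push_cast
  ring

theorem abs_sub_round_le_norm_addExp_sub_one (x : ℝ) :
    4 * |x - round x| ≤ ‖addExp x - 1‖ := by
  rw [← addExp_sub_intCast x (round x)]
  set t := x - round x with ht
  have ht2 : |t| ≤ 1 / 2 := abs_sub_round x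
  rw [addExp, mul_comm _ Complex.I, Complex.norm_exp_I_mul_ofReal_sub_one, norm_mul,
    Real.norm_eq_abs, Real.norm_eq_abs]
  have e : 2 * Real.pi * t / 2 = Real.pi * t := by ring
  have h1 : |Real.pi * t| ≤ Real.pi / 2 := by
    rw [abs_mul, abs_of_pos Real.pi_pos]
    nlinarith [Real.pi_pos]
  have h2 := Real.mul_abs_le_abs_sin h1
  rw [abs_mul, abs_of_pos Real.pi_pos] at h2
  have h3 : 2 / Real.pi * (Real.pi * |t|) = 2 * |t| := by
    field_simp
  rw [e, abs_of_pos (by norm_num : (0 : ℝ) < 2)]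
  linarith

/-- The one-sided Fejér kernel `∑_{1 ≤ j < J} (1 - j / J) exp (2 π i j x)`. -/
noncomputable def halfFejer (J : ℕ) (x : ℝ) : ℂ :=
  ∑ j ∈ Finset.Ico 1 J, ((1 - (j : ℝ) / J : ℝ) : ℂ) * addExp (j * x)

theorem sum_sub_mul_pow (w : ℂ) (J : ℕ) :
    ∑ j ∈ Finset.Ico 1 J, ((J : ℂ) - j) * w ^ j =
      ∑ m ∈ Finset.range J, ∑ j ∈ Finset.Icc 1 m, w ^ j := by
  induction J with
  | zero => simp
  | succ J ih =>
    rw [Finset.sum_range_succ, ← ih]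
    rcases Nat.eq_zero_or_pos J with h | h
    · subst h
      simp
    · rw [Finset.sum_Ico_succ_top h]
      have h1 : Finset.Icc 1 J = insert J (Finset.Ico 1 J) := by
        ext x
        simp only [Finset.mem_Icc, Finset.mem_insert, Finset.mem_Ico]
        omega
      rw [h1, Finset.sum_insert (by simp), ← add_assoc, add_right_comm, ← Finset.sum_add_distrib]
      congr 1
      · refine Finset.sum_congr rfl fun j _ => ?_
        push_cast
        ring
      · push_cast
        ring

theorem mul_halfFejer (J : ℕ) (x : ℝ) :
    (J : ℂ) * halfFejer J x =
      ∑ m ∈ Finset.range J, ∑ j ∈ Finset.Icc 1 m, addExp x ^ j := by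
  rcases Nat.eq_zero_or_pos J with h | h
  · subst h
    simp
  · have hJ : (J : ℂ) ≠ 0 := by exact_mod_cast h.ne'
    rw [← sum_sub_mul_pow, halfFejer, Finset.mul_sum]
    refine Finset.sum_congr rfl fun j _ => ?_
    rw [addExp_pow, ← mul_assoc]
    congr 1
    push_cast
    field_simp

theorem norm_sum_pow_sq {w : ℂ} (hw : ‖w‖ = 1) (J : ℕ) :
    ‖∑ j ∈ Finset.range J, w ^ j‖ ^ 2 =
      J + 2 * (∑ m ∈ Finset.range J, ∑ j ∈ Finset.Icc 1 m, w ^ j).re := by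
  induction J with
  | zero => simp
  | succ J ih =>
    have hconj : w ^ J * (starRingEnd ℂ) (∑ j ∈ Finset.range J, w ^ j) =
        ∑ j ∈ Finset.Icc 1 J, w ^ j := by
      rw [map_sum, Finset.mul_sum]
      refine Finset.sum_bij' (fun k _ => J - k) (fun j _ => J - j) ?_ ?_ ?_ ?_ ?_
      · intro k hk
        simp only [Finset.mem_range, Finset.mem_Icc] at *
        omega
      · intro k hk
        simp only [Finset.mem_range, Finset.mem_Icc] at *
        omega
      · intro k hk
        simp only [Finset.mem_range] at *
        omega
      · intro k hk
        simp only [Finset.mem_Icc] at *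
        omega
      · intro k hk
        simp only [Finset.mem_range] at hk
        have h1 : w ^ J = w ^ (J - k) * w ^ k := by
          rw [← pow_add]
          congr 1
          omega
        rw [h1, map_pow, mul_assoc, ← mul_pow, Complex.mul_conj, Complex.normSq_eq_norm_sq, hw]
        simp
    rw [Finset.sum_range_succ, Finset.sum_range_succ, ← hconj, Complex.sq_norm,
      Complex.normSq_add, ← Complex.sq_norm, ih, ← Complex.sq_norm, norm_pow, hw, Complex.add_re]
    have h2 : (w ^ J * (starRingEnd ℂ) (∑ j ∈ Finset.range J, w ^ j)).re =
        ((∑ j ∈ Finset.range J, w ^ j) * (starRingEnd ℂ) (w ^ J)).re := by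
      rw [← Complex.conj_re, map_mul, Complex.conj_conj, mul_comm]
    rw [h2]
    push_cast
    ring

theorem mul_fejer {J : ℕ} (x : ℝ) :
    (J : ℝ) * (1 + 2 * (halfFejer J x).re) = ‖∑ j ∈ Finset.range J, addExp x ^ j‖ ^ 2 := by
  rw [norm_sum_pow_sq (norm_addExp x), ← mul_halfFejer]
  have : ((J : ℂ) * halfFejer J x).re = J * (halfFejer J x).re := by
    rw [← Complex.ofReal_natCast, Complex.re_ofReal_mul]
  rw [this]
  ring

theorem fejer_nonneg {J : ℕ} (hJ : 1 ≤ J) (x : ℝ) : 0 ≤ 1 + 2 * (halfFejer J x).re := by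
  have hJ' : (0 : ℝ) < J := by exact_mod_cast hJ
  have h := mul_fejer (J := J) x
  have h2 : 0 ≤ (J : ℝ) * (1 + 2 * (halfFejer J x).re) := by
    rw [h]
    positivity
  exact nonneg_of_mul_nonneg_right h2 hJ'

/-- For `j < J` the points `addExp (j * x)` stay within angle `π / 4` of `1`, so the geometric sum
whose square is `J` times the kernel has real part at least `J / √2`. -/
theorem half_le_fejer {J : ℕ} (hJ : 1 ≤ J) {x : ℝ} {n : ℤ} (hx : |x - n| ≤ 1 / (8 * J)) :
    (J : ℝ) / 2 ≤ 1 + 2 * (halfFejer J x).re := by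
  have hJ' : (0 : ℝ) < J := by exact_mod_cast hJ
  have h := mul_fejer (J := J) x
  have h1 : ∀ j ∈ Finset.range J, √2 / 2 ≤ (addExp x ^ j).re := by
    intro j hj
    rw [← addExp_sub_intCast x n, addExp_pow, addExp, Complex.exp_ofReal_mul_I_re,
      ← Real.cos_pi_div_four, ← Real.cos_abs (2 * Real.pi * _)]
    apply Real.cos_le_cos_of_nonneg_of_le_pi (abs_nonneg _) (by linarith [Real.pi_pos])
    rw [abs_mul, abs_of_pos (by positivity : 0 < 2 * Real.pi), abs_mul, Nat.abs_cast]
    have hj' : (j : ℝ) ≤ J := by exact_mod_cast (Finset.mem_range.1 hj).le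
    calc 2 * Real.pi * (j * |x - n|) ≤ 2 * Real.pi * (J * (1 / (8 * J))) := by gcongr
      _ = Real.pi / 4 := by
        field_simp
        norm_num
  have h2 : (J : ℝ) * (√2 / 2) ≤ ‖∑ j ∈ Finset.range J, addExp x ^ j‖ := by
    refine le_trans ?_ (Complex.re_le_norm _)
    rw [Complex.re_sum]
    simpa using Finset.card_nsmul_le_sum _ _ _ h1
  have h3 : (J : ℝ) ^ 2 / 2 ≤ ‖∑ j ∈ Finset.range J, addExp x ^ j‖ ^ 2 := by
    calc (J : ℝ) ^ 2 / 2 = (J * (√2 / 2)) ^ 2 := by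
          rw [mul_pow, div_pow, Real.sq_sqrt (by norm_num)]
          ring
      _ ≤ _ := by gcongr
  rw [← h] at h3
  have h4 : (J : ℝ) * (J / 2) ≤ J * (1 + 2 * (halfFejer J x).re) := by linarith
  exact le_of_mul_le_mul_left h4 hJ'

theorem norm_sum_Icc_pow_le (x : ℝ) (m : ℕ) (hx : 0 < |x - round x|) :
    ‖∑ j ∈ Finset.Icc 1 m, addExp x ^ j‖ ≤ 1 / (2 * |x - round x|) := by
  have h1 := abs_sub_round_le_norm_addExp_sub_one x
  have h2 : (∑ j ∈ Finset.Icc 1 m, addExp x ^ j) * (addExp x - 1) =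
      addExp x * (addExp x ^ m - 1) := by
    rw [← Finset.Ico_add_one_right_eq_Icc, ← geom_sum_mul, Finset.sum_Ico_eq_sum_range,
      ← mul_assoc, Finset.mul_sum]
    congr 1
    simp [pow_add]
  have h3 : ‖∑ j ∈ Finset.Icc 1 m, addExp x ^ j‖ * ‖addExp x - 1‖ ≤ 2 := by
    rw [← norm_mul, h2, norm_mul, norm_addExp, one_mul]
    refine (norm_sub_le _ _).trans ?_
    rw [norm_pow, norm_addExp]
    norm_num
  rw [le_div_iff₀ (by positivity)]
  have := norm_nonneg (∑ j ∈ Finset.Icc 1 m, addExp x ^ j)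
  nlinarith

theorem norm_halfFejer_le_of_forall {J : ℕ} (hJ : 1 ≤ J) {x B : ℝ}
    (h : ∀ m < J, ‖∑ j ∈ Finset.Icc 1 m, addExp x ^ j‖ ≤ B) : ‖halfFejer J x‖ ≤ B := by
  have hJ' : (0 : ℝ) < J := by exact_mod_cast hJ
  have h1 : (J : ℝ) * ‖halfFejer J x‖ ≤ J * B := by
    have e : (J : ℝ) * ‖halfFejer J x‖ = ‖(J : ℂ) * halfFejer J x‖ := by
      rw [norm_mul, Complex.norm_natCast]
    rw [e, mul_halfFejer]
    refine (norm_sum_le _ _).trans ?_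
    simpa using Finset.sum_le_card_nsmul _ _ _ fun m hm => h m (Finset.mem_range.1 hm)
  exact le_of_mul_le_mul_left h1 hJ'

theorem norm_halfFejer_le {J : ℕ} (hJ : 1 ≤ J) (x : ℝ) : ‖halfFejer J x‖ ≤ J := by
  refine norm_halfFejer_le_of_forall hJ fun m hm => (norm_sum_le _ _).trans ?_
  simp only [norm_pow, norm_addExp, one_pow, Finset.sum_const, Nat.card_Icc, nsmul_eq_mul]
  rw [mul_one]
  exact_mod_cast (by omega : m + 1 - 1 ≤ J)

/-- With `d` the distance from `x` to the nearest integer, the kernel is at most `min J (1 / (2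
d))`. Writing this minimum as a number of scales `m` lets a later sum over `h` be exchanged with the
sum over `m` and read as counts of hits. The factor `2` pays for the floor. -/
theorem norm_halfFejer_le_card {J : ℕ} (hJ : 1 ≤ J) (x : ℝ) :
    ‖halfFejer J x‖ ≤
      2 * ((Finset.Icc 1 J).filter fun m : ℕ => |x - round x| ≤ 1 / (2 * m)).card := by
  set d := |x - round x| with hd
  rcases (abs_nonneg (x - round x)).eq_or_lt with h0 | h0
  · have : (Finset.Icc 1 J).filter (fun m : ℕ => d ≤ 1 / (2 * (m : ℝ))) = Finset.Icc 1 J := by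
      apply Finset.filter_true_of_mem
      intro m _
      rw [hd, ← h0]
      positivity
    rw [this]
    have h1 := norm_halfFejer_le hJ x
    simp only [Nat.card_Icc, Nat.add_sub_cancel]
    linarith [norm_nonneg (halfFejer J x)]
  · have hd2 : d ≤ 1 / 2 := abs_sub_round x
    have hd0 : 0 < d := h0
    set M := min J ⌊1 / (2 * d)⌋₊ with hM
    have hsub : Finset.Icc 1 M ⊆
        (Finset.Icc 1 J).filter (fun m : ℕ => d ≤ 1 / (2 * (m : ℝ))) := by
      intro m hm
      obtain ⟨h1, h2⟩ := Finset.mem_Icc.1 hm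
      refine Finset.mem_filter.2 ⟨Finset.mem_Icc.2 ⟨h1, h2.trans (min_le_left _ _)⟩, ?_⟩
      have h3 : (m : ℝ) ≤ 1 / (2 * d) :=
        (Nat.le_floor_iff (by positivity)).1 (h2.trans (min_le_right _ _))
      have hm' : (0 : ℝ) < m := by exact_mod_cast h1
      rw [le_div_iff₀ (by positivity)] at h3 ⊢
      linarith
    have hcard := Finset.card_le_card hsub
    rw [Nat.card_Icc, Nat.add_sub_cancel] at hcard
    have hcard' : (M : ℝ) ≤
        ((Finset.Icc 1 J).filter (fun m : ℕ => d ≤ 1 / (2 * (m : ℝ)))).card := by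
      exact_mod_cast hcard
    refine le_trans ?_ (mul_le_mul_of_nonneg_left hcard' (by norm_num))
    rcases min_choice J ⌊1 / (2 * d)⌋₊ with h | h
    · rw [hM, h]
      linarith [norm_halfFejer_le hJ x, norm_nonneg (halfFejer J x)]
    · rw [hM, h]
      have h1 : ‖halfFejer J x‖ ≤ 1 / (2 * d) :=
        norm_halfFejer_le_of_forall hJ fun m _ => norm_sum_Icc_pow_le x m h0
      have h2 : 1 ≤ 1 / (2 * d) := by
        rw [le_div_iff₀ (by positivity)]
        linarith
      have h3 : (1 : ℝ) ≤ ⌊1 / (2 * d)⌋₊ := by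
        exact_mod_cast (Nat.le_floor_iff (by positivity)).2 (by exact_mod_cast h2)
      have h4 := Nat.lt_floor_add_one (1 / (2 * d))
      linarith

/-! ### The sum of kernels over `h` and its dual almost periodic form. -/

/-- The almost periodic function
`∑_{1 ≤ j < J} (1 - j / J) j ^ (-1/2) exp (π i j z) ∑_l exp (-π lam l² / j² - π i z l² / j)`. -/
noncomputable def dualForm (lam : ℝ) (J : ℕ) (z : ℝ) : ℂ :=
  ∑ j ∈ Finset.Ico 1 J, (((1 - (j : ℝ) / J) / √(j : ℝ) : ℝ) : ℂ) * addExp (j * (z / 2)) *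
    dualSum lam j z

/-- The phase `(z + h² / z) / 2`, equal to `s` when `z` is a root of `z² - 2 s z + h²`. -/
noncomputable def rootPhase (h : ℤ) (z : ℝ) : ℝ := (z + (h : ℝ) ^ 2 / z) / 2

/-- The Gaussian-weighted sum over `h` of the half Fejér kernel at `rootPhase h z`. -/
noncomputable def kernelForm (lam : ℝ) (J : ℕ) (z : ℝ) : ℂ :=
  ∑' h : ℤ, (Real.exp (-Real.pi * (lam / z ^ 2) * (h : ℝ) ^ 2) : ℂ) *
    halfFejer J (rootPhase h z)

section
variable {lam : ℝ} {J : ℕ} {z : ℝ}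

theorem fejerCoeff_nonneg {j : ℕ} (hj : j ∈ Finset.Ico 1 J) : 0 ≤ 1 - (j : ℝ) / J := by
  obtain ⟨h1, h2⟩ := Finset.mem_Ico.1 hj
  have h3 : (j : ℝ) ≤ J := by exact_mod_cast h2.le
  have : (j : ℝ) / J ≤ 1 := div_le_one_of_le₀ h3 (by positivity)
  linarith

theorem fejerCoeff_le_one (j J : ℕ) : 1 - (j : ℝ) / J ≤ 1 := by
  have : 0 ≤ (j : ℝ) / J := by positivity
  linarith

theorem weight_mul_addExp (lam : ℝ) (j : ℕ) (z : ℝ) (h : ℤ) :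
    (Real.exp (-Real.pi * (lam / z ^ 2) * (h : ℝ) ^ 2) : ℂ) * addExp (j * rootPhase h z) =
      addExp (j * (z / 2)) * Complex.exp (-Real.pi * chirpParam lam j z * (h : ℂ) ^ 2) := by
  rw [addExp, addExp, Complex.ofReal_exp, ← Complex.exp_add, ← Complex.exp_add, chirpParam,
    rootPhase]
  congr 1
  push_cast
  ring

theorem kernelForm_eq (hlam : 0 < lam) (hz : 0 < z) :
    kernelForm lam J z = ∑ j ∈ Finset.Ico 1 J, ((1 - (j : ℝ) / J : ℝ) : ℂ) *
      addExp (j * (z / 2)) * chirpSum lam j z := by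
  have hre : ∀ j, 0 < (chirpParam lam j z).re := fun j => by
    rw [chirpParam_re]
    positivity
  rw [kernelForm]
  have h1 : ∀ h : ℤ, (Real.exp (-Real.pi * (lam / z ^ 2) * (h : ℝ) ^ 2) : ℂ) *
      halfFejer J (rootPhase h z) = ∑ j ∈ Finset.Ico 1 J, ((1 - (j : ℝ) / J : ℝ) : ℂ) *
        addExp (j * (z / 2)) * Complex.exp (-Real.pi * chirpParam lam j z * (h : ℂ) ^ 2) := by
    intro h
    rw [halfFejer, Finset.mul_sum]
    refine Finset.sum_congr rfl fun j _ => ?_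
    rw [mul_left_comm, weight_mul_addExp]
    ring
  simp_rw [h1]
  rw [Summable.tsum_finsetSum fun j _ => (summable_cexp_neg_mul_int_sq (hre j)).mul_left _]
  refine Finset.sum_congr rfl fun j _ => ?_
  rw [tsum_mul_left, chirpSum]

theorem sum_inv_le_one_add_log (J : ℕ) :
    ∑ j ∈ Finset.Icc 1 J, (1 : ℝ) / j ≤ 1 + Real.log J := by
  have h := harmonic_le_one_add_log J
  rw [harmonic_eq_sum_Icc] at h
  push_cast at h
  simpa only [one_div] using h

/-- Each `j` contributes an error of order `lam² / j` by `norm_chirpSum_sub_le`, and the harmonic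
sum costs only a logarithm. -/
theorem norm_kernelForm_sub_le (hlam : 1 ≤ lam) (hz : lam ≤ z) :
    ‖kernelForm lam J z - sqrtI * √z * dualForm lam J z‖ ≤
      25 * gaussianSum * lam ^ 2 * (1 + Real.log J) := by
  have hg := one_le_gaussianSum
  have hz0 : 0 < z := by linarith
  rw [kernelForm_eq (by linarith) hz0, dualForm, Finset.mul_sum, ← Finset.sum_sub_distrib]
  calc _ ≤ ∑ j ∈ Finset.Ico 1 J, 25 * gaussianSum * lam ^ 2 * (1 / (j : ℝ)) := by
        refine (norm_sum_le _ _).trans (Finset.sum_le_sum fun j hj => ?_)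
        have hj1 := (Finset.mem_Ico.1 hj).1
        have e : ((1 - (j : ℝ) / J : ℝ) : ℂ) * addExp (j * (z / 2)) * chirpSum lam j z -
            sqrtI * √z * ((((1 - (j : ℝ) / J) / √(j : ℝ) : ℝ) : ℂ) * addExp (j * (z / 2)) *
              dualSum lam j z) = ((1 - (j : ℝ) / J : ℝ) : ℂ) * addExp (j * (z / 2)) *
            (chirpSum lam j z - sqrtI * √(z / j) * dualSum lam j z) := by
          rw [Real.sqrt_div hz0.le, Complex.ofReal_div, Complex.ofReal_div]
          ring
        rw [e, norm_mul, norm_mul, norm_addExp, Complex.norm_real,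
          Real.norm_of_nonneg (fejerCoeff_nonneg hj), mul_one]
        calc _ ≤ 1 * (25 * gaussianSum * lam ^ 2 / j) := by
              gcongr
              · exact fejerCoeff_le_one j J
              · exact norm_chirpSum_sub_le hlam hj1 hz
          _ = _ := by ring
    _ = 25 * gaussianSum * lam ^ 2 * ∑ j ∈ Finset.Ico 1 J, 1 / (j : ℝ) := by
        rw [Finset.mul_sum]
    _ ≤ 25 * gaussianSum * lam ^ 2 * ∑ j ∈ Finset.Icc 1 J, 1 / (j : ℝ) := by
        gcongr
        exact Finset.Ico_subset_Icc_self
    _ ≤ _ := by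
        gcongr
        exact sum_inv_le_one_add_log J

theorem norm_dualForm_le_sum (lam : ℝ) (J : ℕ) (z : ℝ) :
    ‖dualForm lam J z‖ ≤ ∑ j ∈ Finset.Ico 1 J, 1 / √(j : ℝ) * ‖dualSum lam j z‖ := by
  rw [dualForm]
  refine (norm_sum_le _ _).trans (Finset.sum_le_sum fun j hj => ?_)
  rw [norm_mul, norm_mul, norm_addExp, mul_one, Complex.norm_real,
    Real.norm_of_nonneg (div_nonneg (fejerCoeff_nonneg hj) (Real.sqrt_nonneg _))]
  gcongr
  exact fejerCoeff_le_one j J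

theorem norm_dualForm_sq_le (hlam : 1 ≤ lam) (J : ℕ) (z : ℝ) :
    ‖dualForm lam J z‖ ^ 2 ≤ 4 * gaussianSum ^ 2 * J ^ 3 := by
  have hg := one_le_gaussianSum
  have h1 : ‖dualForm lam J z‖ ≤ 2 * gaussianSum * (J * √J) := by
    refine (norm_dualForm_le_sum lam J z).trans ?_
    calc _ ≤ ∑ j ∈ Finset.Ico 1 J, 2 * gaussianSum * √J := by
          refine Finset.sum_le_sum fun j hj => ?_
          obtain ⟨hj1, hj2⟩ := Finset.mem_Ico.1 hj
          have hj0 : (0 : ℝ) < j := by exact_mod_cast hj1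
          calc _ ≤ 1 / √(j : ℝ) * (2 * gaussianSum * j) := by
                gcongr
                exact norm_dualSum_le hlam hj1
            _ = 2 * gaussianSum * √j := by
                rw [mul_left_comm, one_div_mul_eq_div, Real.div_sqrt]
            _ ≤ _ := by gcongr
      _ ≤ J * (2 * gaussianSum * √J) := by
          rw [Finset.sum_const, nsmul_eq_mul, Nat.card_Ico]
          gcongr
          omega
      _ = _ := by ring
  calc _ ≤ (2 * gaussianSum * (J * √J)) ^ 2 := by gcongr
    _ = _ := by
      rw [mul_pow, mul_pow, mul_pow, Real.sq_sqrt (by positivity)]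
      ring

/-- The coefficient `j ^ (-1/2)` cancels the `√j` in `norm_dualSum_le_sqrt`, so all `j` contribute
the same amount `lam / √z`. -/
theorem norm_dualForm_sq_le_div (hlam : 1 ≤ lam) (J : ℕ) (hz : 0 < z) (hzl : z ≤ lam) :
    ‖dualForm lam J z‖ ^ 2 ≤ 9 * gaussianSum ^ 2 * lam ^ 2 * J ^ 2 / z := by
  have hg := one_le_gaussianSum
  have h1 : ‖dualForm lam J z‖ ≤ 3 * gaussianSum * lam * J / √z := by
    refine (norm_dualForm_le_sum lam J z).trans ?_
    calc _ ≤ ∑ j ∈ Finset.Ico 1 J, 3 * gaussianSum * lam / √z := by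
          refine Finset.sum_le_sum fun j hj => ?_
          obtain ⟨hj1, hj2⟩ := Finset.mem_Ico.1 hj
          have hj0 : (0 : ℝ) < √j := Real.sqrt_pos.2 (by exact_mod_cast hj1)
          calc _ ≤ 1 / √(j : ℝ) * (3 * gaussianSum * lam * √(j / z)) := by
                gcongr
                exact norm_dualSum_le_sqrt hlam hj1 hz le_rfl hzl
            _ = 3 * gaussianSum * lam / √z := by
                rw [Real.sqrt_div (by positivity)]
                field_simp
            _ ≤ _ := le_rfl
      _ ≤ J * (3 * gaussianSum * lam / √z) := by
          rw [Finset.sum_const, nsmul_eq_mul, Nat.card_Ico]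
          gcongr
          omega
      _ = _ := by ring
  calc _ ≤ (3 * gaussianSum * lam * J / √z) ^ 2 := by gcongr
    _ = _ := by
      rw [div_pow, Real.sq_sqrt hz.le]
      ring

theorem conj_dualSum (lam : ℝ) (j : ℕ) (z : ℝ) :
    (starRingEnd ℂ) (dualSum lam j z) = dualSum lam j (-z) := by
  rw [dualSum, dualSum, Complex.conj_tsum]
  refine tsum_congr fun l => ?_
  rw [← Complex.exp_conj]
  congr 1
  simp only [thetaParam, map_mul, map_neg, map_add, map_pow, Complex.conj_ofReal, Complex.conj_I,
    map_intCast]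
  push_cast
  ring

theorem conj_addExp (x : ℝ) : (starRingEnd ℂ) (addExp x) = addExp (-x) := by
  rw [addExp, addExp, ← Complex.exp_conj]
  congr 1
  rw [map_mul, Complex.conj_ofReal, Complex.conj_I]
  push_cast
  ring

theorem norm_dualForm_neg (lam : ℝ) (J : ℕ) (z : ℝ) :
    ‖dualForm lam J (-z)‖ = ‖dualForm lam J z‖ := by
  rw [← Complex.norm_conj (dualForm lam J z)]
  congr 1
  rw [dualForm, dualForm, map_sum]
  refine Finset.sum_congr rfl fun j _ => ?_
  rw [map_mul, map_mul, Complex.conj_ofReal, conj_dualSum, conj_addExp]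
  congr 3
  ring

theorem continuous_addExp : Continuous addExp := by
  unfold addExp
  fun_prop

theorem continuous_dualSum (hlam : 1 ≤ lam) {j : ℕ} (hj : 1 ≤ j) :
    Continuous (dualSum lam j) := by
  unfold dualSum
  have hre : 0 < lam / (j : ℝ) ^ 2 := by
    have := thetaParam_re_pos (z := 0) hlam hj
    rwa [thetaParam_re] at this
  refine continuous_tsum (fun l => ?_) (summable_exp_neg_mul_int_sq hre) fun l z => ?_
  · unfold thetaParam
    fun_prop
  · rw [norm_cexp_neg_pi_mul, thetaParam_re]

theorem continuous_dualForm (hlam : 1 ≤ lam) (J : ℕ) : Continuous (dualForm lam J) := by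
  unfold dualForm
  refine continuous_finsetSum _ fun j hj => ?_
  refine (continuous_const.mul (continuous_addExp.comp (by fun_prop))).mul
    (continuous_dualSum hlam (Finset.mem_Ico.1 hj).1)

end

/-! ### Monotonicity of Gaussian mean squares. -/

open MeasureTheory Filter Topology in
theorem integral_exp_neg_mul_sq_mul_cos {b : ℝ} (hb : 0 < b) (c : ℝ) :
    ∫ z : ℝ, Real.exp (-b * z ^ 2) * Real.cos (c * z) =
      √(Real.pi / b) * Real.exp (-c ^ 2 / (4 * b)) := by
  have h := fourierIntegral_gaussian (b := (b : ℂ)) (by simpa using hb) (c : ℂ)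
  have hint : Integrable fun x : ℝ => Complex.exp (Complex.I * c * x) *
      Complex.exp (-(b : ℂ) * (x : ℂ) ^ 2) := by
    have := GaussianFourier.integrable_cexp_neg_mul_sq_add_real_mul_I (b := (b : ℂ))
      (by simpa using hb) 0
    have h2 := this.bdd_mul (f := fun x : ℝ => Complex.exp (Complex.I * c * x)) (c := 1)
      (by fun_prop) (Eventually.of_forall fun x => by
        rw [show Complex.I * c * x = ((c * x : ℝ) : ℂ) * Complex.I by push_cast; ring,
          Complex.norm_exp_ofReal_mul_I])
    simpa using h2
  have h3 := congrArg Complex.re h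
  rw [← Complex.reCLM_apply, ← ContinuousLinearMap.integral_comp_comm _ hint] at h3
  have hl : ∀ x : ℝ, Complex.reCLM (Complex.exp (Complex.I * c * x) *
      Complex.exp (-(b : ℂ) * (x : ℂ) ^ 2)) = Real.exp (-b * x ^ 2) * Real.cos (c * x) := by
    intro x
    rw [show Complex.I * c * x = ((c * x : ℝ) : ℂ) * Complex.I by push_cast; ring,
      show -(b : ℂ) * (x : ℂ) ^ 2 = ((-b * x ^ 2 : ℝ) : ℂ) by push_cast; ring,
      ← Complex.ofReal_exp, Complex.reCLM_apply, Complex.re_mul_ofReal,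
      Complex.exp_ofReal_mul_I_re, mul_comm]
  simp_rw [hl] at h3
  rw [h3, show (Real.pi : ℂ) / b = ((Real.pi / b : ℝ) : ℂ) by push_cast; ring,
    show -(c : ℂ) ^ 2 / (4 * b) = ((-c ^ 2 / (4 * b) : ℝ) : ℂ) by push_cast; ring,
    show (1 / 2 : ℂ) = ((1 / 2 : ℝ) : ℂ) by norm_num,
    ← Complex.ofReal_cpow (by positivity), ← Complex.ofReal_exp, ← Complex.ofReal_mul,
    Complex.ofReal_re, Real.sqrt_eq_rpow]

theorem norm_sum_mul_addExp_sq {ι : Type*} (S : Finset ι) (a w : ι → ℝ) (z : ℝ) :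
    ‖∑ i ∈ S, (a i : ℂ) * addExp (w i * z)‖ ^ 2 =
      ∑ i ∈ S, ∑ k ∈ S, a i * a k * Real.cos (2 * Real.pi * (w i - w k) * z) := by
  have h1 : ((‖∑ i ∈ S, (a i : ℂ) * addExp (w i * z)‖ ^ 2 : ℝ) : ℂ) =
      ∑ i ∈ S, ∑ k ∈ S, ((a i * a k : ℝ) : ℂ) * addExp ((w i - w k) * z) := by
    rw [← Complex.normSq_eq_norm_sq, ← Complex.mul_conj, map_sum, Finset.sum_mul_sum]
    refine Finset.sum_congr rfl fun i _ => Finset.sum_congr rfl fun k _ => ?_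
    rw [map_mul, Complex.conj_ofReal, conj_addExp]
    have : addExp ((w i - w k) * z) = addExp (w i * z) * addExp (-(w k * z)) := by
      rw [addExp, addExp, addExp, ← Complex.exp_add]
      congr 1
      push_cast
      ring
    rw [this]
    push_cast
    ring
  have h2 := congrArg Complex.re h1
  rw [Complex.ofReal_re, Complex.re_sum] at h2
  rw [h2]
  refine Finset.sum_congr rfl fun i _ => ?_
  rw [Complex.re_sum]
  refine Finset.sum_congr rfl fun k _ => ?_
  rw [Complex.re_ofReal_mul, addExp, Complex.exp_ofReal_mul_I_re, mul_assoc (2 * Real.pi)]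

open MeasureTheory in
theorem integrable_exp_neg_mul_sq_mul_of_bdd {b B : ℝ} (hb : 0 < b) {f : ℝ → ℝ}
    (hf : Continuous f) (hB : ∀ z, |f z| ≤ B) :
    Integrable fun z : ℝ => Real.exp (-b * z ^ 2) * f z := by
  have h := (integrable_exp_neg_mul_sq hb).bdd_mul (f := f) (c := B)
    hf.aestronglyMeasurable (Filter.Eventually.of_forall fun x => by
      simpa [Real.norm_eq_abs] using hB x)
  simpa [mul_comm] using h

open MeasureTheory in
theorem sqrt_mul_integral_norm_sum_sq {ι : Type*} (S : Finset ι) (a w : ι → ℝ) {b : ℝ}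
    (hb : 0 < b) :
    √b * ∫ z : ℝ, Real.exp (-b * z ^ 2) * ‖∑ i ∈ S, (a i : ℂ) * addExp (w i * z)‖ ^ 2 =
      ∑ i ∈ S, ∑ k ∈ S, a i * a k *
        (√Real.pi * Real.exp (-(2 * Real.pi * (w i - w k)) ^ 2 / (4 * b))) := by
  simp_rw [norm_sum_mul_addExp_sq, Finset.mul_sum]
  have hint : ∀ i k, Integrable fun z : ℝ => Real.exp (-b * z ^ 2) *
      (a i * a k * Real.cos (2 * Real.pi * (w i - w k) * z)) := fun i k =>
    integrable_exp_neg_mul_sq_mul_of_bdd (B := |a i * a k|) hb (by fun_prop) fun z => by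
      rw [abs_mul]
      exact mul_le_of_le_one_right (abs_nonneg _) (Real.abs_cos_le_one _)
  rw [integral_finsetSum _ fun i _ => integrable_finsetSum _ fun k _ => hint i k,
    Finset.mul_sum]
  refine Finset.sum_congr rfl fun i _ => ?_
  rw [integral_finsetSum _ fun k _ => hint i k, Finset.mul_sum]
  refine Finset.sum_congr rfl fun k _ => ?_
  simp_rw [mul_left_comm _ (a i * a k)]
  rw [integral_const_mul, integral_exp_neg_mul_sq_mul_cos hb, Real.sqrt_div Real.pi_pos.le]
  have : √b ≠ 0 := (Real.sqrt_pos.2 hb).ne'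
  field_simp

open MeasureTheory in
-- After expansion of the square, the pair `(i, k)` contributes `a i * a k * √π * exp (-π² (w i - w
-- k)² / b)`. This increases with `b` because the coefficients are nonnegative: widening the window
-- cannot increase the normalised mean square.
theorem sqrt_mul_integral_norm_sum_sq_mono {ι : Type*} (S : Finset ι) {a : ι → ℝ}
    (ha : ∀ i, 0 ≤ a i) (w : ι → ℝ) {b c : ℝ} (hb : 0 < b) (hbc : b ≤ c) :
    √b * ∫ z : ℝ, Real.exp (-b * z ^ 2) * ‖∑ i ∈ S, (a i : ℂ) * addExp (w i * z)‖ ^ 2 ≤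
      √c * ∫ z : ℝ, Real.exp (-c * z ^ 2) * ‖∑ i ∈ S, (a i : ℂ) * addExp (w i * z)‖ ^ 2 := by
  rw [sqrt_mul_integral_norm_sum_sq S a w hb,
    sqrt_mul_integral_norm_sum_sq S a w (hb.trans_le hbc)]
  refine Finset.sum_le_sum fun i _ => Finset.sum_le_sum fun k _ => ?_
  refine mul_le_mul_of_nonneg_left ?_ (mul_nonneg (ha i) (ha k))
  refine mul_le_mul_of_nonneg_left (Real.exp_le_exp.2 ?_) (Real.sqrt_nonneg _)
  rw [neg_div, neg_div, neg_le_neg_iff]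
  gcongr

open MeasureTheory Filter Topology in
theorem sqrt_mul_integral_norm_tsum_sq_mono {ι : Type*} [Countable ι] {a : ι → ℝ}
    (ha : ∀ i, 0 ≤ a i) (hs : Summable a) (w : ι → ℝ) {b c : ℝ} (hb : 0 < b) (hbc : b ≤ c) :
    √b * ∫ z : ℝ, Real.exp (-b * z ^ 2) * ‖∑' i, (a i : ℂ) * addExp (w i * z)‖ ^ 2 ≤
      √c * ∫ z : ℝ, Real.exp (-c * z ^ 2) * ‖∑' i, (a i : ℂ) * addExp (w i * z)‖ ^ 2 := by
  have hn : ∀ (z : ℝ) (i : ι), ‖(a i : ℂ) * addExp (w i * z)‖ = a i := fun z i => by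
    rw [norm_mul, norm_addExp, Complex.norm_real, Real.norm_of_nonneg (ha i), mul_one]
  have hsum : ∀ z : ℝ, Summable fun i => (a i : ℂ) * addExp (w i * z) := fun z =>
    Summable.of_norm (by simpa only [hn] using hs)
  have key : ∀ d : ℝ, 0 < d → Tendsto (fun S : Finset ι => √d * ∫ z : ℝ,
      Real.exp (-d * z ^ 2) * ‖∑ i ∈ S, (a i : ℂ) * addExp (w i * z)‖ ^ 2) atTop
      (𝓝 (√d * ∫ z : ℝ, Real.exp (-d * z ^ 2) *
        ‖∑' i, (a i : ℂ) * addExp (w i * z)‖ ^ 2)) := by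
    intro d hd
    refine Tendsto.const_mul _ ?_
    refine tendsto_integral_filter_of_dominated_convergence
      (fun z => Real.exp (-d * z ^ 2) * (∑' i, a i) ^ 2) ?_ ?_ ?_ ?_
    · refine Eventually.of_forall fun S => Continuous.aestronglyMeasurable ?_
      have := continuous_addExp
      fun_prop
    · refine Eventually.of_forall fun S => Eventually.of_forall fun z => ?_
      rw [Real.norm_of_nonneg (by positivity)]
      gcongr
      refine (norm_sum_le _ _).trans ?_
      simp only [hn]
      exact hs.sum_le_tsum S fun i _ => ha i
    · exact (integrable_exp_neg_mul_sq hd).mul_const _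
    · refine Eventually.of_forall fun z => ?_
      exact (((hsum z).hasSum.norm).pow 2).const_mul _
  exact le_of_tendsto_of_tendsto' (key b hb) (key c (hb.trans_le hbc)) fun S =>
    sqrt_mul_integral_norm_sum_sq_mono S ha w hb hbc

/-- The coefficients are nonnegative because the Fejér coefficients, the factors `j ^ (-1/2)` and
the Gaussians are; the frequencies are `(j - l² / j) / 2`. Thus mean square monotonicity applies to
`dualForm`. -/
theorem dualForm_eq_tsum {lam : ℝ} (hlam : 1 ≤ lam) (J : ℕ) :
    ∃ (a w : Finset.Ico 1 J × ℤ → ℝ), (∀ i, 0 ≤ a i) ∧ Summable a ∧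
      ∀ z, dualForm lam J z = ∑' i, (a i : ℂ) * addExp (w i * z) := by
  set a : Finset.Ico 1 J × ℤ → ℝ := fun i => (1 - ((i.1 : ℕ) : ℝ) / J) / √((i.1 : ℕ) : ℝ) *
    Real.exp (-Real.pi * (lam / ((i.1 : ℕ) : ℝ) ^ 2) * (i.2 : ℝ) ^ 2) with ha
  set w : Finset.Ico 1 J × ℤ → ℝ := fun i =>
    (((i.1 : ℕ) : ℝ) - (i.2 : ℝ) ^ 2 / ((i.1 : ℕ) : ℝ)) / 2 with hw
  have ha0 : ∀ i, 0 ≤ a i := fun i => mul_nonneg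
    (div_nonneg (fejerCoeff_nonneg i.1.2) (Real.sqrt_nonneg _)) (Real.exp_pos _).le
  have hre : ∀ j : Finset.Ico 1 J, 0 < lam / ((j : ℕ) : ℝ) ^ 2 := fun j => by
    have := thetaParam_re_pos (z := 0) hlam (Finset.mem_Ico.1 j.2).1
    rwa [thetaParam_re] at this
  have hs : Summable a := by
    refine (summable_prod_of_nonneg ha0).2 ⟨fun j => ?_, ?_⟩
    · exact (summable_exp_neg_mul_int_sq (hre j)).mul_left
        ((1 - ((j : ℕ) : ℝ) / J) / √((j : ℕ) : ℝ))
    · exact Summable.of_finite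
  refine ⟨a, w, ha0, hs, fun z => ?_⟩
  have hsum : Summable fun i => (a i : ℂ) * addExp (w i * z) := by
    refine Summable.of_norm (hs.congr fun i => ?_)
    rw [norm_mul, norm_addExp, Complex.norm_real, Real.norm_of_nonneg (ha0 i), mul_one]
  rw [hsum.tsum_prod, tsum_fintype, dualForm, ← Finset.sum_coe_sort]
  refine Finset.sum_congr rfl fun j _ => ?_
  rw [dualSum, ← tsum_mul_left]
  refine tsum_congr fun l => ?_
  have hj : (((j : ℕ) : ℝ) : ℂ) ≠ 0 := by
    have := (Finset.mem_Ico.1 j.2).1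
    exact_mod_cast (by omega : (j : ℕ) ≠ 0)
  rw [ha, hw]
  simp only [Complex.ofReal_mul, Complex.ofReal_exp]
  rw [mul_assoc _ (addExp _) (Complex.exp _), mul_assoc _ (Complex.exp _) (addExp _), addExp,
    addExp, ← Complex.exp_add, ← Complex.exp_add, thetaParam]
  congr 2
  push_cast
  field_simp
  ring

open MeasureTheory in
theorem sqrt_mul_integral_dualForm_mono {lam : ℝ} (hlam : 1 ≤ lam) (J : ℕ) {b c : ℝ}
    (hb : 0 < b) (hbc : b ≤ c) :
    √b * ∫ z : ℝ, Real.exp (-b * z ^ 2) * ‖dualForm lam J z‖ ^ 2 ≤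
      √c * ∫ z : ℝ, Real.exp (-c * z ^ 2) * ‖dualForm lam J z‖ ^ 2 := by
  obtain ⟨a, w, ha, hs, h⟩ := dualForm_eq_tsum hlam J
  simp_rw [h]
  exact sqrt_mul_integral_norm_tsum_sq_mono ha hs w hb hbc

/-! ### Energy of a finite family of reals as a mean square of hits. -/

/-- The number of pairs from `P` whose `x`-values differ by at most `δ`. -/
noncomputable def energy {ι : Type*} (P : Finset ι) (x : ι → ℝ) (δ : ℝ) : ℕ :=
  ((P ×ˢ P).filter fun q => |x q.1 - x q.2| ≤ δ).card

/-- The number of elements of `P` whose `x`-value is within `δ` of `z`. -/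
noncomputable def hits {ι : Type*} (P : Finset ι) (x : ι → ℝ) (δ z : ℝ) : ℕ :=
  (P.filter fun p => |z - x p| ≤ δ).card

section
variable {ι : Type*} (P : Finset ι) (x : ι → ℝ) {δ : ℝ}

theorem energy_mono {δ' : ℝ} (h : δ ≤ δ') : energy P x δ ≤ energy P x δ' :=
  Finset.card_le_card fun _ hq => Finset.mem_filter.2
    ⟨(Finset.mem_filter.1 hq).1, (Finset.mem_filter.1 hq).2.trans h⟩

theorem hits_eq_sum_indicator (z : ℝ) :
    (hits P x δ z : ℝ) = ∑ p ∈ P, (Set.Icc (x p - δ) (x p + δ)).indicator (fun _ => (1 : ℝ)) z := by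
  rw [hits, Finset.card_filter]
  push_cast
  refine Finset.sum_congr rfl fun p _ => ?_
  rw [Set.indicator_apply]
  congr 1
  rw [Set.mem_Icc, abs_le]
  apply propext
  constructor <;> rintro ⟨h1, h2⟩ <;> constructor <;> linarith

theorem hits_sq_eq_sum_indicator (z : ℝ) :
    (hits P x δ z : ℝ) ^ 2 = ∑ p ∈ P, ∑ q ∈ P,
      (Set.Icc (max (x p) (x q) - δ) (min (x p) (x q) + δ)).indicator (fun _ => (1 : ℝ)) z := by
  rw [hits_eq_sum_indicator, sq, Finset.sum_mul_sum]
  refine Finset.sum_congr rfl fun p _ => Finset.sum_congr rfl fun q _ => ?_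
  rw [← Set.inter_indicator_mul, Set.Icc_inter_Icc]
  simp only [one_mul, max_sub_sub_right, min_add_add_right]

open MeasureTheory in
theorem integrable_indicator_Icc_one (a b : ℝ) :
    Integrable ((Set.Icc a b).indicator (fun _ => (1 : ℝ))) :=
  (integrable_indicator_iff measurableSet_Icc).2 (by simp)

open MeasureTheory in
theorem integrable_hits_sq : Integrable fun z => (hits P x δ z : ℝ) ^ 2 := by
  simp_rw [hits_sq_eq_sum_indicator]
  exact integrable_finsetSum _ fun p _ => integrable_finsetSum _ fun q _ =>
    integrable_indicator_Icc_one _ _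

open MeasureTheory in
-- The square counts pairs whose windows of radius `δ` both contain `z`, and two such windows meet
-- in length `max (2 δ - |x p - x q|) 0`. This traps the integral between energies at scales `δ` and
-- `2 δ`.
theorem integral_hits_sq :
    ∫ z, (hits P x δ z : ℝ) ^ 2 = ∑ pq ∈ P ×ˢ P, max (2 * δ - |x pq.1 - x pq.2|) 0 := by
  simp_rw [hits_sq_eq_sum_indicator]
  rw [integral_finsetSum _ fun p _ => integrable_finsetSum _ fun q _ =>
    integrable_indicator_Icc_one _ _, Finset.sum_product]
  refine Finset.sum_congr rfl fun p _ => ?_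
  rw [integral_finsetSum _ fun q _ => integrable_indicator_Icc_one _ _]
  refine Finset.sum_congr rfl fun q _ => ?_
  rw [integral_indicator measurableSet_Icc, setIntegral_const, smul_eq_mul, mul_one,
    Real.volume_real_Icc]
  congr 1
  have := max_sub_min_eq_abs (x p) (x q)
  linarith [abs_sub_comm (x p) (x q)]

open MeasureTheory in
theorem mul_energy_le_integral_hits_sq :
    δ * energy P x δ ≤ ∫ z, (hits P x δ z : ℝ) ^ 2 := by
  rw [integral_hits_sq, energy, Finset.card_filter]
  push_cast
  rw [Finset.mul_sum]
  refine Finset.sum_le_sum fun q _ => ?_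
  split_ifs with h
  · exact le_max_of_le_left (by linarith)
  · simp

open MeasureTheory in
theorem integral_hits_sq_le (hδ : 0 ≤ δ) :
    ∫ z, (hits P x δ z : ℝ) ^ 2 ≤ 2 * δ * energy P x (2 * δ) := by
  rw [integral_hits_sq, energy, Finset.card_filter]
  push_cast
  rw [Finset.mul_sum]
  refine Finset.sum_le_sum fun q _ => ?_
  split_ifs with h
  · exact max_le (by linarith [abs_nonneg (x q.1 - x q.2)]) (by linarith)
  · rw [mul_zero, max_eq_right]
    linarith

end

/-! ### Lattice boxes and the larger roots of `z² - 2 s z + h²`. -/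

/-- The larger root `s + √(s² - h²)` of `z² - 2 s z + h²`, where `p = (h, s)`. -/
noncomputable def upperRoot (p : ℤ × ℤ) : ℝ := p.2 + √((p.2 : ℝ) ^ 2 - (p.1 : ℝ) ^ 2)

/-- The pairs `(h, s)` of integers with `Z ≤ s ≤ 16 Z` and `|h| ≤ ρ s`. -/
noncomputable def latticeBox (ρ Z : ℝ) : Finset (ℤ × ℤ) :=
  ((Finset.Icc (-⌊16 * Z⌋) ⌊16 * Z⌋) ×ˢ (Finset.Icc ⌈Z⌉ ⌊16 * Z⌋)).filter
    fun p => |(p.1 : ℝ)| ≤ ρ * p.2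

theorem mem_latticeBox {ρ Z : ℝ} (hρ : ρ ≤ 1) (hZ : 0 < Z) {p : ℤ × ℤ} :
    p ∈ latticeBox ρ Z ↔ Z ≤ p.2 ∧ (p.2 : ℝ) ≤ 16 * Z ∧ |(p.1 : ℝ)| ≤ ρ * p.2 := by
  simp only [latticeBox, Finset.mem_filter, Finset.mem_product, Finset.mem_Icc, Int.ceil_le,
    Int.le_floor]
  constructor
  · tauto
  · rintro ⟨h1, h2, h3⟩
    have h4 : |(p.1 : ℝ)| ≤ 16 * Z := by nlinarith
    have h5 : |p.1| ≤ ⌊16 * Z⌋ := by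
      rw [Int.le_floor]
      push_cast
      exact h4
    exact ⟨⟨⟨(abs_le.1 h5).1, Int.le_floor.1 (abs_le.1 h5).2⟩, h1, h2⟩, h3⟩

theorem card_le_of_forall_sub_le (F : Finset ℤ) {D : ℝ}
    (h : ∀ a ∈ F, ∀ b ∈ F, (a : ℝ) ≤ b → (b : ℝ) - a ≤ D) : F.card ≤ ⌊D⌋₊ + 1 := by
  rcases F.eq_empty_or_nonempty with rfl | hF
  · simp
  · have hsub : F ⊆ Finset.Icc (F.min' hF) (F.min' hF + ⌊D⌋₊) := by
      intro b hb
      have h1 := F.min'_le b hb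
      refine Finset.mem_Icc.2 ⟨h1, ?_⟩
      have h2 := h _ (F.min'_mem hF) b hb (by exact_mod_cast h1)
      have h3 : ((b - F.min' hF).toNat : ℝ) ≤ D := by
        have : (((b - F.min' hF).toNat : ℤ) : ℝ) = ((b - F.min' hF : ℤ) : ℝ) := by
          rw [Int.toNat_of_nonneg (by omega)]
        rw [← Int.cast_natCast, this]
        push_cast
        exact h2
      have h4 := Nat.le_floor h3
      omega
    have := Finset.card_le_card hsub
    rw [Int.card_Icc] at this
    omega

theorem upperRoot_sub_le {h s t : ℤ} (hst : (s : ℝ) ≤ t) (hs : 0 ≤ s) :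
    (t : ℝ) - s ≤ upperRoot (h, t) - upperRoot (h, s) := by
  have hs' : (0 : ℝ) ≤ s := by exact_mod_cast hs
  have : √((s : ℝ) ^ 2 - (h : ℝ) ^ 2) ≤ √((t : ℝ) ^ 2 - (h : ℝ) ^ 2) := by
    apply Real.sqrt_le_sqrt
    gcongr
  simp only [upperRoot]
  linarith

/-- Once the first point and the coordinate `h` of the second are fixed, the second `s` lies in an
interval of length `2 δ`, since for fixed `h` the root moves at least as fast as `s`. -/
theorem energy_latticeBox_le {ρ Z δ : ℝ} (hZ : 1 ≤ Z) (hδ : 0 ≤ δ) :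
    (energy (latticeBox ρ Z) upperRoot δ : ℝ) ≤ 40000 * (1 + δ) * Z ^ 3 := by
  set A := Finset.Icc (-⌊16 * Z⌋) ⌊16 * Z⌋ with hA
  have hs : ∀ p ∈ latticeBox ρ Z, p.1 ∈ A ∧ p.2 ∈ Finset.Icc ⌈Z⌉ ⌊16 * Z⌋ := fun p hp => by
    have := (Finset.mem_filter.1 hp).1
    exact Finset.mem_product.1 this
  have h1 : energy (latticeBox ρ Z) upperRoot δ ≤
      (⌊2 * δ⌋₊ + 1) * (latticeBox ρ Z ×ˢ A).card := by
    refine Finset.card_le_mul_card_image_of_maps_to (f := fun q => (q.1, q.2.1)) ?_ _ ?_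
    · intro q hq
      have hq' := Finset.mem_product.1 (Finset.mem_filter.1 hq).1
      exact Finset.mem_product.2 ⟨hq'.1, (hs _ hq'.2).1⟩
    · rintro ⟨p, h⟩ -
      have hle := card_le_of_forall_sub_le (((((latticeBox ρ Z ×ˢ latticeBox ρ Z).filter
        fun q => |upperRoot q.1 - upperRoot q.2| ≤ δ).filter
          fun q => (q.1, q.2.1) = (p, h))).image fun q => q.2.2) (D := 2 * δ) ?_
      · refine le_trans (le_of_eq ?_) hle
        rw [Finset.card_image_of_injOn]
        rintro ⟨q1, q2, q3⟩ hq ⟨r1, r2, r3⟩ hr hqr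
        simp only [Finset.coe_filter, Finset.mem_filter, Set.mem_ofPred_eq, Prod.mk.injEq] at hq hr
        simp only at hqr
        rw [hq.2.1, hr.2.1, hq.2.2, hr.2.2, hqr]
      · intro a ha b hb hab
        obtain ⟨⟨q1, q2, q3⟩, hq, rfl⟩ := Finset.mem_image.1 ha
        obtain ⟨⟨r1, r2, r3⟩, hr, rfl⟩ := Finset.mem_image.1 hb
        simp only [Finset.mem_filter, Prod.mk.injEq, Finset.mem_product] at hq hr
        obtain ⟨⟨⟨hq1, hq2⟩, hq3⟩, rfl, rfl⟩ := hq
        obtain ⟨⟨⟨hr1, hr2⟩, hr3⟩, rfl, rfl⟩ := hr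
        have hpos : 0 ≤ q3 := by
          have h2 := (Finset.mem_Icc.1 (hs _ hq2).2).1
          have h3 : (0 : ℤ) ≤ ⌈Z⌉ := Int.ceil_nonneg (by linarith)
          exact h3.trans h2
        have h2 := upperRoot_sub_le (h := r2) hab hpos
        rw [abs_le] at hq3 hr3
        linarith
  have hfl : (⌊16 * Z⌋ : ℝ) ≤ 16 * Z := Int.floor_le _
  have hfl0 : 0 ≤ ⌊16 * Z⌋ := Int.floor_nonneg.2 (by linarith)
  have hcl : 0 ≤ ⌈Z⌉ := Int.ceil_nonneg (by linarith)
  have hcA : (A.card : ℝ) ≤ 33 * Z := by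
    rw [hA, Int.card_Icc]
    have : (((⌊16 * Z⌋ + 1 - -⌊16 * Z⌋).toNat : ℤ) : ℝ) = 2 * ⌊16 * Z⌋ + 1 := by
      rw [Int.toNat_of_nonneg (by omega)]
      push_cast
      ring
    rw [← Int.cast_natCast, this]
    linarith
  have hcS : ((Finset.Icc ⌈Z⌉ ⌊16 * Z⌋).card : ℝ) ≤ 17 * Z := by
    rw [Int.card_Icc]
    have h2 : (((⌊16 * Z⌋ + 1 - ⌈Z⌉).toNat : ℤ) : ℝ) ≤ ((⌊16 * Z⌋ + 1 : ℤ) : ℝ) := by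
      exact_mod_cast (by omega)
    rw [← Int.cast_natCast]
    push_cast at h2 ⊢
    linarith
  have hcB : ((latticeBox ρ Z).card : ℝ) ≤ 33 * Z * (17 * Z) := by
    have : (latticeBox ρ Z).card ≤ A.card * (Finset.Icc ⌈Z⌉ ⌊16 * Z⌋).card := by
      rw [← Finset.card_product]
      exact Finset.card_le_card (Finset.filter_subset _ _)
    calc ((latticeBox ρ Z).card : ℝ) ≤ A.card * (Finset.Icc ⌈Z⌉ ⌊16 * Z⌋).card := by
          exact_mod_cast this
      _ ≤ _ := by gcongr
  have hfd : (⌊2 * δ⌋₊ : ℝ) ≤ 2 * δ := Nat.floor_le (by linarith)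
  calc (energy (latticeBox ρ Z) upperRoot δ : ℝ)
      ≤ (⌊2 * δ⌋₊ + 1) * ((latticeBox ρ Z).card * A.card) := by
        rw [Finset.card_product] at h1
        exact_mod_cast h1
    _ ≤ (2 * δ + 1) * (33 * Z * (17 * Z) * (33 * Z)) := by gcongr
    _ = (18513 * (2 * δ + 1)) * Z ^ 3 := by ring
    _ ≤ _ := mul_le_mul_of_nonneg_right (by linarith) (by positivity)

section
variable {h s : ℤ} {z : ℝ}

/-- The left side is `(z² - 2 s z + h²) / (2 z)`, and `|h| ≤ s` makes both roots real. -/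
theorem rootPhase_sub (hz : z ≠ 0) (hh : |(h : ℝ)| ≤ s) :
    rootPhase h z - s = (z - upperRoot (h, s)) * (z - (s - √((s : ℝ) ^ 2 - (h : ℝ) ^ 2))) /
      (2 * z) := by
  have h1 : (0 : ℝ) ≤ (s : ℝ) ^ 2 - (h : ℝ) ^ 2 := by
    have := sq_le_sq' (by linarith [abs_nonneg (h : ℝ)]) hh
    rw [sq_abs] at this
    linarith
  have h2 := Real.sq_sqrt h1
  rw [rootPhase, upperRoot]
  field_simp
  ring_nf at h2 ⊢
  linarith

theorem sqrt_sq_sub_sq_le (hs : (0 : ℝ) ≤ s) : √((s : ℝ) ^ 2 - (h : ℝ) ^ 2) ≤ s := by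
  rw [Real.sqrt_le_left hs]
  nlinarith [sq_nonneg (h : ℝ)]

theorem le_upperRoot : (s : ℝ) ≤ upperRoot (h, s) := by
  rw [upperRoot]
  exact le_add_of_nonneg_right (Real.sqrt_nonneg _)

theorem upperRoot_le (hs : (0 : ℝ) ≤ s) : upperRoot (h, s) ≤ 2 * s := by
  rw [upperRoot]
  linarith [sqrt_sq_sub_sq_le (h := h) hs]

theorem abs_rootPhase_sub_le {δ : ℝ} (hs : (1 : ℝ) ≤ s) (hh : |(h : ℝ)| ≤ s) (hδ : δ ≤ 1 / 4)
    (hz : |z - upperRoot (h, s)| ≤ δ) : |rootPhase h z - s| ≤ δ / 2 := by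
  have h1 := le_upperRoot (h := h) (s := s)
  have h2 := abs_le.1 hz
  have hz0 : 0 < z := by linarith
  have h3 := sqrt_sq_sub_sq_le (h := h) (s := s) (by linarith)
  have h4 := Real.sqrt_nonneg ((s : ℝ) ^ 2 - (h : ℝ) ^ 2)
  rw [rootPhase_sub hz0.ne' hh, abs_div, abs_mul, abs_of_pos (by positivity : 0 < 2 * z),
    div_le_iff₀ (by positivity)]
  have h5 : |z - (s - √((s : ℝ) ^ 2 - (h : ℝ) ^ 2))| ≤ z := by
    rw [abs_le]
    constructor <;> linarith
  calc _ ≤ δ * z := mul_le_mul hz h5 (abs_nonneg _) ((abs_nonneg _).trans hz)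
    _ = _ := by ring

/-- For `|h| ≤ z / 8` the smaller root is at most `z / 2`, so its factor in `rootPhase_sub` is
bounded below by `z / 2` and the smallness falls on the factor of the larger root. -/
theorem near_root_of_rootPhase {ρ η : ℝ} (hρ : ρ ≤ 1 / 8) (hη : η ≤ 1 / 2) (hz : 2 ≤ z)
    (hh : |(h : ℝ)| ≤ ρ * z) (hs : |rootPhase h z - s| ≤ η) :
    z / 4 ≤ s ∧ (s : ℝ) ≤ 2 * z ∧ |(h : ℝ)| ≤ 4 * ρ * s ∧ |z - upperRoot (h, s)| ≤ 4 * η := by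
  have hρ0 : 0 ≤ ρ := by
    have := (abs_nonneg (h : ℝ)).trans hh
    by_contra hneg
    nlinarith
  have hh2 : (h : ℝ) ^ 2 ≤ 1 / 64 * z ^ 2 := by
    rw [← sq_abs]
    have h1 : |(h : ℝ)| ≤ 1 / 8 * z := hh.trans (by gcongr)
    calc |(h : ℝ)| ^ 2 ≤ (1 / 8 * z) ^ 2 := by gcongr
      _ = _ := by ring
  have hq : (h : ℝ) ^ 2 / z ≤ 1 / 64 * z := by
    rw [div_le_iff₀ (by linarith)]
    linarith
  have hq0 : 0 ≤ (h : ℝ) ^ 2 / z := by positivity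
  have h2 := abs_le.1 hs
  rw [rootPhase] at h2
  have hs1 : z / 4 ≤ s := by linarith
  have hs2 : (s : ℝ) ≤ 2 * z := by linarith
  have hhs : |(h : ℝ)| ≤ 4 * ρ * s := hh.trans (by nlinarith)
  have hhs' : |(h : ℝ)| ≤ s := hhs.trans (by nlinarith)
  refine ⟨hs1, hs2, hhs, ?_⟩
  have hz0 : 0 < z := by linarith
  rw [rootPhase_sub hz0.ne' hhs', abs_div, abs_mul, abs_of_pos (by positivity : 0 < 2 * z),
    div_le_iff₀ (by positivity)] at hs
  set r := √((s : ℝ) ^ 2 - (h : ℝ) ^ 2) with hr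
  have hr0 : 0 ≤ r := Real.sqrt_nonneg _
  have h1 : (0 : ℝ) ≤ (s : ℝ) ^ 2 - (h : ℝ) ^ 2 := by
    have := sq_le_sq' (by linarith [abs_nonneg (h : ℝ)]) hhs'
    rw [sq_abs] at this
    linarith
  have hr2 : r ^ 2 = (s : ℝ) ^ 2 - (h : ℝ) ^ 2 := Real.sq_sqrt h1
  have h3 : (s : ℝ) - r ≤ z / 2 := by
    have : ((s : ℝ) - r) * (s + r) ≤ 1 / 64 * z ^ 2 := by nlinarith
    by_contra hcon
    push Not at hcon
    nlinarith
  have h4 : z / 2 ≤ |z - (s - r)| := (by linarith : z / 2 ≤ z - (s - r)).trans (le_abs_self _)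
  have h5 : |z - upperRoot (h, s)| * (z / 2) ≤ η * (2 * z) :=
    (mul_le_mul_of_nonneg_left h4 (abs_nonneg _)).trans hs
  nlinarith

end

/-! ### Hits of a lattice box against the kernel sum, in both directions. -/

section
variable {lam ρ z : ℝ} {J : ℕ}

theorem summable_weight (hlam : 0 < lam) (hz : 0 < z) :
    Summable fun h : ℤ => Real.exp (-Real.pi * (lam / z ^ 2) * (h : ℝ) ^ 2) :=
  summable_exp_neg_mul_int_sq (by positivity)

theorem norm_weight_mul_halfFejer_le (hJ : 1 ≤ J) (h : ℤ) :
    ‖(Real.exp (-Real.pi * (lam / z ^ 2) * (h : ℝ) ^ 2) : ℂ) * halfFejer J (rootPhase h z)‖ ≤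
      J * Real.exp (-Real.pi * (lam / z ^ 2) * (h : ℝ) ^ 2) := by
  rw [norm_mul, Complex.norm_real, Real.norm_of_nonneg (Real.exp_pos _).le, mul_comm]
  gcongr
  exact norm_halfFejer_le hJ _

theorem summable_weight_mul_halfFejer (hlam : 0 < lam) (hz : 0 < z) (hJ : 1 ≤ J) :
    Summable fun h : ℤ => (Real.exp (-Real.pi * (lam / z ^ 2) * (h : ℝ) ^ 2) : ℂ) *
      halfFejer J (rootPhase h z) :=
  Summable.of_norm_bounded ((summable_weight hlam hz).mul_left (J : ℝ)) fun h =>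
    norm_weight_mul_halfFejer_le hJ h

theorem tsum_weight_le (hlam : 1 ≤ lam) (hz : 0 < z) :
    ∑' h : ℤ, Real.exp (-Real.pi * (lam / z ^ 2) * (h : ℝ) ^ 2) ≤ gaussianSum * (1 + z) := by
  refine (tsum_exp_neg_mul_int_sq_le (by positivity)).trans ?_
  have hg := one_le_gaussianSum
  gcongr
  rw [Real.sqrt_div (by linarith), Real.sqrt_sq hz.le, one_div_div]
  exact div_le_self hz.le (Real.one_le_sqrt.2 hlam)

/-- Each hit `(h, s)` forces the Fejér kernel at `rootPhase h z` to be at least `J / 2`, and `|h| ≤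
2 ρ z` bounds the Gaussian weight below by `exp (-4 π lam ρ²)`. All other weighted kernels are
nonnegative, so the sum can be extended to every integer `h`. -/
theorem hits_latticeBox_le {N δ : ℝ} (hlam : 1 ≤ lam) (hJ : 1 ≤ J) (hρ0 : 0 ≤ ρ) (hρ : ρ ≤ 1)
    (hN : 1 ≤ N) (hδ : δ ≤ 1 / (4 * J)) (hz : 0 < z) :
    (hits (latticeBox ρ N) upperRoot δ z : ℝ) ≤
      2 / J * Real.exp (4 * Real.pi * lam * ρ ^ 2) *
        (gaussianSum * (1 + z) + 2 * ‖kernelForm lam J z‖) := by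
  have hJ' : (1 : ℝ) ≤ J := by exact_mod_cast hJ
  have hlam0 : 0 < lam := by linarith
  set E := Real.exp (4 * Real.pi * lam * ρ ^ 2) with hE
  set w : ℤ → ℝ := fun h => Real.exp (-Real.pi * (lam / z ^ 2) * (h : ℝ) ^ 2) with hw
  set K : ℤ → ℂ := fun h => halfFejer J (rootPhase h z) with hK
  have hδ4 : δ ≤ 1 / 4 := hδ.trans (by
    apply one_div_le_one_div_of_le (by norm_num)
    linarith)
  set F := (latticeBox ρ N).filter fun p => |z - upperRoot p| ≤ δ with hF
  have hmem : ∀ p ∈ F, (1 : ℝ) ≤ p.2 ∧ |(p.1 : ℝ)| ≤ p.2 ∧ |(p.1 : ℝ)| ≤ 2 * ρ * z ∧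
      |rootPhase p.1 z - p.2| ≤ δ / 2 := by
    intro p hp
    obtain ⟨hp1, hp2⟩ := Finset.mem_filter.1 hp
    obtain ⟨h1, h2, h3⟩ := (mem_latticeBox hρ (by linarith)).1 hp1
    have h4 : (1 : ℝ) ≤ p.2 := hN.trans h1
    have h5 : |(p.1 : ℝ)| ≤ p.2 := h3.trans (by nlinarith)
    have h6 := le_upperRoot (h := p.1) (s := p.2)
    have h7 := abs_le.1 hp2
    refine ⟨h4, h5, ?_, abs_rootPhase_sub_le h4 h5 hδ4 hp2⟩
    have h8 : (p.2 : ℝ) ≤ 2 * z := by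
      have : upperRoot p = upperRoot (p.1, p.2) := rfl
      linarith
    calc _ ≤ ρ * p.2 := h3
      _ ≤ ρ * (2 * z) := by gcongr
      _ = _ := by ring
  -- The phase is within `1 / 8` of `s`, so `h` determines `s`.
  have hinj : Set.InjOn Prod.fst (F : Set (ℤ × ℤ)) := by
    intro p hp q hq hpq
    have h1 := (hmem p hp).2.2.2
    have h2 := (hmem q hq).2.2.2
    have hpq' : p.1 = q.1 := hpq
    rw [← hpq'] at h2
    have h3 : |(p.2 : ℝ) - q.2| < 1 := by
      rw [abs_lt]
      rw [abs_le] at h1 h2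
      constructor <;> linarith
    have h4 : p.2 = q.2 := by
      have h5 : |p.2 - q.2| < 1 := by exact_mod_cast h3
      rw [abs_lt] at h5
      omega
    exact Prod.ext hpq' h4
  have hterm : ∀ h : ℤ, 0 ≤ w h * (1 + 2 * (K h).re) := fun h =>
    mul_nonneg (Real.exp_pos _).le (fejer_nonneg hJ _)
  have hsw : Summable w := summable_weight hlam0 hz
  have hswK : Summable fun h => (w h : ℂ) * K h := summable_weight_mul_halfFejer hlam0 hz hJ
  have hre : HasSum (fun h => w h * (K h).re) (kernelForm lam J z).re := by
    have := Complex.hasSum_re hswK.hasSum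
    simp only [Complex.re_ofReal_mul] at this
    exact this
  have hsum : HasSum (fun h => w h * (1 + 2 * (K h).re))
      (∑' h, w h + 2 * (kernelForm lam J z).re) := by
    have := hsw.hasSum.add (hre.mul_left 2)
    convert this using 1
    funext h
    ring
  have hlow : ∀ p ∈ F, (1 : ℝ) ≤ 2 / J * E * (w p.1 * (1 + 2 * (K p.1).re)) := by
    intro p hp
    obtain ⟨-, -, h3, h4⟩ := hmem p hp
    have h5 : (J : ℝ) / 2 ≤ 1 + 2 * (K p.1).re := by
      refine half_le_fejer hJ (h4.trans ?_)
      calc δ / 2 ≤ 1 / (4 * J) / 2 := by gcongr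
        _ = _ := by
          field_simp
          norm_num
    have h6 : 1 ≤ E * w p.1 := by
      rw [hE, hw, ← Real.exp_add, Real.one_le_exp_iff]
      have h7 : (p.1 : ℝ) ^ 2 ≤ (2 * ρ * z) ^ 2 := by
        rw [← sq_abs]
        gcongr
      have h8 : Real.pi * (lam / z ^ 2) * (p.1 : ℝ) ^ 2 ≤
          Real.pi * (lam / z ^ 2) * (2 * ρ * z) ^ 2 := by gcongr
      have h9 : Real.pi * (lam / z ^ 2) * (2 * ρ * z) ^ 2 = 4 * Real.pi * lam * ρ ^ 2 := by
        field_simp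
        ring
      linarith
    calc (1 : ℝ) ≤ 2 / J * (J / 2) * (E * w p.1) := by
          rw [div_mul_div_cancel₀ (by positivity)]
          linarith
      _ ≤ 2 / J * (1 + 2 * (K p.1).re) * (E * w p.1) := by
          have : 0 < E * w p.1 := by linarith
          gcongr
      _ = _ := by ring
  calc (hits (latticeBox ρ N) upperRoot δ z : ℝ) = ∑ p ∈ F, (1 : ℝ) := by simp [hits, hF]
    _ ≤ ∑ p ∈ F, 2 / J * E * (w p.1 * (1 + 2 * (K p.1).re)) := Finset.sum_le_sum hlow
    _ = 2 / J * E * ∑ h ∈ F.image Prod.fst, w h * (1 + 2 * (K h).re) := by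
        rw [Finset.sum_image hinj, Finset.mul_sum]
    _ ≤ 2 / J * E * (∑' h, w h + 2 * (kernelForm lam J z).re) := by
        gcongr
        exact sum_le_hasSum _ (fun h _ => hterm h) hsum
    _ ≤ _ := by
        gcongr
        · exact tsum_weight_le hlam hz
        · exact Complex.re_le_norm _

/-- The kernels are replaced by counts of scales and the sums exchanged; then `h` is paired with the
integer `s` nearest its phase. For `z` between `Z` and `2 Z` such `s` lie between `Z / 4` and `4 Z`,
which explains the factor `16` in `latticeBox`. -/
theorem sum_norm_halfFejer_le (hJ : 1 ≤ J) (hρ : ρ ≤ 1 / 8) {Z : ℝ} (hZ : 2 ≤ Z)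
    (hz : z ∈ Set.Icc Z (2 * Z)) :
    ∑ h ∈ Finset.Icc (-⌊ρ * z⌋) ⌊ρ * z⌋, ‖halfFejer J (rootPhase h z)‖ ≤
      2 * ∑ m ∈ Finset.Icc 1 J, (hits (latticeBox (4 * ρ) (Z / 4)) upperRoot (2 / m) z : ℝ) := by
  set A := Finset.Icc (-⌊ρ * z⌋) ⌊ρ * z⌋ with hA
  have hz2 : 2 ≤ z := hZ.trans hz.1
  have hcount : ∀ m ∈ Finset.Icc 1 J,
      (A.filter fun h : ℤ => |rootPhase h z - round (rootPhase h z)| ≤ 1 / (2 * m)).card ≤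
        hits (latticeBox (4 * ρ) (Z / 4)) upperRoot (2 / m) z := by
    intro m hm
    have hm1 : (1 : ℝ) ≤ m := by exact_mod_cast (Finset.mem_Icc.1 hm).1
    refine Finset.card_le_card_of_injOn (fun h => (h, round (rootPhase h z))) ?_ ?_
    · intro h hh
      obtain ⟨h1, h2⟩ := Finset.mem_filter.1 hh
      have h3 : |(h : ℝ)| ≤ ρ * z := by
        have h4 := abs_le.2 (Finset.mem_Icc.1 h1)
        have h5 := Int.le_floor.1 h4
        exact_mod_cast h5
      have h6 : 1 / (2 * (m : ℝ)) ≤ 1 / 2 := by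
        apply one_div_le_one_div_of_le (by norm_num)
        linarith
      obtain ⟨k1, k2, k3, k4⟩ := near_root_of_rootPhase hρ h6 hz2 h3 h2
      refine Finset.mem_filter.2 ⟨(mem_latticeBox (by linarith) (by linarith)).2
        ⟨?_, ?_, k3⟩, k4.trans (le_of_eq ?_)⟩
      · linarith [hz.1]
      · linarith [hz.2]
      · field_simp
        norm_num
    · intro a _ b _ hab
      exact congrArg Prod.fst hab
  calc _ ≤ ∑ h ∈ A, 2 * ((((Finset.Icc 1 J).filter fun m : ℕ =>
        |rootPhase h z - round (rootPhase h z)| ≤ 1 / (2 * m)).card : ℕ) : ℝ) :=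
        Finset.sum_le_sum fun h _ => norm_halfFejer_le_card hJ _
    _ = 2 * ∑ m ∈ Finset.Icc 1 J, (((A.filter fun h : ℤ =>
        |rootPhase h z - round (rootPhase h z)| ≤ 1 / (2 * m)).card : ℕ) : ℝ) := by
        rw [← Finset.mul_sum]
        congr 1
        simp only [Finset.card_filter]
        push_cast
        exact Finset.sum_comm
    _ ≤ _ := by
        gcongr with m hm
        exact hcount m hm

/-- For `|h|` above `ρ z`, half of the Gaussian exponent gives the saving `exp (-π lam ρ² / 2)` and
the other half makes the series converge. -/
theorem norm_kernelForm_le (hlam : 1 ≤ lam) (hJ : 1 ≤ J) (hρ0 : 0 ≤ ρ) (hz : 1 ≤ z) :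
    ‖kernelForm lam J z‖ ≤
      ∑ h ∈ Finset.Icc (-⌊ρ * z⌋) ⌊ρ * z⌋, ‖halfFejer J (rootPhase h z)‖ +
        J * Real.exp (-(Real.pi * lam * ρ ^ 2 / 2)) * (3 * gaussianSum * z) := by
  have hlam0 : 0 < lam := by linarith
  have hz0 : 0 < z := by linarith
  have hg := one_le_gaussianSum
  set A := Finset.Icc (-⌊ρ * z⌋) ⌊ρ * z⌋ with hA
  set E := Real.exp (-(Real.pi * lam * ρ ^ 2 / 2)) with hE
  set a := lam / 2 / z ^ 2 with ha
  have ha0 : 0 < a := by positivity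
  have hbound : ∀ h : ℤ,
      ‖(Real.exp (-Real.pi * (lam / z ^ 2) * (h : ℝ) ^ 2) : ℂ) * halfFejer J (rootPhase h z)‖ ≤
        (A : Set ℤ).indicator (fun h => ‖halfFejer J (rootPhase h z)‖) h +
          J * E * Real.exp (-Real.pi * a * (h : ℝ) ^ 2) := by
    intro h
    by_cases hh : h ∈ A
    · rw [Set.indicator_of_mem (by exact_mod_cast hh), norm_mul, Complex.norm_real,
        Real.norm_of_nonneg (Real.exp_pos _).le]
      have h1 : Real.exp (-Real.pi * (lam / z ^ 2) * (h : ℝ) ^ 2) ≤ 1 := by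
        rw [Real.exp_le_one_iff]
        have : 0 ≤ Real.pi * (lam / z ^ 2) * (h : ℝ) ^ 2 := by positivity
        linarith
      have h2 : 0 ≤ J * E * Real.exp (-Real.pi * a * (h : ℝ) ^ 2) := by positivity
      have h3 := mul_le_mul_of_nonneg_right h1 (norm_nonneg (halfFejer J (rootPhase h z)))
      linarith
    · rw [Set.indicator_of_notMem (by exact_mod_cast hh), zero_add]
      refine (norm_weight_mul_halfFejer_le hJ h).trans ?_
      rw [mul_assoc (J : ℝ) E, hE, ← Real.exp_add]
      gcongr
      have h1 : ρ * z ≤ |(h : ℝ)| := by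
        by_contra hcon
        push Not at hcon
        apply hh
        have h2 : |h| ≤ ⌊ρ * z⌋ := by
          rw [Int.le_floor]
          push_cast
          exact hcon.le
        exact Finset.mem_Icc.2 (abs_le.1 h2)
      have h2 : (ρ * z) ^ 2 ≤ (h : ℝ) ^ 2 := by
        rw [← sq_abs (h : ℝ)]
        gcongr
      have h3 : Real.pi * a * (ρ * z) ^ 2 ≤ Real.pi * a * (h : ℝ) ^ 2 := by gcongr
      have h4 : Real.pi * a * (ρ * z) ^ 2 = Real.pi * lam * ρ ^ 2 / 2 := by
        rw [ha]
        field_simp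
      have h5 : lam / z ^ 2 = 2 * a := by
        rw [ha]
        ring
      rw [h5]
      linarith
  have hs1 : HasSum ((A : Set ℤ).indicator fun h => ‖halfFejer J (rootPhase h z)‖)
      (∑ h ∈ A, ‖halfFejer J (rootPhase h z)‖) := by
    have := hasSum_sum_of_ne_finset_zero (L := SummationFilter.unconditional ℤ) (s := A)
      (f := (A : Set ℤ).indicator fun h => ‖halfFejer J (rootPhase h z)‖) fun h hh =>
        Set.indicator_of_notMem (by exact_mod_cast hh) _
    rwa [Finset.sum_congr rfl fun h hh => Set.indicator_of_mem (by exact_mod_cast hh) _] at this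
  have hs2 := ((summable_exp_neg_mul_int_sq ha0).hasSum).mul_left (J * E)
  refine (tsum_of_norm_bounded (hs1.add hs2) hbound).trans ?_
  gcongr
  refine (tsum_exp_neg_mul_int_sq_le ha0).trans ?_
  have h6 : 1 / √a ≤ 2 * z := by
    rw [ha, Real.sqrt_div (by positivity), Real.sqrt_sq hz0.le, one_div_div, div_le_iff₀ (by positivity)]
    have : (1 / 2 : ℝ) ≤ √(lam / 2) := by
      apply Real.le_sqrt_of_sq_le
      linarith
    nlinarith
  nlinarith

theorem sqrt_mul_norm_dualForm_le (hlam : 2 ≤ lam) (hJ : 1 ≤ J) (hρ0 : 0 ≤ ρ) (hρ : ρ ≤ 1 / 8)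
    {Z : ℝ} (hZ : lam ≤ Z) (hz : z ∈ Set.Icc Z (2 * Z)) :
    √z * ‖dualForm lam J z‖ ≤
      2 * ∑ m ∈ Finset.Icc 1 J, (hits (latticeBox (4 * ρ) (Z / 4)) upperRoot (2 / m) z : ℝ) +
        (J * Real.exp (-(Real.pi * lam * ρ ^ 2 / 2)) * (6 * gaussianSum * Z) +
          25 * gaussianSum * lam ^ 2 * (1 + Real.log J)) := by
  have hg := one_le_gaussianSum
  have h1 := norm_kernelForm_sub_le (J := J) (by linarith) (hZ.trans hz.1)
  have hz1 : 1 ≤ z := by linarith [hz.1]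
  have h2 := norm_kernelForm_le (lam := lam) (ρ := ρ) (by linarith) hJ hρ0 hz1
  have h3 := sum_norm_halfFejer_le hJ hρ (by linarith) hz
  have h4 : √z * ‖dualForm lam J z‖ = ‖sqrtI * √z * dualForm lam J z‖ := by
    rw [norm_mul, norm_mul, norm_sqrtI, Complex.norm_real, Real.norm_of_nonneg (Real.sqrt_nonneg _),
      one_mul]
  have h5 := norm_sub_norm_le (sqrtI * √z * dualForm lam J z) (kernelForm lam J z)
  rw [norm_sub_rev] at h5
  have h6 : J * Real.exp (-(Real.pi * lam * ρ ^ 2 / 2)) * (3 * gaussianSum * z) ≤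
      J * Real.exp (-(Real.pi * lam * ρ ^ 2 / 2)) * (6 * gaussianSum * Z) := by
    have h7 := hz.2
    have : 3 * gaussianSum * z ≤ 6 * gaussianSum * Z := by nlinarith
    gcongr
  rw [h4]
  linarith

end

/-! ### Mean square of the dual form on a dyadic block. -/

open MeasureTheory

/-- Cauchy–Schwarz with weights `1 / m`. The factor `m` left on the right cancels the window length
of order `1 / m` in `integral_hits_sq_le`, so every scale contributes its energy with the same
constant. -/
theorem sum_sq_le_one_add_log_mul {J : ℕ} (f : ℕ → ℝ) :
    (∑ m ∈ Finset.Icc 1 J, f m) ^ 2 ≤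
      (1 + Real.log J) * ∑ m ∈ Finset.Icc 1 J, m * f m ^ 2 := by
  have h1 : (∑ m ∈ Finset.Icc 1 J, f m) ^ 2 ≤
      (∑ m ∈ Finset.Icc 1 J, 1 / (m : ℝ)) * ∑ m ∈ Finset.Icc 1 J, m * f m ^ 2 := by
    refine Finset.sum_sq_le_sum_mul_sum_of_sq_le_mul _ (fun m _ => by positivity)
      (fun m _ => by positivity) fun m hm => ?_
    have : (m : ℝ) ≠ 0 := by
      have := (Finset.mem_Icc.1 hm).1
      exact_mod_cast (by omega : m ≠ 0)
    apply le_of_eq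
    field_simp
  refine h1.trans ?_
  gcongr
  exact sum_inv_le_one_add_log J

section
variable {lam ρ Z : ℝ} {J : ℕ}

theorem integral_block_le_energy (hlam : 2 ≤ lam) (hJ : 1 ≤ J) (hρ0 : 0 ≤ ρ) (hρ : ρ ≤ 1 / 8)
    (hZ : lam ≤ Z) {R : ℝ} (hR : J * Real.exp (-(Real.pi * lam * ρ ^ 2 / 2)) *
      (6 * gaussianSum * Z) + 25 * gaussianSum * lam ^ 2 * (1 + Real.log J) ≤ R) :
    ∫ z in Set.Icc Z (2 * Z), ‖dualForm lam J z‖ ^ 2 ≤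
      32 * (1 + Real.log J) / Z *
        ∑ m ∈ Finset.Icc 1 J, (energy (latticeBox (4 * ρ) (Z / 4)) upperRoot (4 / m) : ℝ) +
      2 * R ^ 2 := by
  have hZ0 : 0 < Z := by linarith
  have hlog : 0 ≤ Real.log J := Real.log_natCast_nonneg J
  set P := latticeBox (4 * ρ) (Z / 4) with hP
  have hcont := continuous_dualForm (lam := lam) (by linarith) J
  have hint : ∀ m : ℕ, IntegrableOn (fun z => (m : ℝ) * (hits P upperRoot (2 / m) z : ℝ) ^ 2)
      (Set.Icc Z (2 * Z)) := fun m => ((integrable_hits_sq P upperRoot).const_mul _).integrableOn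
  have hpt : ∀ z ∈ Set.Icc Z (2 * Z), ‖dualForm lam J z‖ ^ 2 ≤
      8 * (1 + Real.log J) / Z *
        (∑ m ∈ Finset.Icc 1 J, (m : ℝ) * (hits P upperRoot (2 / m) z : ℝ) ^ 2) +
        2 * R ^ 2 / Z := by
    intro z hz
    have hz0 : 0 < z := hZ0.trans_le hz.1
    have h1 := (sqrt_mul_norm_dualForm_le hlam hJ hρ0 hρ hZ hz).trans
      (add_le_add_right hR _)
    set S := ∑ m ∈ Finset.Icc 1 J, (hits P upperRoot (2 / m) z : ℝ) with hS
    have h2 : z * ‖dualForm lam J z‖ ^ 2 ≤ (2 * S + R) ^ 2 := by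
      calc z * ‖dualForm lam J z‖ ^ 2 = (√z * ‖dualForm lam J z‖) ^ 2 := by
            rw [mul_pow, Real.sq_sqrt hz0.le]
        _ ≤ _ := by gcongr
    have h3 : S ^ 2 ≤ _ := sum_sq_le_one_add_log_mul _
    have h4 : Z * ‖dualForm lam J z‖ ^ 2 ≤ 8 * S ^ 2 + 2 * R ^ 2 := by
      have : Z * ‖dualForm lam J z‖ ^ 2 ≤ z * ‖dualForm lam J z‖ ^ 2 := by
        gcongr
        exact hz.1
      nlinarith [sq_nonneg (2 * S - R)]
    rw [div_mul_eq_mul_div, ← add_div, le_div_iff₀ hZ0]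
    linarith
  have hI : IntegrableOn (fun z => ∑ m ∈ Finset.Icc 1 J,
      (m : ℝ) * (hits P upperRoot (2 / m) z : ℝ) ^ 2) (Set.Icc Z (2 * Z)) :=
    integrable_finsetSum _ fun m _ => hint m
  have hvol : volume.real (Set.Icc Z (2 * Z)) = Z := by
    rw [Real.volume_real_Icc_of_le (by linarith)]
    ring
  calc ∫ z in Set.Icc Z (2 * Z), ‖dualForm lam J z‖ ^ 2
      ≤ ∫ z in Set.Icc Z (2 * Z), (8 * (1 + Real.log J) / Z *
        (∑ m ∈ Finset.Icc 1 J, (m : ℝ) * (hits P upperRoot (2 / m) z : ℝ) ^ 2) +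
          2 * R ^ 2 / Z) := by
        refine setIntegral_mono_on ?_ ((hI.const_mul _).add (by simp)) measurableSet_Icc hpt
        exact (hcont.norm.pow 2).continuousOn.integrableOn_compact isCompact_Icc
    _ = 8 * (1 + Real.log J) / Z * ∑ m ∈ Finset.Icc 1 J,
        (m : ℝ) * (∫ z in Set.Icc Z (2 * Z), (hits P upperRoot (2 / m) z : ℝ) ^ 2) +
          2 * R ^ 2 := by
        rw [integral_add (hI.const_mul _) (by simp), integral_const_mul,
          integral_finsetSum _ fun m _ => hint m, setIntegral_const, hvol, smul_eq_mul]
        simp_rw [integral_const_mul]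
        congr 1
        field_simp
    _ ≤ 8 * (1 + Real.log J) / Z * ∑ m ∈ Finset.Icc 1 J,
        4 * (energy P upperRoot (4 / m) : ℝ) + 2 * R ^ 2 := by
        refine add_le_add (mul_le_mul_of_nonneg_left (Finset.sum_le_sum fun m hm => ?_)
          (by positivity)) le_rfl
        have hm0 : (0 : ℝ) < m := by exact_mod_cast (Finset.mem_Icc.1 hm).1
        have h1 : ∫ z in Set.Icc Z (2 * Z), (hits P upperRoot (2 / m) z : ℝ) ^ 2 ≤
            2 * (2 / m) * energy P upperRoot (2 * (2 / m)) :=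
          (setIntegral_le_integral (integrable_hits_sq P upperRoot)
            (Filter.Eventually.of_forall fun z => by positivity)).trans
            (integral_hits_sq_le P upperRoot (by positivity))
        have h2 : 2 * (2 / (m : ℝ)) = 4 / m := by ring
        rw [h2] at h1
        calc _ ≤ (m : ℝ) * (4 / m * energy P upperRoot (4 / m)) :=
              mul_le_mul_of_nonneg_left h1 hm0.le
          _ = _ := by field_simp
    _ = _ := by
        rw [← Finset.mul_sum]
        ring

/-- Summed over the scales `4 / m`, the energy hypothesis gives `Z³` times a logarithm plus `J Z^(2
+ γ)`. Division by `Z` and the bound `Z ≤ 2 J L` leave `J^(2 + γ)` up to powers of `L`. -/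
theorem integral_block_le (hlam : 4 ≤ lam) (hJ : 1 ≤ J) (hρ0 : 0 ≤ ρ) (hρ : ρ ≤ 1 / 8)
    (hZ : lam ≤ Z) {L γ B : ℝ} (hL : 1 ≤ L) (hJL : (J : ℝ) ≤ Real.exp L)
    (hlamρ : 2 * L ≤ lam * ρ ^ 2) (hγ0 : 0 ≤ γ) (hγ : γ ≤ 1) (hB : 1 ≤ B) (hZJ : Z ≤ 2 * J * L)
    (hE : ∀ δ, 0 < δ → (energy (latticeBox (4 * ρ) (Z / 4)) upperRoot δ : ℝ) ≤
      B * (δ * (Z / 4) ^ 3 + (Z / 4) ^ (2 + γ))) :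
    ∫ z in Set.Icc Z (2 * Z), ‖dualForm lam J z‖ ^ 2 ≤
      1024 * B * L ^ 4 * (J : ℝ) ^ (2 + γ) + 7688 * gaussianSum ^ 2 * lam ^ 4 * L ^ 2 := by
  have hg := one_le_gaussianSum
  have hZ0 : 0 < Z := by linarith
  have hJ1 : (1 : ℝ) ≤ J := by exact_mod_cast hJ
  have hJ0 : (0 : ℝ) < J := by linarith
  have hlog0 : 0 ≤ Real.log J := Real.log_natCast_nonneg J
  have hlog : Real.log J ≤ L := (Real.log_le_iff_le_exp hJ0).2 hJL
  have hR : J * Real.exp (-(Real.pi * lam * ρ ^ 2 / 2)) * (6 * gaussianSum * Z) +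
      25 * gaussianSum * lam ^ 2 * (1 + Real.log J) ≤ 62 * gaussianSum * lam ^ 2 * L := by
    -- The condition `2 L ≤ lam ρ²` is there for this: the discarded `h` then cost a factor `J⁻²`,
    -- which offsets `J * Z ≤ 2 J² L`.
    have h1 : Real.exp (-(Real.pi * lam * ρ ^ 2 / 2)) ≤ 1 / (J : ℝ) ^ 2 := by
      rw [Real.exp_neg, ← one_div]
      apply one_div_le_one_div_of_le (by positivity)
      calc (J : ℝ) ^ 2 ≤ Real.exp L ^ 2 := by gcongr
        _ = Real.exp (2 * L) := by
            rw [← Real.exp_nat_mul]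
            norm_num
        _ ≤ _ := by
            apply Real.exp_le_exp.2
            have := Real.pi_gt_three
            have h0 : 0 ≤ lam * ρ ^ 2 := by positivity
            nlinarith
    have h2 : J * Real.exp (-(Real.pi * lam * ρ ^ 2 / 2)) * (6 * gaussianSum * Z) ≤
        12 * gaussianSum * L := by
      calc _ ≤ J * (1 / (J : ℝ) ^ 2) * (6 * gaussianSum * (2 * J * L)) := by gcongr
        _ = _ := by
            field_simp
            norm_num
    have h3 : 25 * gaussianSum * lam ^ 2 * (1 + Real.log J) ≤
        25 * gaussianSum * lam ^ 2 * (2 * L) := by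
      gcongr
      linarith
    have h4 : 12 * gaussianSum * L ≤ 12 * gaussianSum * L * lam ^ 2 :=
      le_mul_of_one_le_right (by positivity) (one_le_pow₀ (by linarith))
    linarith
  refine (integral_block_le_energy (by linarith) hJ hρ0 hρ hZ hR).trans ?_
  have hsum : ∑ m ∈ Finset.Icc 1 J,
      (energy (latticeBox (4 * ρ) (Z / 4)) upperRoot (4 / m) : ℝ) ≤
      2 * B * L * Z ^ 3 + B * J * Z ^ (2 + γ) := by
    calc _ ≤ ∑ m ∈ Finset.Icc 1 J, (B * Z ^ 3 * (1 / (m : ℝ)) + B * Z ^ (2 + γ)) := by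
          refine Finset.sum_le_sum fun m hm => ?_
          have hm0 : (0 : ℝ) < m := by exact_mod_cast (Finset.mem_Icc.1 hm).1
          refine (hE (4 / m) (by positivity)).trans ?_
          have h1 : (Z / 4) ^ (2 + γ) ≤ Z ^ (2 + γ) := by
            apply Real.rpow_le_rpow (by positivity) (by linarith) (by linarith)
          have h2 : 4 / (m : ℝ) * (Z / 4) ^ 3 ≤ Z ^ 3 * (1 / (m : ℝ)) := by
            have : 0 < Z ^ 3 / m := by positivity
            calc _ = 1 / 16 * (Z ^ 3 / m) := by ring
              _ ≤ 1 * (Z ^ 3 / m) := by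
                gcongr
                norm_num
              _ = _ := by ring
          calc _ ≤ B * (Z ^ 3 * (1 / (m : ℝ)) + Z ^ (2 + γ)) := by gcongr
            _ = _ := by ring
      _ = B * Z ^ 3 * ∑ m ∈ Finset.Icc 1 J, 1 / (m : ℝ) + J * (B * Z ^ (2 + γ)) := by
          rw [Finset.sum_add_distrib, ← Finset.mul_sum]
          simp
      _ ≤ B * Z ^ 3 * (2 * L) + J * (B * Z ^ (2 + γ)) := by
          gcongr
          exact (sum_inv_le_one_add_log J).trans (by linarith)
      _ = _ := by ring
  have hZ2 : Z ^ 2 ≤ 4 * L ^ 2 * (J : ℝ) ^ (2 + γ) := by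
    have h1 : (J : ℝ) ^ (2 : ℝ) ≤ (J : ℝ) ^ (2 + γ) :=
      Real.rpow_le_rpow_of_exponent_le hJ1 (by linarith)
    rw [Real.rpow_two] at h1
    calc Z ^ 2 ≤ (2 * J * L) ^ 2 := by gcongr
      _ = 4 * L ^ 2 * (J : ℝ) ^ 2 := by ring
      _ ≤ _ := by gcongr
  have hZγ : J * Z ^ (1 + γ) ≤ 4 * L ^ 2 * (J : ℝ) ^ (2 + γ) := by
    have h1 : Z ^ (1 + γ) ≤ (2 * L) ^ (2 : ℝ) * (J : ℝ) ^ (1 + γ) := by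
      calc Z ^ (1 + γ) ≤ (2 * L * J) ^ (1 + γ) := by
            apply Real.rpow_le_rpow hZ0.le (by linarith) (by linarith)
        _ = (2 * L) ^ (1 + γ) * (J : ℝ) ^ (1 + γ) := by
            rw [Real.mul_rpow (by linarith) hJ0.le]
        _ ≤ _ := by
            gcongr
            · linarith
            · linarith
    rw [Real.rpow_two] at h1
    calc J * Z ^ (1 + γ) ≤ J * ((2 * L) ^ 2 * (J : ℝ) ^ (1 + γ)) := by gcongr
      _ = 4 * L ^ 2 * ((J : ℝ) ^ (1 + γ) * J) := by ring
      _ = _ := by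
        rw [← Real.rpow_add_one hJ0.ne']
        ring_nf
  have hmain : 32 * (1 + Real.log J) / Z * (2 * B * L * Z ^ 3 + B * J * Z ^ (2 + γ)) ≤
      1024 * B * L ^ 4 * (J : ℝ) ^ (2 + γ) := by
    have h1 : Z ^ (2 + γ) = Z * Z ^ (1 + γ) := by
      rw [mul_comm, ← Real.rpow_add_one hZ0.ne']
      ring_nf
    have hX : 0 ≤ (J : ℝ) ^ (2 + γ) := by positivity
    calc _ = 32 * (1 + Real.log J) * B * (2 * L * Z ^ 2 + J * Z ^ (1 + γ)) := by
          rw [h1]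
          field_simp
      _ ≤ 32 * (2 * L) * B * (2 * L * (4 * L ^ 2 * (J : ℝ) ^ (2 + γ)) +
          4 * L ^ 2 * (J : ℝ) ^ (2 + γ)) := by
          gcongr
          linarith
      _ = 512 * B * (L ^ 4 * (J : ℝ) ^ (2 + γ)) + 256 * B * (L ^ 3 * (J : ℝ) ^ (2 + γ)) := by ring
      _ ≤ 512 * B * (L ^ 4 * (J : ℝ) ^ (2 + γ)) + 256 * B * (L ^ 4 * (J : ℝ) ^ (2 + γ)) := by
          gcongr
          norm_num
      _ ≤ _ := by
          have : 0 ≤ B * (L ^ 4 * (J : ℝ) ^ (2 + γ)) := by positivity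
          linarith
  have h5 : 32 * (1 + Real.log J) / Z * ∑ m ∈ Finset.Icc 1 J,
      (energy (latticeBox (4 * ρ) (Z / 4)) upperRoot (4 / m) : ℝ) ≤
      32 * (1 + Real.log J) / Z * (2 * B * L * Z ^ 3 + B * J * Z ^ (2 + γ)) := by
    gcongr
  calc _ ≤ 1024 * B * L ^ 4 * (J : ℝ) ^ (2 + γ) + 2 * (62 * gaussianSum * lam ^ 2 * L) ^ 2 :=
        add_le_add (h5.trans hmain) le_rfl
    _ = _ := by ring

end

/-! ### Mean square of the dual form over a Gaussian window of length `J`. -/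

section
variable {lam ρ : ℝ} {J : ℕ}

theorem integrable_exp_mul_dualForm {b : ℝ} (hb : 0 < b) (hlam : 1 ≤ lam) :
    Integrable fun z : ℝ => Real.exp (-b * z ^ 2) * ‖dualForm lam J z‖ ^ 2 :=
  integrable_exp_neg_mul_sq_mul_of_bdd hb ((continuous_dualForm hlam J).norm.pow 2) fun z => by
    rw [abs_of_nonneg (by positivity)]
    exact norm_dualForm_sq_le hlam J z

theorem integral_exp_mul_dualForm_eq (b : ℝ) (lam : ℝ) (J : ℕ) :
    ∫ z : ℝ, Real.exp (-b * z ^ 2) * ‖dualForm lam J z‖ ^ 2 =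
      2 * ∫ z in Set.Ioi (0 : ℝ), Real.exp (-b * z ^ 2) * ‖dualForm lam J z‖ ^ 2 := by
  rw [← integral_comp_abs (f := fun z => Real.exp (-b * z ^ 2) * ‖dualForm lam J z‖ ^ 2)]
  congr 1
  funext z
  rcases abs_choice z with h | h
  · rw [h]
  · rw [h, norm_dualForm_neg, neg_sq]

theorem exp_mul_dualForm_le {b : ℝ} (hb : 0 ≤ b) (z : ℝ) :
    Real.exp (-b * z ^ 2) * ‖dualForm lam J z‖ ^ 2 ≤ ‖dualForm lam J z‖ ^ 2 := by
  apply mul_le_of_le_one_left (by positivity)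
  rw [Real.exp_le_one_iff]
  nlinarith [mul_nonneg hb (sq_nonneg z)]

theorem integral_near_zero_le (hlam : 1 ≤ lam) (hJ : 1 ≤ J) {b : ℝ} (hb : 0 ≤ b) :
    ∫ z in (0 : ℝ)..(1 / J), Real.exp (-b * z ^ 2) * ‖dualForm lam J z‖ ^ 2 ≤
      4 * gaussianSum ^ 2 * J ^ 2 := by
  have hJ0 : (0 : ℝ) < J := by exact_mod_cast hJ
  have hc := continuous_dualForm hlam J
  calc _ ≤ ∫ z in (0 : ℝ)..(1 / J), 4 * gaussianSum ^ 2 * (J : ℝ) ^ 3 := by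
        refine intervalIntegral.integral_mono_on (by positivity)
          (Continuous.intervalIntegrable (by fun_prop) _ _) (by simp) fun z _ => ?_
        exact (exp_mul_dualForm_le hb z).trans (norm_dualForm_sq_le hlam J z)
    _ = _ := by
        rw [intervalIntegral.integral_const, smul_eq_mul]
        field_simp
        ring

theorem integral_middle_le (hlam : 1 ≤ lam) (hJ : 1 ≤ J) {b : ℝ} (hb : 0 ≤ b) :
    ∫ z in (1 / (J : ℝ))..lam, Real.exp (-b * z ^ 2) * ‖dualForm lam J z‖ ^ 2 ≤
      9 * gaussianSum ^ 2 * lam ^ 2 * J ^ 2 * (lam + Real.log J) := by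
  have hJ1 : (1 : ℝ) ≤ J := by exact_mod_cast hJ
  have hJ0 : (0 : ℝ) < J := by linarith
  have hc := continuous_dualForm hlam J
  have hle : 1 / (J : ℝ) ≤ lam := (div_le_one_of_le₀ hJ1 hJ0.le).trans hlam
  have hpos : 0 < 1 / (J : ℝ) := by positivity
  have hii : IntervalIntegrable (fun z : ℝ => z⁻¹) volume (1 / (J : ℝ)) lam := by
    refine intervalIntegrable_inv_iff.2 (Or.inr ?_)
    exact Set.notMem_uIcc_of_lt hpos (by linarith)
  calc _ ≤ ∫ z in (1 / (J : ℝ))..lam, 9 * gaussianSum ^ 2 * lam ^ 2 * (J : ℝ) ^ 2 * z⁻¹ := by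
        refine intervalIntegral.integral_mono_on hle
          (Continuous.intervalIntegrable (by fun_prop) _ _) (hii.const_mul _) fun z hz => ?_
        refine (exp_mul_dualForm_le hb z).trans ?_
        rw [← div_eq_mul_inv]
        exact norm_dualForm_sq_le_div hlam J (hpos.trans_le hz.1) hz.2
    _ = 9 * gaussianSum ^ 2 * lam ^ 2 * (J : ℝ) ^ 2 * Real.log (lam / (1 / J)) := by
        rw [intervalIntegral.integral_const_mul, integral_inv_of_pos hpos (by linarith)]
    _ ≤ _ := by
        gcongr
        rw [div_div_eq_mul_div, div_one, Real.log_mul (by linarith) hJ0.ne']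
        gcongr
        exact Real.log_le_self (by linarith)

theorem integral_tail_le (hlam : 1 ≤ lam) (hJ : 1 ≤ J) {L Y : ℝ} (hL : 1 ≤ L)
    (hJL : (J : ℝ) ≤ Real.exp L) (hY : 2 * J * L ≤ Y) :
    ∫ z in Set.Ioi Y, Real.exp (-(1 / (J : ℝ) ^ 2) * z ^ 2) * ‖dualForm lam J z‖ ^ 2 ≤
      12 * gaussianSum ^ 2 * J ^ 2 := by
  have hJ0 : (0 : ℝ) < J := by exact_mod_cast hJ
  have hg := one_le_gaussianSum
  -- Half of the exponent: beyond `2 J L` one factor `exp (-c z²)` is at most `J⁻²`, and the other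
  -- is integrated.
  set c : ℝ := 1 / (2 * (J : ℝ) ^ 2) with hcdef
  have hc0 : 0 < c := by positivity
  have hgi := integrable_exp_neg_mul_sq hc0
  have hpt : ∀ z ∈ Set.Ioi Y, Real.exp (-(1 / (J : ℝ) ^ 2) * z ^ 2) * ‖dualForm lam J z‖ ^ 2 ≤
      4 * gaussianSum ^ 2 * J * Real.exp (-c * z ^ 2) := by
    intro z hz
    have hz' : 2 * J * L ≤ z := hY.trans (le_of_lt hz)
    have h1 : Real.exp (-(1 / (J : ℝ) ^ 2) * z ^ 2) =
        Real.exp (-c * z ^ 2) * Real.exp (-c * z ^ 2) := by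
      rw [← Real.exp_add, hcdef]
      congr 1
      field_simp
      norm_num
    have h2 : Real.exp (-c * z ^ 2) ≤ 1 / (J : ℝ) ^ 2 := by
      have h3 : 2 * L ≤ c * z ^ 2 := by
        have h4 : (2 * J * L) ^ 2 ≤ z ^ 2 := by gcongr
        calc 2 * L ≤ 2 * L ^ 2 := by nlinarith
          _ = c * (2 * J * L) ^ 2 := by
              rw [hcdef]
              field_simp
          _ ≤ _ := by gcongr
      calc Real.exp (-c * z ^ 2) ≤ Real.exp (-(2 * L)) := Real.exp_le_exp.2 (by linarith)
        _ = 1 / Real.exp L ^ 2 := by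
            rw [Real.exp_neg, ← Real.exp_nat_mul, one_div]
            norm_num
        _ ≤ _ := by gcongr
    rw [h1]
    calc _ ≤ Real.exp (-c * z ^ 2) * (1 / (J : ℝ) ^ 2) * (4 * gaussianSum ^ 2 * J ^ 3) := by
          gcongr
          exact norm_dualForm_sq_le hlam J z
      _ = _ := by field_simp
  calc _ ≤ ∫ z in Set.Ioi Y, 4 * gaussianSum ^ 2 * J * Real.exp (-c * z ^ 2) :=
        setIntegral_mono_on
          (integrable_exp_mul_dualForm (by positivity) hlam).integrableOn
          (hgi.const_mul _).integrableOn measurableSet_Ioi hpt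
    _ ≤ ∫ z, 4 * gaussianSum ^ 2 * J * Real.exp (-c * z ^ 2) :=
        setIntegral_le_integral (hgi.const_mul _)
          (Filter.Eventually.of_forall fun z => by positivity)
    _ = 4 * gaussianSum ^ 2 * J * √(Real.pi / c) := by
        rw [integral_const_mul, integral_gaussian]
    _ ≤ 4 * gaussianSum ^ 2 * J * (3 * J) := by
        gcongr
        rw [Real.sqrt_le_left (by positivity), hcdef]
        have := Real.pi_lt_d2
        rw [div_div_eq_mul_div, div_one]
        nlinarith [sq_nonneg (J : ℝ)]
    _ = _ := by ring

theorem exists_dyadic_cover {a X L : ℝ} (ha : 1 ≤ a) (hL : 1 ≤ L) (hX : X ≤ 2 * Real.exp L * L) :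
    ∃ n : ℕ, X ≤ a * 2 ^ n ∧ (∀ i < n, a * 2 ^ i ≤ X) ∧ (n : ℝ) ≤ 6 * L := by
  have hex : ∃ n : ℕ, X ≤ a * 2 ^ n := by
    obtain ⟨n, hn⟩ := pow_unbounded_of_one_lt X (by norm_num : (1 : ℝ) < 2)
    refine ⟨n, hn.le.trans ?_⟩
    exact le_mul_of_one_le_left (by positivity) ha
  classical
  refine ⟨Nat.find hex, Nat.find_spec hex, fun i hi => ?_, ?_⟩
  · exact (not_le.1 (Nat.find_min hex hi)).le
  · rcases Nat.eq_zero_or_pos (Nat.find hex) with h | h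
    · rw [h]
      push_cast
      linarith
    · obtain ⟨m, hm⟩ := Nat.exists_eq_succ_of_ne_zero h.ne'
      have h1 := (not_le.1 (Nat.find_min hex (m := m) (by omega))).le
      have h2 : (2 : ℝ) ^ m ≤ Real.exp (1 + 2 * L) := by
        calc (2 : ℝ) ^ m ≤ a * 2 ^ m := le_mul_of_one_le_left (by positivity) ha
          _ ≤ 2 * Real.exp L * L := h1.trans hX
          _ ≤ Real.exp 1 * Real.exp L * Real.exp L := by
              have h3 := Real.add_one_le_exp L
              have h4 := Real.add_one_le_exp (1 : ℝ)
              gcongr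
              · linarith
              · linarith
          _ = _ := by
              rw [← Real.exp_add, ← Real.exp_add]
              ring_nf
      have h5 : (m : ℝ) * Real.log 2 ≤ 1 + 2 * L := by
        rw [← Real.log_pow, Real.log_le_iff_le_exp (by positivity)]
        exact h2
      have h6 := Real.log_two_gt_d9
      rw [hm]
      push_cast
      nlinarith

/-- The half-line is cut at `1 / J`, at `lam` and beyond `2 J L`. Trivial bounds, the `1 / z` bound
and Gaussian decay settle three ranges; the energy hypothesis is spent on the dyadic blocks in
between, of which there are `O(L)`. -/
theorem integral_dualForm_le (hlam : 4 ≤ lam) (hJ : 1 ≤ J) (hρ0 : 0 ≤ ρ) (hρ : ρ ≤ 1 / 8)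
    {L γ B : ℝ} (hL : 1 ≤ L) (hJL : (J : ℝ) ≤ Real.exp L)
    (hlamρ : 2 * L ≤ lam * ρ ^ 2) (hγ0 : 0 ≤ γ) (hγ : γ ≤ 1) (hB : 1 ≤ B)
    (hE : ∀ Z δ, lam ≤ Z → Z ≤ 2 * J * L → 0 < δ →
      (energy (latticeBox (4 * ρ) (Z / 4)) upperRoot δ : ℝ) ≤
        B * (δ * (Z / 4) ^ 3 + (Z / 4) ^ (2 + γ))) :
    ∫ z : ℝ, Real.exp (-(1 / (J : ℝ) ^ 2) * z ^ 2) * ‖dualForm lam J z‖ ^ 2 ≤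
      110000 * gaussianSum ^ 2 * B * lam ^ 4 * L ^ 5 * (J : ℝ) ^ (2 + γ) := by
  have hg := one_le_gaussianSum
  have hlam1 : 1 ≤ lam := by linarith
  have hJ1 : (1 : ℝ) ≤ J := by exact_mod_cast hJ
  have hJ0 : (0 : ℝ) < J := by linarith
  set b : ℝ := 1 / (J : ℝ) ^ 2 with hb
  have hb0 : 0 < b := by positivity
  set f : ℝ → ℝ := fun z => Real.exp (-b * z ^ 2) * ‖dualForm lam J z‖ ^ 2 with hf
  have hcont := continuous_dualForm hlam1 J
  have hfc : Continuous f := by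
    rw [hf]
    fun_prop
  have hfi : Integrable f := integrable_exp_mul_dualForm hb0 hlam1
  obtain ⟨n, hn1, hn2, hn3⟩ := exists_dyadic_cover (a := lam) (X := 2 * J * L) hlam1 hL
    (by gcongr)
  have hii : ∀ a c : ℝ, IntervalIntegrable f volume a c := fun a c => hfc.intervalIntegrable a c
  have hblocks : ∫ z in lam..(lam * 2 ^ n), f z ≤
      n * (1024 * B * L ^ 4 * (J : ℝ) ^ (2 + γ) + 7688 * gaussianSum ^ 2 * lam ^ 4 * L ^ 2) := by
    have h1 := intervalIntegral.sum_integral_adjacent_intervals (f := f) (μ := volume)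
      (a := fun i => lam * 2 ^ i) (n := n) fun i _ => hii _ _
    rw [pow_zero, mul_one] at h1
    rw [← h1]
    have h2 : ∀ i ∈ Finset.range n, ∫ z in (lam * 2 ^ i)..(lam * 2 ^ (i + 1)), f z ≤
        1024 * B * L ^ 4 * (J : ℝ) ^ (2 + γ) + 7688 * gaussianSum ^ 2 * lam ^ 4 * L ^ 2 := by
      intro i hi
      set Z := lam * 2 ^ i with hZ
      have hZlam : lam ≤ Z := le_mul_of_one_le_right (by linarith) (one_le_pow₀ (by norm_num))
      have hZJ : Z ≤ 2 * J * L := hn2 i (Finset.mem_range.1 hi)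
      have h3 : lam * 2 ^ (i + 1) = 2 * Z := by
        rw [hZ]
        ring
      rw [h3, intervalIntegral.integral_of_le (by linarith), ← integral_Icc_eq_integral_Ioc]
      refine le_trans ?_ (integral_block_le hlam hJ hρ0 hρ hZlam hL hJL hlamρ hγ0 hγ hB hZJ
        fun δ hδ => hE Z δ hZlam hZJ hδ)
      refine setIntegral_mono hfi.integrableOn ?_ fun z => exp_mul_dualForm_le hb0.le z
      exact (hcont.norm.pow 2).continuousOn.integrableOn_compact isCompact_Icc
    refine (Finset.sum_le_card_nsmul _ _ _ h2).trans (le_of_eq ?_)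
    rw [Finset.card_range, nsmul_eq_mul]
  have hsplit : ∫ z in Set.Ioi (0 : ℝ), f z = (∫ z in (0 : ℝ)..(1 / J), f z) +
      (∫ z in (1 / (J : ℝ))..lam, f z) + (∫ z in lam..(lam * 2 ^ n), f z) +
        ∫ z in Set.Ioi (lam * 2 ^ n), f z := by
    rw [intervalIntegral.integral_add_adjacent_intervals (hii _ _) (hii _ _),
      intervalIntegral.integral_add_adjacent_intervals (hii _ _) (hii _ _),
      intervalIntegral.integral_interval_add_Ioi hfi.integrableOn hfi.integrableOn]
  have h1 := integral_near_zero_le hlam1 hJ hb0.le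
  have h2 := integral_middle_le hlam1 hJ hb0.le
  have h4 := integral_tail_le hlam1 hJ hL hJL hn1
  have hlog : Real.log J ≤ L := (Real.log_le_iff_le_exp hJ0).2 hJL
  rw [integral_exp_mul_dualForm_eq b lam J]
  change 2 * ∫ z in Set.Ioi (0 : ℝ), f z ≤ _
  rw [hsplit]
  set X := (J : ℝ) ^ (2 + γ) with hX
  have hJX : (J : ℝ) ^ 2 ≤ X := by
    rw [← Real.rpow_two]
    exact Real.rpow_le_rpow_of_exponent_le hJ1 (by linarith)
  have hX1 : 1 ≤ X := (one_le_pow₀ hJ1).trans hJX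
  have hG1 : 1 ≤ gaussianSum ^ 2 := one_le_pow₀ hg
  set G := gaussianSum ^ 2 with hG
  set M := G * B * lam ^ 4 * L ^ 5 * X with hM
  have hL1 : 1 ≤ L ^ 5 := one_le_pow₀ hL
  have hl1 : 1 ≤ lam ^ 4 := one_le_pow₀ hlam1
  have e1 : G * (J : ℝ) ^ 2 ≤ M := by
    calc G * (J : ℝ) ^ 2 = G * 1 * 1 * 1 * (J : ℝ) ^ 2 := by ring
      _ ≤ G * B * lam ^ 4 * L ^ 5 * X := by gcongr
  have e2 : G * lam ^ 2 * J ^ 2 * (lam + Real.log J) ≤ 2 * M := by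
    calc G * lam ^ 2 * J ^ 2 * (lam + Real.log J) ≤ G * lam ^ 2 * X * (2 * (lam ^ 2 * L)) := by
          have h5 : lam * 1 ≤ lam * (lam * L) := by
            gcongr
            nlinarith
          have h6 : 1 * L ≤ lam ^ 2 * L := by
            gcongr
            exact one_le_pow₀ hlam1
          gcongr
          linarith
      _ = 2 * (G * 1 * lam ^ 4 * L * X) := by ring
      _ ≤ 2 * (G * B * lam ^ 4 * L ^ 5 * X) := by
          have : L ≤ L ^ 5 := le_self_pow₀ hL (by norm_num)
          gcongr
  have e3 : n * (1024 * B * L ^ 4 * X + 7688 * G * lam ^ 4 * L ^ 2) ≤ 52272 * M := by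
    have k1 : L * (B * L ^ 4 * X) ≤ M := by
      calc L * (B * L ^ 4 * X) = 1 * B * 1 * L ^ 5 * X := by ring
        _ ≤ G * B * lam ^ 4 * L ^ 5 * X := by gcongr
    have k2 : L * (G * lam ^ 4 * L ^ 2) ≤ M := by
      calc L * (G * lam ^ 4 * L ^ 2) = G * 1 * lam ^ 4 * L ^ 3 * 1 := by ring
        _ ≤ G * B * lam ^ 4 * L ^ 5 * X := by
          have : L ^ 3 ≤ L ^ 5 := pow_le_pow_right₀ hL (by norm_num)
          gcongr
    calc _ ≤ 6 * L * (1024 * B * L ^ 4 * X + 7688 * G * lam ^ 4 * L ^ 2) := by gcongr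
      _ = 6144 * (L * (B * L ^ 4 * X)) + 46128 * (L * (G * lam ^ 4 * L ^ 2)) := by ring
      _ ≤ _ := by linarith
  have hgoal : 110000 * G * B * lam ^ 4 * L ^ 5 * X = 110000 * M := by
    rw [hM]
    ring
  rw [hgoal]
  have hM0 : 0 ≤ M := by positivity
  have h1' : ∫ z in (0 : ℝ)..(1 / J), f z ≤ 4 * M := h1.trans (by linarith)
  have h2' : ∫ z in (1 / (J : ℝ))..lam, f z ≤ 18 * M := h2.trans (by linarith)
  have h3' : ∫ z in lam..(lam * 2 ^ n), f z ≤ 52272 * M := hblocks.trans e3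
  have h4' : ∫ z in Set.Ioi (lam * 2 ^ n), f z ≤ 12 * M := h4.trans (by linarith)
  linarith

end

/-! ### From the mean square of the dual form back to the energy of a large box. -/

section
variable {lam ρ ρ' N : ℝ} {J : ℕ}

theorem hits_latticeBox_eq_zero {δ z : ℝ} (hρ : ρ ≤ 1) (hN : 1 ≤ N) (hδ : δ ≤ 1 / 4)
    (hz : z ∉ Set.Icc (N / 2) (33 * N)) : hits (latticeBox ρ N) upperRoot δ z = 0 := by
  rw [hits, Finset.card_eq_zero, Finset.filter_eq_empty_iff]
  intro p hp hle
  obtain ⟨h1, h2, -⟩ := (mem_latticeBox hρ (by linarith)).1 hp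
  have h3 : (p.2 : ℝ) ≤ upperRoot p := le_upperRoot (h := p.1) (s := p.2)
  have h4 : upperRoot p ≤ 2 * p.2 := upperRoot_le (h := p.1) (s := p.2) (by linarith)
  have h5 := abs_le.1 hle
  exact hz ⟨by linarith, by linarith⟩

theorem hits_latticeBox_sq_le {z L : ℝ} (hlam : 1 ≤ lam) (hJ : 1 ≤ J) (hρ0 : 0 ≤ ρ) (hρ : ρ ≤ 1)
    (hN : 2 * lam ≤ N) (hL : 1 ≤ L) (hJL : (J : ℝ) ≤ Real.exp L)
    (hz : z ∈ Set.Icc (N / 2) (33 * N)) :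
    (hits (latticeBox ρ N) upperRoot (1 / (4 * J)) z : ℝ) ^ 2 ≤
      12 / (J : ℝ) ^ 2 * Real.exp (8 * Real.pi * lam * ρ ^ 2) *
        (14356 * gaussianSum ^ 2 * lam ^ 4 * L ^ 2 * N ^ 2 +
          132 * N * ‖dualForm lam J z‖ ^ 2) := by
  obtain ⟨hz1, hz2⟩ := hz
  have hJ0 : (0 : ℝ) < J := by exact_mod_cast hJ
  have hN0 : 0 ≤ N := by linarith
  have hz0 : 1 ≤ z := by linarith
  have hg := one_le_gaussianSum
  have hlog : Real.log J ≤ L := (Real.log_le_iff_le_exp hJ0).2 hJL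
  have h1 := hits_latticeBox_le (δ := 1 / (4 * J)) hlam hJ hρ0 hρ (by linarith : 1 ≤ N) le_rfl
    (by linarith : 0 < z)
  have h2 := norm_kernelForm_sub_le (J := J) hlam (by linarith : lam ≤ z)
  have h3 : ‖kernelForm lam J z‖ ≤ √z * ‖dualForm lam J z‖ + 50 * gaussianSum * lam ^ 2 * L := by
    have h4 : 25 * gaussianSum * lam ^ 2 * (1 + Real.log J) ≤
        25 * gaussianSum * lam ^ 2 * (2 * L) := by
      gcongr
      linarith
    have h5 : ‖sqrtI * (√z : ℂ) * dualForm lam J z‖ = √z * ‖dualForm lam J z‖ := by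
      rw [norm_mul, norm_mul, norm_sqrtI, Complex.norm_real, Real.norm_of_nonneg (Real.sqrt_nonneg z),
        one_mul]
    have h6 := norm_le_norm_add_norm_sub' (kernelForm lam J z) (sqrtI * (√z : ℂ) * dualForm lam J z)
    linarith
  set E := Real.exp (4 * Real.pi * lam * ρ ^ 2) with hE
  have hE2 : Real.exp (8 * Real.pi * lam * ρ ^ 2) = E ^ 2 := by
    rw [hE, ← Real.exp_nat_mul]
    congr 1
    push_cast
    ring
  set G := gaussianSum with hG
  set D := ‖dualForm lam J z‖ with hD
  have hD0 : 0 ≤ D := norm_nonneg _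
  have h4 : (hits (latticeBox ρ N) upperRoot (1 / (4 * J)) z : ℝ) ≤
      2 / J * E * (2 * G * z + 2 * (√z * D) + 100 * G * lam ^ 2 * L) := by
    have hG0 : G ≤ G * z := le_mul_of_one_le_right (by linarith) hz0
    refine h1.trans (mul_le_mul_of_nonneg_left ?_ (by positivity))
    linarith
  have h5 : (2 * G * z + 2 * (√z * D) + 100 * G * lam ^ 2 * L) ^ 2 ≤
      3 * (4 * G ^ 2 * z ^ 2 + 4 * (z * D ^ 2) + 10000 * G ^ 2 * lam ^ 4 * L ^ 2) := by
    have h6 : z * D ^ 2 = (√z * D) ^ 2 := by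
      rw [mul_pow, Real.sq_sqrt (by linarith)]
    rw [h6]
    generalize √z * D = y
    nlinarith [sq_nonneg (2 * G * z - 2 * y), sq_nonneg (2 * G * z - 100 * G * lam ^ 2 * L),
      sq_nonneg (2 * y - 100 * G * lam ^ 2 * L)]
  have hl1 : 1 ≤ lam ^ 4 := one_le_pow₀ hlam
  have hL1 : 1 ≤ L ^ 2 := one_le_pow₀ hL
  have hN1 : 1 ≤ N ^ 2 := one_le_pow₀ (by linarith)
  have h6 : G ^ 2 * z ^ 2 ≤ 1089 * (G ^ 2 * lam ^ 4 * L ^ 2 * N ^ 2) := by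
    calc G ^ 2 * z ^ 2 ≤ G ^ 2 * (33 * N) ^ 2 := by gcongr
      _ = 1089 * (G ^ 2 * 1 * 1 * N ^ 2) := by ring
      _ ≤ _ := by gcongr
  have h7 : G ^ 2 * lam ^ 4 * L ^ 2 ≤ G ^ 2 * lam ^ 4 * L ^ 2 * N ^ 2 :=
    le_mul_of_one_le_right (by positivity) hN1
  have h8 : z * D ^ 2 ≤ 33 * N * D ^ 2 := by gcongr
  calc _ ≤ (2 / J * E * (2 * G * z + 2 * (√z * D) + 100 * G * lam ^ 2 * L)) ^ 2 := by gcongr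
    _ = 4 / (J : ℝ) ^ 2 * E ^ 2 * (2 * G * z + 2 * (√z * D) + 100 * G * lam ^ 2 * L) ^ 2 := by
        ring
    _ ≤ 4 / (J : ℝ) ^ 2 * E ^ 2 * (3 * (14356 * G ^ 2 * lam ^ 4 * L ^ 2 * N ^ 2 +
          132 * N * D ^ 2)) := by
        gcongr
        linarith
    _ = _ := by
        rw [hE2]
        ring

/-- This is the descent from length `N` to length `J`: mean square monotonicity with parameters `1 /
N² ≤ 1 / J²`. On the range of integration the Gaussian of width `N` is at least `exp (-33²)`. -/
theorem setIntegral_dualForm_sq_le (hlam : 1 ≤ lam) (hJ : 1 ≤ J) (hJN : (J : ℝ) ≤ N) :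
    ∫ z in Set.Icc (N / 2) (33 * N), ‖dualForm lam J z‖ ^ 2 ≤
      Real.exp 1089 * (N / J *
        ∫ z : ℝ, Real.exp (-(1 / (J : ℝ) ^ 2) * z ^ 2) * ‖dualForm lam J z‖ ^ 2) := by
  have hJ0 : (0 : ℝ) < J := by exact_mod_cast hJ
  have hN : 0 < N := by linarith
  have hcont := continuous_dualForm hlam J
  have hint := integrable_exp_mul_dualForm (J := J) (b := 1 / N ^ 2) (by positivity) hlam
  have h1 := sqrt_mul_integral_dualForm_mono hlam J (b := 1 / N ^ 2) (c := 1 / (J : ℝ) ^ 2)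
    (by positivity) (by gcongr)
  rw [Real.sqrt_div zero_le_one, Real.sqrt_div zero_le_one, Real.sqrt_one, Real.sqrt_sq hN.le,
    Real.sqrt_sq hJ0.le] at h1
  have h2 : ∫ z : ℝ, Real.exp (-(1 / N ^ 2) * z ^ 2) * ‖dualForm lam J z‖ ^ 2 ≤
      N / J * ∫ z : ℝ, Real.exp (-(1 / (J : ℝ) ^ 2) * z ^ 2) * ‖dualForm lam J z‖ ^ 2 := by
    have h3 := mul_le_mul_of_nonneg_left h1 hN.le
    rw [← mul_assoc, ← mul_assoc, mul_one_div_cancel hN.ne', one_mul, mul_one_div] at h3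
    exact h3
  calc _ ≤ ∫ z in Set.Icc (N / 2) (33 * N), Real.exp 1089 *
        (Real.exp (-(1 / N ^ 2) * z ^ 2) * ‖dualForm lam J z‖ ^ 2) := by
        refine setIntegral_mono_on
          (hcont.norm.pow 2).continuousOn.integrableOn_Icc
          (hint.const_mul _).integrableOn measurableSet_Icc fun z hz => ?_
        rw [← mul_assoc, ← Real.exp_add]
        refine le_mul_of_one_le_left (by positivity) (Real.one_le_exp ?_)
        have h3 : z ^ 2 ≤ (33 * N) ^ 2 := by
          have : 0 ≤ z := by linarith [hz.1]
          have := hz.2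
          gcongr
        have h4 : 1 / N ^ 2 * z ^ 2 ≤ 1 / N ^ 2 * (33 * N) ^ 2 := by gcongr
        have h5 : 1 / N ^ 2 * (33 * N) ^ 2 = 1089 := by
          field_simp
          norm_num
        linarith
    _ ≤ ∫ z : ℝ, Real.exp 1089 *
        (Real.exp (-(1 / N ^ 2) * z ^ 2) * ‖dualForm lam J z‖ ^ 2) :=
        setIntegral_le_integral (hint.const_mul _)
          (Filter.Eventually.of_forall fun z => by positivity)
    _ = Real.exp 1089 * ∫ z : ℝ, Real.exp (-(1 / N ^ 2) * z ^ 2) * ‖dualForm lam J z‖ ^ 2 :=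
        integral_const_mul _ _
    _ ≤ _ := by gcongr

/-- The squared hits are of order `J⁻² (N² + N |dualForm|²)`. Integrating over length `N`, with `(N
/ J) J^(2 + γ)` for the mean square, and dividing by the scale `1 / (4 J)` gives the two terms. -/
theorem energy_latticeBox_le_of_dyadic (hlam : 4 ≤ lam) (hJ : 1 ≤ J) (hρ0 : 0 ≤ ρ) (hρ : ρ ≤ 1 / 8)
    {L γ B : ℝ} (hL : 1 ≤ L) (hJL : (J : ℝ) ≤ Real.exp L)
    (hlamρ : 2 * L ≤ lam * ρ ^ 2) (hγ0 : 0 ≤ γ) (hγ : γ ≤ 1) (hB : 1 ≤ B)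
    (hE : ∀ Z δ, lam ≤ Z → Z ≤ 2 * J * L → 0 < δ →
      (energy (latticeBox (4 * ρ) (Z / 4)) upperRoot δ : ℝ) ≤
        B * (δ * (Z / 4) ^ 3 + (Z / 4) ^ (2 + γ)))
    (hN : 2 * lam ≤ N) (hJN : (J : ℝ) ≤ N) (hρ0' : 0 ≤ ρ') (hρ' : ρ' ≤ 1) :
    (energy (latticeBox ρ' N) upperRoot (1 / (4 * J)) : ℝ) ≤
      10 ^ 9 * Real.exp 1089 * Real.exp (8 * Real.pi * lam * ρ' ^ 2) *
        (gaussianSum ^ 2 * B * lam ^ 4 * L ^ 5) * (N ^ 3 / J + N ^ 2 * (J : ℝ) ^ γ) := by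
  have hJ1 : (1 : ℝ) ≤ J := by exact_mod_cast hJ
  have hJ0 : (0 : ℝ) < J := by linarith
  have hN0 : 0 < N := by linarith
  have hg := one_le_gaussianSum
  have hcont := continuous_dualForm (by linarith : 1 ≤ lam) J
  set κ := Real.exp (8 * Real.pi * lam * ρ' ^ 2) with hκ
  set I := ∫ z : ℝ, Real.exp (-(1 / (J : ℝ) ^ 2) * z ^ 2) * ‖dualForm lam J z‖ ^ 2
  have hI := integral_dualForm_le hlam hJ hρ0 hρ hL hJL hlamρ hγ0 hγ hB hE
  have hδ : (1 : ℝ) / (4 * J) ≤ 1 / 4 := by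
    apply one_div_le_one_div_of_le (by norm_num)
    linarith
  have h1 := mul_energy_le_integral_hits_sq (latticeBox ρ' N) upperRoot (δ := 1 / (4 * J))
  rw [← setIntegral_eq_integral_of_forall_compl_eq_zero (s := Set.Icc (N / 2) (33 * N))
    fun z hz => by rw [hits_latticeBox_eq_zero hρ' (by linarith) hδ hz]; norm_num] at h1
  have hg2i : IntegrableOn (fun z => ‖dualForm lam J z‖ ^ 2) (Set.Icc (N / 2) (33 * N)) :=
    (hcont.norm.pow 2).continuousOn.integrableOn_Icc
  have hci : IntegrableOn (fun _ : ℝ => 14356 * gaussianSum ^ 2 * lam ^ 4 * L ^ 2 * N ^ 2)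
      (Set.Icc (N / 2) (33 * N)) := continuousOn_const.integrableOn_Icc
  have h2 : ∫ z in Set.Icc (N / 2) (33 * N),
      (hits (latticeBox ρ' N) upperRoot (1 / (4 * J)) z : ℝ) ^ 2 ≤
      12 / (J : ℝ) ^ 2 * κ * (33 * N * (14356 * gaussianSum ^ 2 * lam ^ 4 * L ^ 2 * N ^ 2) +
        132 * N * ∫ z in Set.Icc (N / 2) (33 * N), ‖dualForm lam J z‖ ^ 2) := by
    refine (setIntegral_mono_on (integrable_hits_sq _ _).integrableOn
      ((hci.add (hg2i.const_mul (132 * N))).const_mul (12 / (J : ℝ) ^ 2 * κ)) measurableSet_Icc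
      fun z hz => hits_latticeBox_sq_le (by linarith) hJ hρ0' hρ' hN hL hJL hz).trans ?_
    rw [integral_const_mul]
    gcongr
    refine (integral_add hci (hg2i.const_mul (132 * N))).le.trans ?_
    rw [setIntegral_const, integral_const_mul, smul_eq_mul, Real.volume_real_Icc_of_le (by linarith)]
    gcongr
    linarith
  have h3 := setIntegral_dualForm_sq_le (lam := lam) (by linarith) hJ hJN
  have hX : (J : ℝ) ^ (2 + γ) = J ^ 2 * (J : ℝ) ^ γ := by
    rw [Real.rpow_add hJ0, Real.rpow_two]
  set M := gaussianSum ^ 2 * B * lam ^ 4 * L ^ 5 with hM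
  have h4 : ∫ z in Set.Icc (N / 2) (33 * N), ‖dualForm lam J z‖ ^ 2 ≤
      Real.exp 1089 * (N / J * (110000 * M * (J ^ 2 * (J : ℝ) ^ γ))) := by
    refine h3.trans ?_
    gcongr
    rw [← hX]
    refine hI.trans (le_of_eq ?_)
    rw [hM]
    ring
  have h5 : gaussianSum ^ 2 * lam ^ 4 * L ^ 2 ≤ M := by
    have h6 : L ^ 2 ≤ L ^ 5 := pow_le_pow_right₀ hL (by norm_num)
    calc gaussianSum ^ 2 * lam ^ 4 * L ^ 2 = gaussianSum ^ 2 * 1 * lam ^ 4 * L ^ 2 := by ring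
      _ ≤ gaussianSum ^ 2 * B * lam ^ 4 * L ^ 5 := by gcongr
  have hM0 : 0 ≤ M := by positivity
  have hexp : 1 ≤ Real.exp 1089 := Real.one_le_exp (by norm_num)
  have h7 : 1 / (4 * (J : ℝ)) * energy (latticeBox ρ' N) upperRoot (1 / (4 * J)) ≤
      12 / (J : ℝ) ^ 2 * κ * (33 * N * (14356 * M * N ^ 2) +
        132 * N * (Real.exp 1089 * (N / J * (110000 * M * (J ^ 2 * (J : ℝ) ^ γ))))) := by
    have h6 : 14356 * gaussianSum ^ 2 * lam ^ 4 * L ^ 2 * N ^ 2 ≤ 14356 * M * N ^ 2 := by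
      refine mul_le_mul_of_nonneg_right ?_ (by positivity)
      linarith
    refine h1.trans (h2.trans ?_)
    gcongr
  have h8 := mul_le_mul_of_nonneg_left h7 (by positivity : (0 : ℝ) ≤ 4 * J)
  rw [← mul_assoc, mul_one_div_cancel (by positivity), one_mul] at h8
  refine h8.trans ?_
  have h9 : 4 * J * (12 / (J : ℝ) ^ 2 * κ * (33 * N * (14356 * M * N ^ 2) +
        132 * N * (Real.exp 1089 * (N / J * (110000 * M * (J ^ 2 * (J : ℝ) ^ γ)))))) =
      κ * M * (22739904 * 1 * (N ^ 3 / J) +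
        696960000 * Real.exp 1089 * (N ^ 2 * (J : ℝ) ^ γ)) := by
    field_simp
    ring
  rw [h9]
  calc _ ≤ κ * M * (10 ^ 9 * Real.exp 1089 * (N ^ 3 / J) +
        10 ^ 9 * Real.exp 1089 * (N ^ 2 * (J : ℝ) ^ γ)) := by
        gcongr
        · norm_num
        · norm_num
    _ = _ := by ring

end

/-! ### Induction on the exponent of the energy bound. -/

/-- `energy (latticeBox ρ Z) upperRoot δ ≪ δ Z³ + Z^(2 + γ)`, up to powers of `log Z`, for thin
boxes. -/
def EnergyBound (γ : ℝ) : Prop :=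
  ∃ (C : ℝ) (k : ℕ), 1 ≤ C ∧ ∀ L Z δ ρ : ℝ, 1 ≤ L → 1 ≤ Z → Z ≤ Real.exp L → 0 < δ → 0 ≤ ρ →
    ρ ≤ 1 / (8 * L ^ k) →
      (energy (latticeBox ρ Z) upperRoot δ : ℝ) ≤ C * L ^ k * (δ * Z ^ 3 + Z ^ (2 + γ))

theorem energyBound_one : EnergyBound 1 := by
  refine ⟨40000, 0, by norm_num, fun L Z δ ρ _ hZ _ hδ _ _ => ?_⟩
  refine (energy_latticeBox_le hZ hδ.le).trans (le_of_eq ?_)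
  have : Z ^ ((2 : ℝ) + 1) = Z ^ 3 := by
    rw [← Real.rpow_natCast]
    norm_num
  rw [this]
  ring

/-- The value `N^(1 / (1 + γ))` equalises `N³ / J` and `N² J^γ`. The cap `1 / (4 δ)` keeps the scale
`1 / (4 J)` above `δ`, and when it is active `N³ / J` is comparable to `δ N³`. -/
theorem exists_nat_balance {N δ γ : ℝ} (hN : 1 ≤ N) (hδ : 0 < δ) (hδ4 : δ ≤ 1 / 4) (hγ0 : 0 ≤ γ) :
    ∃ J : ℕ, 1 ≤ J ∧ (J : ℝ) ≤ N ∧ δ ≤ 1 / (4 * J) ∧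
      N ^ 3 / J + N ^ 2 * (J : ℝ) ^ γ ≤ 8 * (δ * N ^ 3 + N ^ (2 + γ / (1 + γ))) := by
  have hN0 : 0 < N := by linarith
  set Y := min (1 / (4 * δ)) (N ^ (1 / (1 + γ))) with hY
  have hY1 : 1 ≤ Y := by
    refine le_min ?_ (Real.one_le_rpow hN (by positivity))
    rw [le_div_iff₀ (by positivity)]
    linarith
  have hJ : 1 ≤ ⌊Y⌋₊ := Nat.floor_pos.2 hY1
  have hJ1 : (1 : ℝ) ≤ (⌊Y⌋₊ : ℝ) := by exact_mod_cast hJ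
  have hJY : (⌊Y⌋₊ : ℝ) ≤ Y := Nat.floor_le (by linarith)
  have hYJ : Y ≤ 2 * (⌊Y⌋₊ : ℝ) := by linarith [Nat.lt_floor_add_one Y]
  generalize ⌊Y⌋₊ = J at *
  have hJ0 : (0 : ℝ) < J := by linarith
  have hJN : (J : ℝ) ≤ N ^ (1 / (1 + γ)) := hJY.trans (min_le_right _ _)
  refine ⟨J, hJ, ?_, ?_, ?_⟩
  · refine hJN.trans ?_
    conv_rhs => rw [← Real.rpow_one N]
    refine Real.rpow_le_rpow_of_exponent_le hN ?_
    rw [div_le_one (by positivity)]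
    linarith
  · have h1 : (J : ℝ) ≤ 1 / (4 * δ) := hJY.trans (min_le_left _ _)
    rw [le_div_iff₀ (by positivity)] at h1 ⊢
    linarith
  · set X := N ^ (2 + γ / (1 + γ)) with hX
    have h1 : N ^ 2 * (J : ℝ) ^ γ ≤ X := by
      calc N ^ 2 * (J : ℝ) ^ γ ≤ N ^ 2 * (N ^ (1 / (1 + γ))) ^ γ := by gcongr
        _ = X := by
          rw [hX, ← Real.rpow_mul hN0.le, Real.rpow_add hN0, Real.rpow_two, one_div_mul_eq_div]
    have h2 : 1 / Y ≤ 4 * δ + N ^ (-(1 / (1 + γ))) := by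
      have h3 : 0 ≤ N ^ (-(1 / (1 + γ))) := by positivity
      rcases min_choice (1 / (4 * δ)) (N ^ (1 / (1 + γ))) with h | h
      · rw [hY, h, one_div_one_div]
        linarith
      · rw [hY, h, Real.rpow_neg hN0.le, one_div (N ^ _)]
        linarith
    have h4 : N ^ 3 * N ^ (-(1 / (1 + γ))) = X := by
      rw [hX, ← Real.rpow_natCast, ← Real.rpow_add hN0]
      congr 1
      push_cast
      field_simp
      ring
    have h5 : N ^ 3 / J ≤ 2 * (4 * (δ * N ^ 3) + X) := by
      calc N ^ 3 / J = 2 * (N ^ 3 * (1 / (2 * J))) := by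
            field_simp
        _ ≤ 2 * (N ^ 3 * (1 / Y)) := by gcongr
        _ ≤ 2 * (N ^ 3 * (4 * δ + N ^ (-(1 / (1 + γ))))) := by gcongr
        _ = 2 * (4 * (δ * N ^ 3) + N ^ 3 * N ^ (-(1 / (1 + γ)))) := by ring
        _ = _ := by rw [h4]
    have h6 : 0 ≤ δ * N ^ 3 := by positivity
    have h7 : 0 ≤ X := by positivity
    linarith

set_option maxHeartbeats 1000000 in
-- Two demands compete: truncating the Gaussian on the short window needs `2 L ≤ lam ρ²` for the old
-- width `ρ`, while removing it on the long one needs `lam ρ'²` bounded for the new width `ρ'`.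
-- Hence boxes become thinner by powers of `L` at each step.
theorem EnergyBound.step {γ : ℝ} (hγ0 : 0 ≤ γ) (hγ : γ ≤ 1) (h : EnergyBound γ) :
    EnergyBound (γ / (1 + γ)) := by
  obtain ⟨C, k, hC, H⟩ := h
  set A := 8 * (10 ^ 9 * Real.exp 1089 * Real.exp (8 * Real.pi * (32 * 4 ^ k)) *
    (gaussianSum ^ 2 * C * (2048 ^ 4 * 512 ^ k))) with hA
  have hA0 : 0 ≤ A := by positivity
  -- The exponent collects `L^k` from the old bound, `L^(8 k + 4)` from `lam ^ 4`, and `L ^ 5`. The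
  -- second summand of the constant covers the ranges where the trivial bound is used.
  refine ⟨A + 2 * 10 ^ 8 * 4 ^ k, 9 * k + 9, ?_, ?_⟩
  · have : (1 : ℝ) ≤ 4 ^ k := one_le_pow₀ (by norm_num)
    linarith
  intro L N δ ρ' hL hN hNL hδ hρ0' hρ'
  have hN0 : 0 < N := by linarith
  set X := N ^ (2 + γ / (1 + γ)) with hX
  have hNX : N ^ 2 ≤ X := by
    rw [← Real.rpow_two]
    exact Real.rpow_le_rpow_of_exponent_le hN (by linarith [div_nonneg hγ0 (by linarith : 0 ≤ 1 + γ)])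
  set T := (2 * L) ^ k with hT
  have hT1 : 1 ≤ T := one_le_pow₀ (by linarith)
  have hT0 : 0 < T := by linarith
  have hT2 : T ^ 2 = 4 ^ k * L ^ (2 * k) := by
    rw [hT, ← pow_mul, mul_comm k 2, pow_mul, mul_pow, mul_pow, pow_mul]
    norm_num
  -- Chosen so that `lam ρ² = 2 L` for `ρ = 1 / (32 T)`; then `4 ρ = 1 / (8 T)` is the widest box
  -- the old bound allows.
  set lam := 2048 * L * T ^ 2 with hlam
  have hlam' : lam = 2048 * 4 ^ k * L ^ (2 * k + 1) := by
    rw [hlam, hT2, pow_succ]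
    ring
  have hlam4 : 4 ≤ lam := by
    have : 1 ≤ T ^ 2 := one_le_pow₀ hT1
    nlinarith
  have hLk : 1 ≤ L ^ (9 * k + 9) := one_le_pow₀ hL
  have hδN : 0 ≤ δ * N ^ 3 := by positivity
  have htriv := energy_latticeBox_le (ρ := ρ') hN hδ.le
  have hsplit : (A + 2 * 10 ^ 8 * 4 ^ k) * L ^ (9 * k + 9) * (δ * N ^ 3 + X) =
      A * L ^ (9 * k + 9) * (δ * N ^ 3 + X) +
        2 * 10 ^ 8 * 4 ^ k * L ^ (9 * k + 9) * (δ * N ^ 3 + X) := by ring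
  have hX0 : 0 ≤ X := by positivity
  rw [hsplit]
  have hnn : 0 ≤ A * L ^ (9 * k + 9) * (δ * N ^ 3 + X) := by positivity
  have hnn' : 0 ≤ 2 * 10 ^ 8 * 4 ^ k * L ^ (9 * k + 9) * (δ * N ^ 3 + X) := by positivity
  have h4k : (1 : ℝ) ≤ 4 ^ k := one_le_pow₀ (by norm_num)
  -- If `N` is at most a power of `L`, the trivial `N³` is within logarithms of `N²`; if `δ ≥ 1 /
  -- 4`, it is within a constant of `δ N³`.
  rcases lt_or_ge N (2 * lam) with hNl | hNl
  · refine htriv.trans (le_trans ?_ (le_add_of_nonneg_left hnn))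
    have h1 : N ^ 3 ≤ 4096 * (4 ^ k * L ^ (9 * k + 9)) * X := by
      calc N ^ 3 = N * N ^ 2 := by ring
        _ ≤ (2 * lam) * X := by gcongr
        _ = 4096 * (4 ^ k * L ^ (2 * k + 1)) * X := by
            rw [hlam']
            ring
        _ ≤ _ := by
          have : L ^ (2 * k + 1) ≤ L ^ (9 * k + 9) := pow_le_pow_right₀ hL (by omega)
          gcongr
    have h2 : 1 * (δ * N ^ 3) ≤ (4 ^ k * L ^ (9 * k + 9)) * (δ * N ^ 3) := by
      gcongr
      nlinarith
    have h3 : 0 ≤ (4 ^ k * L ^ (9 * k + 9)) * X := by positivity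
    linarith
  rcases le_or_gt (1 / 4) δ with hδ4 | hδ4
  · refine htriv.trans (le_trans ?_ (le_add_of_nonneg_left hnn))
    have h1 : N ^ 3 ≤ 4 * (δ * N ^ 3) := by nlinarith [pow_pos hN0 3]
    have h2 : 1 * (δ * N ^ 3) ≤ (4 ^ k * L ^ (9 * k + 9)) * (δ * N ^ 3) := by
      gcongr
      nlinarith
    have h3 : 0 ≤ (4 ^ k * L ^ (9 * k + 9)) * X := by positivity
    linarith
  refine le_trans ?_ (le_add_of_nonneg_right hnn')
  obtain ⟨J, hJ, hJN, hδJ, hbal⟩ := exists_nat_balance hN hδ hδ4.le hγ0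
  have hJ1 : (1 : ℝ) ≤ J := by exact_mod_cast hJ
  have hρ1' : ρ' ≤ 1 := hρ'.trans (by
    rw [div_le_one (by positivity)]
    linarith)
  have hcore := energy_latticeBox_le_of_dyadic (ρ := 1 / (32 * T)) (ρ' := ρ') (B := C * T) hlam4 hJ
    (by positivity)
    (by
      apply one_div_le_one_div_of_le (by norm_num)
      linarith) hL (hJN.trans hNL)
    (le_of_eq (by
      rw [hlam]
      field_simp
      norm_num)) hγ0 hγ (by nlinarith)
    (fun Z η hZ hZJ hη => by
      -- The logarithmic parameter is doubled because `Z / 4` may reach `J L / 2`, which is at most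
      -- `exp (2 L)` but possibly more than `exp L`.
      refine H (2 * L) (Z / 4) η _ (by linarith) (by linarith) ?_ hη (by positivity) (le_of_eq ?_)
      · have h1 : (J : ℝ) ≤ Real.exp L := hJN.trans hNL
        have h2 := Real.add_one_le_exp L
        have h3 : (J : ℝ) * L ≤ Real.exp L * Real.exp L := by
          gcongr
          linarith
        rw [two_mul, Real.exp_add]
        have : 0 ≤ (J : ℝ) * L := by positivity
        linarith
      · rw [← hT]
        field_simp
        norm_num) hNl hJN hρ0' hρ1'
  have hmono : (energy (latticeBox ρ' N) upperRoot δ : ℝ) ≤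
      energy (latticeBox ρ' N) upperRoot (1 / (4 * J)) := by
    exact_mod_cast energy_mono _ _ hδJ
  refine hmono.trans (hcore.trans ?_)
  have hlr : lam * ρ' ^ 2 ≤ 32 * 4 ^ k := by
    calc lam * ρ' ^ 2 ≤ lam * (1 / (8 * L ^ (9 * k + 9))) ^ 2 := by gcongr
      _ = 32 * 4 ^ k * (L ^ (2 * k + 1) / (L ^ (9 * k + 9)) ^ 2) := by
          rw [hlam']
          field_simp
          norm_num
      _ ≤ 32 * 4 ^ k * 1 := by
          gcongr
          rw [div_le_one (by positivity), ← pow_mul]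
          exact pow_le_pow_right₀ hL (by omega)
      _ = _ := mul_one _
  have hM : gaussianSum ^ 2 * (C * T) * lam ^ 4 * L ^ 5 =
      gaussianSum ^ 2 * C * (2048 ^ 4 * 512 ^ k) * L ^ (9 * k + 9) := by
    have h5 : (512 : ℝ) ^ k = 2 ^ k * (4 ^ k) ^ 4 := by
      rw [← pow_mul, mul_comm k 4, pow_mul, ← mul_pow]
      norm_num
    have h6 : L ^ (9 * k + 9) = L ^ k * (L ^ (2 * k + 1)) ^ 4 * L ^ 5 := by ring
    rw [hlam', hT, h5, h6, mul_pow 2 L k]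
    ring
  calc _ ≤ 10 ^ 9 * Real.exp 1089 * Real.exp (8 * Real.pi * (32 * 4 ^ k)) *
        (gaussianSum ^ 2 * (C * T) * lam ^ 4 * L ^ 5) * (8 * (δ * N ^ 3 + X)) := by
        have h7 : 8 * Real.pi * lam * ρ' ^ 2 ≤ 8 * Real.pi * (32 * 4 ^ k) := by
          rw [mul_assoc]
          gcongr
        gcongr
    _ = _ := by
        rw [hM, hA]
        ring

theorem energyBound_one_div (n : ℕ) : EnergyBound (1 / (n + 1)) := by
  induction n with
  | zero => simpa using energyBound_one
  | succ n ih =>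
    have h1 := ih.step (by positivity) (by
      rw [div_le_one (by positivity)]
      linarith [(Nat.cast_nonneg n : (0 : ℝ) ≤ n)])
    have h2 : (1 : ℝ) / (n + 1) / (1 + 1 / (n + 1)) = 1 / ((n + 1 : ℕ) + 1) := by
      push_cast
      field_simp
    rwa [h2] at h1

/-! ### The fourth moment of the sum of `exp (2 π i √n z)`. -/

/-- The mean of `f` against the Gaussian density whose Fourier transform is `exp (-(w / Δ)²)`. -/
noncomputable def gaussianMean (Δ : ℝ) (f : ℝ → ℝ) : ℝ :=
  √Real.pi * Δ * ∫ z : ℝ, Real.exp (-(Real.pi * Δ) ^ 2 * z ^ 2) * f z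

/-- The exponential sum `∑ exp (2 π i √n z)` over `n ∈ D`. -/
noncomputable def rootSum (D : Finset ℕ) (z : ℝ) : ℂ := ∑ n ∈ D, addExp (√(n : ℝ) * z)

theorem continuous_rootSum (D : Finset ℕ) : Continuous (rootSum D) :=
  continuous_finsetSum _ fun _ _ => continuous_addExp.comp (by fun_prop)

theorem norm_rootSum_le (D : Finset ℕ) (z : ℝ) : ‖rootSum D z‖ ≤ D.card := by
  refine (norm_sum_le _ _).trans (le_of_eq ?_)
  simp [norm_addExp]

section
variable {Δ : ℝ}

theorem integrable_exp_mul_norm_rootSum_pow (hΔ : 0 < Δ) (D : Finset ℕ) (k : ℕ) :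
    Integrable fun z : ℝ => Real.exp (-(Real.pi * Δ) ^ 2 * z ^ 2) * ‖rootSum D z‖ ^ k :=
  integrable_exp_neg_mul_sq_mul_of_bdd (B := (D.card : ℝ) ^ k) (by positivity)
    ((continuous_rootSum D).norm.pow k) fun z => by
      rw [abs_of_nonneg (by positivity)]
      exact pow_le_pow_left₀ (norm_nonneg _) (norm_rootSum_le D z) k

theorem gaussianMean_cos (hΔ : 0 < Δ) (w : ℝ) :
    gaussianMean Δ (fun z => Real.cos (2 * Real.pi * w * z)) = Real.exp (-(w / Δ) ^ 2) := by
  have hpi := Real.pi_pos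
  rw [gaussianMean, integral_exp_neg_mul_sq_mul_cos (by positivity), Real.sqrt_div hpi.le,
    Real.sqrt_sq (by positivity), ← mul_assoc]
  have h1 : √Real.pi * Δ * (√Real.pi / (Real.pi * Δ)) = 1 := by
    rw [mul_div_assoc', mul_right_comm, Real.mul_self_sqrt hpi.le]
    exact div_self (by positivity)
  rw [h1, one_mul]
  congr 1
  field_simp
  ring

theorem gaussianMean_norm_sum_sq (hΔ : 0 < Δ) {ι : Type*} (S : Finset ι) (w : ι → ℝ) :
    gaussianMean Δ (fun z => ‖∑ i ∈ S, addExp (w i * z)‖ ^ 2) =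
      ∑ i ∈ S, ∑ k ∈ S, Real.exp (-((w i - w k) / Δ) ^ 2) := by
  have h := norm_sum_mul_addExp_sq S (fun _ => 1) w
  simp only [Complex.ofReal_one, one_mul] at h
  simp_rw [← gaussianMean_cos hΔ, h]
  simp only [gaussianMean, ← Finset.mul_sum]
  congr 1
  simp_rw [Finset.mul_sum]
  have hint : ∀ i k, Integrable fun z : ℝ => Real.exp (-(Real.pi * Δ) ^ 2 * z ^ 2) *
      Real.cos (2 * Real.pi * (w i - w k) * z) := fun i k =>
    integrable_exp_neg_mul_sq_mul_of_bdd (B := 1) (by positivity) (by fun_prop) fun z =>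
      Real.abs_cos_le_one _
  rw [integral_finsetSum _ fun i _ => integrable_finsetSum _ fun k _ => hint i k]
  exact Finset.sum_congr rfl fun i _ => integral_finsetSum _ fun k _ => hint i k

theorem exp_neg_sq_le_sum (u : ℝ) {M : ℕ} (hM : |u| < M) :
    Real.exp (-u ^ 2) ≤
      ∑ m ∈ Finset.range M, Real.exp (-(m : ℝ) ^ 2) * if |u| ≤ m + 1 then 1 else 0 := by
  have h1 : ⌊|u|⌋₊ ∈ Finset.range M := Finset.mem_range.2 ((Nat.floor_lt (abs_nonneg u)).2 hM)
  refine le_trans ?_ (Finset.single_le_sum (fun m _ => ?_) h1)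
  · rw [if_pos (Nat.lt_floor_add_one _).le, mul_one, ← sq_abs u]
    have := Nat.floor_le (abs_nonneg u)
    gcongr
  · split_ifs <;> positivity

theorem sum_mul_exp_neg_sq_le (M : ℕ) :
    ∑ m ∈ Finset.range M, Real.exp (-(m : ℝ) ^ 2) * (m + 1) ≤ 6 := by
  have h1 : ∀ m ∈ Finset.range M, Real.exp (-(m : ℝ) ^ 2) * (m + 1) ≤ 3 * (1 / 2) ^ m := by
    intro m _
    have h2 := Real.add_one_le_exp (m : ℝ)
    have he := Real.exp_one_lt_d9
    have he' := Real.exp_one_gt_d9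
    calc Real.exp (-(m : ℝ) ^ 2) * (m + 1) ≤ Real.exp (-(m : ℝ) ^ 2) * Real.exp m := by gcongr
      _ ≤ Real.exp (1 + -m) := by
          rw [← Real.exp_add]
          apply Real.exp_le_exp.2
          nlinarith [sq_nonneg ((m : ℝ) - 1)]
      _ = Real.exp 1 * (1 / Real.exp 1) ^ m := by
          rw [Real.exp_add, Real.exp_neg, one_div_pow, ← Real.exp_nat_mul, mul_one, one_div]
      _ ≤ 3 * (1 / 2) ^ m := by
          gcongr
          · linarith
          · linarith
  refine (Finset.sum_le_sum h1).trans ?_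
  rw [← Finset.mul_sum]
  linarith [sum_geometric_two_le M]

/-- The Gaussian is cut into shells where `|x p - x q| / Δ` has integer part `m`. Energies at scale
`(m + 1) Δ` grow linearly in `m`, against weights `exp (-m²)`. -/
theorem sum_exp_neg_sq_le_of_energy_le (hΔ : 0 < Δ) {ι : Type*} (P : Finset ι) (x : ι → ℝ)
    {a b : ℝ} (hb : 0 ≤ b)
    (h : ∀ δ, 0 < δ → (energy P x δ : ℝ) ≤ a * δ + b) :
    ∑ p ∈ P, ∑ q ∈ P, Real.exp (-((x p - x q) / Δ) ^ 2) ≤ 6 * (a * Δ + b) := by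
  rw [← Finset.sum_product']
  obtain ⟨M, hM⟩ : ∃ M : ℕ, ∀ pq ∈ P ×ˢ P, |(x pq.1 - x pq.2) / Δ| < M := by
    obtain ⟨B, hB⟩ := ((P ×ˢ P).image fun pq => |(x pq.1 - x pq.2) / Δ|).bddAbove
    obtain ⟨M, hM⟩ := exists_nat_gt B
    exact ⟨M, fun pq hpq => (hB (Finset.mem_coe.2 (Finset.mem_image_of_mem _ hpq))).trans_lt hM⟩
  have hab : 0 ≤ a * Δ + b := le_trans (Nat.cast_nonneg _) (h Δ hΔ)
  calc _ ≤ ∑ pq ∈ P ×ˢ P, ∑ m ∈ Finset.range M, Real.exp (-(m : ℝ) ^ 2) *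
        if |(x pq.1 - x pq.2) / Δ| ≤ m + 1 then 1 else 0 :=
        Finset.sum_le_sum fun pq hpq => exp_neg_sq_le_sum _ (hM pq hpq)
    _ = ∑ m ∈ Finset.range M, Real.exp (-(m : ℝ) ^ 2) * energy P x ((m + 1) * Δ) := by
        rw [Finset.sum_comm]
        refine Finset.sum_congr rfl fun m _ => ?_
        rw [← Finset.mul_sum, energy, Finset.card_filter]
        push_cast
        congr 1
        refine Finset.sum_congr rfl fun pq _ => ?_
        rw [abs_div, abs_of_pos hΔ]
        simp only [div_le_iff₀ hΔ]
    _ ≤ ∑ m ∈ Finset.range M, Real.exp (-(m : ℝ) ^ 2) * (m + 1) * (a * Δ + b) := by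
        refine Finset.sum_le_sum fun m _ => ?_
        rw [mul_assoc]
        refine mul_le_mul_of_nonneg_left ((h _ (by positivity)).trans ?_) (Real.exp_pos _).le
        have : 0 ≤ (m : ℝ) * b := by positivity
        linarith
    _ ≤ _ := by
        rw [← Finset.sum_mul]
        exact mul_le_mul_of_nonneg_right (sum_mul_exp_neg_sq_le M) hab

theorem gaussianMean_rootSum_pow_four (hΔ : 0 < Δ) (D : Finset ℕ) :
    gaussianMean Δ (fun z => ‖rootSum D z‖ ^ 4) =
      ∑ p ∈ D ×ˢ D, ∑ q ∈ D ×ˢ D,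
        Real.exp (-((√(p.1 : ℝ) + √(p.2 : ℝ) - (√(q.1 : ℝ) + √(q.2 : ℝ))) / Δ) ^ 2) := by
  rw [← gaussianMean_norm_sum_sq hΔ (D ×ˢ D) fun p => √(p.1 : ℝ) + √(p.2 : ℝ)]
  congr 1
  funext z
  have : ∑ p ∈ D ×ˢ D, addExp ((√(p.1 : ℝ) + √(p.2 : ℝ)) * z) = rootSum D z ^ 2 := by
    rw [sq, rootSum, Finset.sum_mul_sum, ← Finset.sum_product']
    refine Finset.sum_congr rfl fun p _ => ?_
    rw [addExp, addExp, addExp, ← Complex.exp_add]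
    congr 1
    push_cast
    ring
  rw [this, norm_pow, ← pow_mul]

/-- Here `s² - h² = 4 a b`, which links sums of two square roots to the lattice boxes. -/
theorem upperRoot_sub_add (a b : ℕ) :
    upperRoot ((a : ℤ) - b, (a : ℤ) + b) = (√(a : ℝ) + √(b : ℝ)) ^ 2 := by
  have h1 : √((((a : ℤ) + b : ℤ) : ℝ) ^ 2 - (((a : ℤ) - b : ℤ) : ℝ) ^ 2) = 2 * (√a * √b) := by
    rw [← Real.sqrt_mul (Nat.cast_nonneg a)]
    rw [show (((((a : ℤ) + b : ℤ) : ℝ)) ^ 2 - (((a : ℤ) - b : ℤ) : ℝ) ^ 2) =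
      2 ^ 2 * ((a : ℝ) * b) by push_cast; ring, Real.sqrt_mul (by norm_num),
      Real.sqrt_sq (by norm_num)]
  rw [upperRoot]
  simp only
  rw [h1, add_sq, Real.sq_sqrt (Nat.cast_nonneg a), Real.sq_sqrt (Nat.cast_nonneg b)]
  push_cast
  ring

/-- Squaring multiplies a difference of two sums by the total of four roots, each at most `(3 / 2)
√N`; the map `(a, b) ↦ (a - b, a + b)` is injective. The set `D` must be short so that `|h| ≤ ρ s`.
-/
theorem energy_add_sqrt_le {N ρ δ : ℝ} (hN : 1 ≤ N) (hρ : ρ ≤ 1) (D : Finset ℕ)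
    (hD : ∀ n ∈ D, N < n ∧ (n : ℝ) ≤ 2 * N)
    (hDρ : ∀ a ∈ D, ∀ b ∈ D, (a : ℝ) - b ≤ ρ * N) :
    energy (D ×ˢ D) (fun p => √(p.1 : ℝ) + √(p.2 : ℝ)) δ ≤
      energy (latticeBox ρ N) upperRoot (6 * √N * δ) := by
  have hN0 : 0 < N := by linarith
  refine Finset.card_le_card_of_injOn (fun q => (((q.1.1 : ℤ) - q.1.2, (q.1.1 : ℤ) + q.1.2),
    ((q.2.1 : ℤ) - q.2.2, (q.2.1 : ℤ) + q.2.2))) ?_ ?_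
  · have hmem : ∀ a ∈ D, ∀ b ∈ D, ((a : ℤ) - b, (a : ℤ) + b) ∈ latticeBox ρ N := by
      intro a ha b hb
      rw [mem_latticeBox hρ hN0]
      have h1 := hD a ha
      have h2 := hD b hb
      have h3 := hDρ a ha b hb
      have h4 := hDρ b hb a ha
      have hρ0 : 0 ≤ ρ := by
        have := hDρ a ha a ha
        rw [sub_self] at this
        exact nonneg_of_mul_nonneg_left this hN0
      push_cast
      refine ⟨by linarith, by linarith, abs_le.2 ?_⟩
      have h5 : ρ * N ≤ ρ * (a + b) := by
        gcongr
        linarith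
      constructor <;> linarith
    have hroot : ∀ n ∈ D, √(n : ℝ) ≤ 3 / 2 * √N := by
      intro n hn
      rw [Real.sqrt_le_left (by positivity), mul_pow, Real.sq_sqrt hN0.le]
      linarith [(hD n hn).2]
    rintro ⟨⟨a, b⟩, ⟨c, d⟩⟩ hq
    simp only [Finset.coe_filter, Finset.mem_product, Set.mem_ofPred_eq] at hq
    obtain ⟨⟨⟨ha, hb⟩, hc, hd⟩, hle⟩ := hq
    simp only [Finset.coe_filter, Finset.mem_product, Set.mem_ofPred_eq]
    refine ⟨⟨hmem a ha b hb, hmem c hc d hd⟩, ?_⟩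
    rw [upperRoot_sub_add, upperRoot_sub_add, sq_sub_sq, abs_mul, abs_of_nonneg (by positivity)]
    have h1 : √(a : ℝ) + √(b : ℝ) + (√(c : ℝ) + √(d : ℝ)) ≤ 6 * √N := by
      linarith [hroot a ha, hroot b hb, hroot c hc, hroot d hd]
    gcongr
  · rintro ⟨⟨a, b⟩, ⟨c, d⟩⟩ - ⟨⟨a', b'⟩, ⟨c', d'⟩⟩ - h
    simp only [Prod.mk.injEq] at h ⊢
    omega

end

section
variable {Δ : ℝ}

theorem gaussianMean_rootSum_pow_four_le_sum (hΔ : 0 < Δ) (D : Finset ℕ) (f : ℕ → ℕ) {K : ℕ}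
    (hf : ∀ n ∈ D, f n < K) :
    gaussianMean Δ (fun z => ‖rootSum D z‖ ^ 4) ≤
      (K : ℝ) ^ 3 * ∑ i ∈ Finset.range K,
        gaussianMean Δ (fun z => ‖rootSum (D.filter fun n => f n = i) z‖ ^ 4) := by
  have hint := fun i => integrable_exp_mul_norm_rootSum_pow hΔ (D.filter fun n => f n = i) 4
  have hpt : ∀ z, ‖rootSum D z‖ ^ 4 ≤
      (K : ℝ) ^ 3 * ∑ i ∈ Finset.range K, ‖rootSum (D.filter fun n => f n = i) z‖ ^ 4 := by
    intro z
    have h1 : rootSum D z = ∑ i ∈ Finset.range K, rootSum (D.filter fun n => f n = i) z :=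
      (Finset.sum_fiberwise_of_maps_to (fun n hn => Finset.mem_range.2 (hf n hn)) _).symm
    have h2 := pow_sum_div_card_le_sum_pow (s := Finset.range K)
      (f := fun i => ‖rootSum (D.filter fun n => f n = i) z‖) (fun _ _ => norm_nonneg _) 3
    rw [Finset.card_range] at h2
    rcases Nat.eq_zero_or_pos K with rfl | hK
    · rw [h1]
      simp
    rw [div_le_iff₀ (by positivity), mul_comm] at h2
    refine le_trans ?_ h2
    rw [h1]
    gcongr
    exact norm_sum_le _ _
  have h3 : ∫ z : ℝ, Real.exp (-(Real.pi * Δ) ^ 2 * z ^ 2) * ‖rootSum D z‖ ^ 4 ≤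
      (K : ℝ) ^ 3 * ∑ i ∈ Finset.range K, ∫ z : ℝ, Real.exp (-(Real.pi * Δ) ^ 2 * z ^ 2) *
        ‖rootSum (D.filter fun n => f n = i) z‖ ^ 4 := by
    rw [← integral_finsetSum _ fun i _ => hint i, ← integral_const_mul]
    refine integral_mono (integrable_exp_mul_norm_rootSum_pow hΔ D 4)
      ((integrable_finsetSum _ fun i _ => hint i).const_mul _) fun z => ?_
    refine (mul_le_mul_of_nonneg_left (hpt z) (Real.exp_pos _).le).trans (le_of_eq ?_)
    rw [mul_left_comm, Finset.mul_sum]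
  simp only [gaussianMean, ← Finset.mul_sum]
  refine (mul_le_mul_of_nonneg_left h3 (by positivity)).trans (le_of_eq ?_)
  rw [mul_left_comm]

theorem exists_one_add_log_pow_le (m : ℕ) {η : ℝ} (hη : 0 < η) :
    ∃ C : ℝ, 0 < C ∧ ∀ N : ℝ, 1 ≤ N → (1 + Real.log N) ^ m ≤ C * N ^ η := by
  set θ := η / (m + 1) with hθ
  have hθ0 : 0 < θ := by positivity
  refine ⟨(1 + 1 / θ) ^ m, by positivity, fun N hN => ?_⟩
  have h1 := Real.log_le_rpow_div (by linarith : 0 ≤ N) hθ0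
  have h2 : 1 ≤ N ^ θ := Real.one_le_rpow hN hθ0.le
  calc (1 + Real.log N) ^ m ≤ ((1 + 1 / θ) * N ^ θ) ^ m := by
        have := Real.log_nonneg hN
        gcongr
        rw [add_mul, one_mul, one_div_mul_eq_div]
        linarith
    _ = (1 + 1 / θ) ^ m * N ^ (θ * m) := by
        rw [mul_pow, ← Real.rpow_natCast (N ^ θ), ← Real.rpow_mul (by linarith)]
    _ ≤ _ := by
        gcongr
        rw [hθ, div_mul_eq_mul_div, div_le_iff₀ (by positivity)]
        nlinarith

theorem exists_gaussianMean_rootSum_pow_four_le {ε : ℝ} (hε : 0 < ε) :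
    ∃ C : ℝ, 0 < C ∧ ∀ (N Δ : ℝ) (D : Finset ℕ), 2 ≤ N → 0 < Δ →
      (∀ n ∈ D, N < n ∧ (n : ℝ) ≤ 2 * N) →
        gaussianMean Δ (fun z => ‖rootSum D z‖ ^ 4) ≤
          C * N ^ ε * (Δ * N ^ (7 / 2 : ℝ) + N ^ 2) := by
  obtain ⟨n, hn⟩ := exists_nat_one_div_lt (half_pos hε)
  obtain ⟨C, k, hC, H⟩ := energyBound_one_div n
  -- One power `L^k` comes from the energy bound and four from cutting the range into about `L^k`
  -- pieces.
  obtain ⟨A, hA, hlog⟩ := exists_one_add_log_pow_le (5 * k) (half_pos hε)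
  refine ⟨360000 * C * A, by positivity, fun N Δ D hN hΔ hD => ?_⟩
  have hN0 : 0 < N := by linarith
  have hN1 : 1 ≤ N := by linarith
  set L := 1 + Real.log N with hL
  have hL1 : 1 ≤ L := by linarith [Real.log_nonneg hN1]
  have hNL : N ≤ Real.exp L := by
    rw [← Real.log_le_iff_le_exp hN0]
    linarith
  have hLk : 1 ≤ L ^ k := one_le_pow₀ hL1
  set K := ⌈8 * L ^ k⌉₊ with hK
  have hK8 : 8 * L ^ k ≤ K := Nat.le_ceil _
  have hK9 : (K : ℝ) ≤ 9 * L ^ k := by linarith [Nat.ceil_lt_add_one (by positivity : 0 ≤ 8 * L ^ k)]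
  have hK0 : (0 : ℝ) < K := by linarith
  -- This slices `(N, 2 N]` into pieces of length `N / K`, thin enough for the energy bound. The
  -- endpoint `2 N` gives the value `K`, hence `K + 1` classes.
  set f : ℕ → ℕ := fun m => ⌊K * (((m : ℝ) - N) / N)⌋₊ with hf
  have hfK : ∀ m ∈ D, f m < K + 1 := by
    intro m hm
    have h1 : ((m : ℝ) - N) / N ≤ 1 := by
      rw [div_le_one hN0]
      linarith [(hD m hm).2]
    have h2 : K * (((m : ℝ) - N) / N) ≤ (K : ℝ) := mul_le_of_le_one_right hK0.le h1
    exact Nat.lt_succ_of_le ((Nat.floor_le_floor h2).trans (Nat.floor_natCast K).le)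
  set Y := Δ * N ^ (7 / 2 : ℝ) + N ^ 2 with hY
  have hγN : N ^ (1 / ((n : ℝ) + 1)) ≤ N ^ (ε / 2) :=
    Real.rpow_le_rpow_of_exponent_le hN1 hn.le
  have hN72 : N ^ (7 / 2 : ℝ) = √N * N ^ 3 := by
    rw [Real.sqrt_eq_rpow, ← Real.rpow_natCast, ← Real.rpow_add hN0]
    norm_num
  have hpiece : ∀ i ∈ Finset.range (K + 1),
      gaussianMean Δ (fun z => ‖rootSum (D.filter fun m => f m = i) z‖ ^ 4) ≤
        36 * C * L ^ k * N ^ (ε / 2) * Y := by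
    intro i _
    set F := D.filter fun m => f m = i with hF
    have hFD : ∀ m ∈ F, N < m ∧ (m : ℝ) ≤ 2 * N := fun m hm => hD m (Finset.mem_filter.1 hm).1
    have hFρ : ∀ a ∈ F, ∀ b ∈ F, (a : ℝ) - b ≤ 1 / K * N := by
      intro a ha b hb
      have h1 : f a = f b := (Finset.mem_filter.1 ha).2.trans (Finset.mem_filter.1 hb).2.symm
      have h2 := Nat.lt_floor_add_one (K * (((a : ℝ) - N) / N))
      have h3 : (f b : ℝ) ≤ K * (((b : ℝ) - N) / N) :=
        Nat.floor_le (mul_nonneg hK0.le (div_nonneg (by linarith [(hFD b hb).1]) hN0.le))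
      have h4 : (f a : ℝ) = f b := by exact_mod_cast h1
      have h5 : K * (((a : ℝ) - N) / N) < f a + 1 := h2
      have h6 : K * (((a : ℝ) - N) / N) - K * (((b : ℝ) - N) / N) ≤ 1 := by linarith
      have h7 : K * (((a : ℝ) - N) / N) - K * (((b : ℝ) - N) / N) = K * (a - b) / N := by ring
      rw [h7, div_le_one hN0] at h6
      rw [one_div_mul_eq_div, le_div_iff₀ hK0]
      linarith
    have hρ1 : (1 : ℝ) / K ≤ 1 := by
      rw [div_le_one hK0]
      linarith
    have hE : ∀ δ, 0 < δ →
        (energy (F ×ˢ F) (fun p => √(p.1 : ℝ) + √(p.2 : ℝ)) δ : ℝ) ≤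
          (6 * C * L ^ k * N ^ (7 / 2 : ℝ)) * δ + C * L ^ k * N ^ (ε / 2) * N ^ 2 := by
      intro δ hδ
      have h1 : (energy (F ×ˢ F) (fun p => √(p.1 : ℝ) + √(p.2 : ℝ)) δ : ℝ) ≤
          energy (latticeBox (1 / K) N) upperRoot (6 * √N * δ) := by
        exact_mod_cast energy_add_sqrt_le hN1 hρ1 F hFD hFρ
      refine h1.trans ((H L N (6 * √N * δ) (1 / K) hL1 hN1 hNL (by positivity) (by positivity)
        (one_div_le_one_div_of_le (by positivity) hK8)).trans ?_)
      rw [Real.rpow_add hN0, Real.rpow_two, hN72]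
      calc _ = 6 * C * L ^ k * (√N * N ^ 3) * δ +
            C * L ^ k * N ^ (1 / ((n : ℝ) + 1)) * N ^ 2 := by ring
        _ ≤ _ := by gcongr
    rw [gaussianMean_rootSum_pow_four hΔ]
    refine (sum_exp_neg_sq_le_of_energy_le hΔ (F ×ˢ F)
      (fun p => √(p.1 : ℝ) + √(p.2 : ℝ)) (by positivity) hE).trans ?_
    have h1 : 1 ≤ N ^ (ε / 2) := Real.one_le_rpow hN1 (by positivity)
    have h2 : C * L ^ k * (Δ * N ^ (7 / 2 : ℝ)) ≤
        C * L ^ k * N ^ (ε / 2) * (Δ * N ^ (7 / 2 : ℝ)) := by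
      refine mul_le_mul_of_nonneg_right ?_ (by positivity)
      exact le_mul_of_one_le_right (by positivity) h1
    have h3 : 0 ≤ C * L ^ k * N ^ (ε / 2) * N ^ 2 := by positivity
    calc _ = 36 * (C * L ^ k * (Δ * N ^ (7 / 2 : ℝ))) + 6 * (C * L ^ k * N ^ (ε / 2) * N ^ 2) := by
          ring
      _ ≤ 36 * (C * L ^ k * N ^ (ε / 2) * (Δ * N ^ (7 / 2 : ℝ))) +
          36 * (C * L ^ k * N ^ (ε / 2) * N ^ 2) := by linarith
      _ = _ := by
          rw [hY]
          ring
  refine (gaussianMean_rootSum_pow_four_le_sum hΔ D f hfK).trans ?_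
  have hY0 : 0 ≤ Y := by positivity
  calc _ ≤ ((K + 1 : ℕ) : ℝ) ^ 3 * (((K + 1 : ℕ) : ℝ) * (36 * C * L ^ k * N ^ (ε / 2) * Y)) := by
        gcongr
        refine (Finset.sum_le_card_nsmul _ _ _ hpiece).trans (le_of_eq ?_)
        rw [Finset.card_range, nsmul_eq_mul]
    _ = ((K + 1 : ℕ) : ℝ) ^ 4 * (36 * C * L ^ k * N ^ (ε / 2) * Y) := by ring
    _ ≤ (10 * L ^ k) ^ 4 * (36 * C * L ^ k * N ^ (ε / 2) * Y) := by
        gcongr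
        push_cast
        linarith
    _ = 360000 * C * L ^ (5 * k) * N ^ (ε / 2) * Y := by
        rw [mul_comm 5 k, pow_mul]
        ring
    _ ≤ 360000 * C * (A * N ^ (ε / 2)) * N ^ (ε / 2) * Y := by
        gcongr
        exact hlog N hN1
    _ = _ := by
        have : N ^ ε = N ^ (ε / 2) * N ^ (ε / 2) := by
          rw [← Real.rpow_add hN0, add_halves]
        rw [this]
        ring

end

/-! ### Hölder's inequality and the signed seven-fold sum. -/

section
variable {Δ : ℝ}

theorem gaussianMean_nonneg (hΔ : 0 < Δ) {f : ℝ → ℝ} (hf : ∀ z, 0 ≤ f z) :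
    0 ≤ gaussianMean Δ f :=
  mul_nonneg (by positivity) (integral_nonneg fun z => mul_nonneg (Real.exp_pos _).le (hf z))

theorem gaussianMean_prod_norm_rootSum_le (hΔ : 0 < Δ) (D : Fin 7 → Finset ℕ) :
    gaussianMean Δ (fun z => ∏ j, ‖rootSum (D j) z‖) ≤
      ∏ j, gaussianMean Δ (fun z => ‖rootSum (D j) z‖ ^ 7) ^ (1 / 7 : ℝ) := by
  set c : ℝ := √Real.pi * Δ with hc
  have hc0 : 0 < c := by positivity
  set f : Fin 7 → ℝ → ℝ := fun j z =>
    c * (Real.exp (-(Real.pi * Δ) ^ 2 * z ^ 2) * ‖rootSum (D j) z‖ ^ 7) with hf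
  have hf0 : ∀ j z, 0 ≤ f j z := fun j z => by positivity
  have hfi : ∀ j, Integrable (f j) := fun j =>
    (integrable_exp_mul_norm_rootSum_pow hΔ (D j) 7).const_mul c
  have hF : ∀ j, ∫⁻ z, ENNReal.ofReal (f j z) =
      ENNReal.ofReal (gaussianMean Δ (fun z => ‖rootSum (D j) z‖ ^ 7)) := by
    intro j
    rw [← ofReal_integral_eq_lintegral_ofReal (hfi j) (Filter.Eventually.of_forall (hf0 j)),
      gaussianMean, ← integral_const_mul]
  have hM0 : ∀ j, 0 ≤ gaussianMean Δ (fun z => ‖rootSum (D j) z‖ ^ 7) := fun j =>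
    gaussianMean_nonneg hΔ fun z => by positivity
  have h1 := ENNReal.lintegral_prod_norm_pow_le (μ := volume) Finset.univ
    (f := fun j z => ENNReal.ofReal (f j z)) (p := fun _ => (1 / 7 : ℝ))
    (fun j _ => (hfi j).aestronglyMeasurable.aemeasurable.ennreal_ofReal)
    (by norm_num) (fun _ _ => by norm_num)
  have hpow : ∀ z, ∏ j, f j z ^ (1 / 7 : ℝ) =
      c * (Real.exp (-(Real.pi * Δ) ^ 2 * z ^ 2) * ∏ j, ‖rootSum (D j) z‖) := by
    intro z
    set w := Real.exp (-(Real.pi * Δ) ^ 2 * z ^ 2) with hw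
    have hw0 : 0 < w := Real.exp_pos _
    have h2 : ∀ j, f j z ^ (1 / 7 : ℝ) = (c * w) ^ (1 / 7 : ℝ) * ‖rootSum (D j) z‖ := by
      intro j
      have : f j z = (c * w) * ‖rootSum (D j) z‖ ^ 7 := by
        rw [hf]
        ring
      rw [this, Real.mul_rpow (by positivity) (by positivity)]
      congr 1
      have := Real.pow_rpow_inv_natCast (norm_nonneg (rootSum (D j) z)) (n := 7) (by norm_num)
      rw [one_div]
      exact_mod_cast this
    simp_rw [h2]
    rw [Finset.prod_mul_distrib, Finset.prod_const, Finset.card_univ, Fintype.card_fin,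
      ← Real.rpow_natCast, ← Real.rpow_mul (by positivity)]
    norm_num
    ring
  have hprod : ∀ z, ∏ j, ENNReal.ofReal (f j z) ^ (1 / 7 : ℝ) =
      ENNReal.ofReal (c * (Real.exp (-(Real.pi * Δ) ^ 2 * z ^ 2) * ∏ j, ‖rootSum (D j) z‖)) := by
    intro z
    rw [← hpow, ENNReal.ofReal_prod_of_nonneg fun j _ => Real.rpow_nonneg (hf0 j z) _]
    exact Finset.prod_congr rfl fun j _ => ENNReal.ofReal_rpow_of_nonneg (hf0 j z) (by norm_num)
  simp_rw [hprod, hF] at h1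
  have hint : Integrable fun z => c *
      (Real.exp (-(Real.pi * Δ) ^ 2 * z ^ 2) * ∏ j, ‖rootSum (D j) z‖) := by
    refine Integrable.const_mul ?_ c
    refine integrable_exp_neg_mul_sq_mul_of_bdd (B := ∏ j, ((D j).card : ℝ)) (by positivity)
      (continuous_finsetProd _ fun j _ => (continuous_rootSum (D j)).norm) fun z => ?_
    rw [abs_of_nonneg (by positivity)]
    exact Finset.prod_le_prod (fun _ _ => norm_nonneg _) fun j _ => norm_rootSum_le (D j) z
  rw [← ofReal_integral_eq_lintegral_ofReal hint
    (Filter.Eventually.of_forall fun z => by positivity), integral_const_mul] at h1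
  have h3 : ∏ j, ENNReal.ofReal (gaussianMean Δ (fun z => ‖rootSum (D j) z‖ ^ 7)) ^ (1 / 7 : ℝ) =
      ENNReal.ofReal (∏ j, gaussianMean Δ (fun z => ‖rootSum (D j) z‖ ^ 7) ^ (1 / 7 : ℝ)) := by
    rw [ENNReal.ofReal_prod_of_nonneg fun j _ => Real.rpow_nonneg (hM0 j) _]
    exact Finset.prod_congr rfl fun j _ => ENNReal.ofReal_rpow_of_nonneg (hM0 j) (by norm_num)
  rw [h3] at h1
  exact (ENNReal.ofReal_le_ofReal_iff
    (Finset.prod_nonneg fun j _ => Real.rpow_nonneg (hM0 j) _)).1 h1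

theorem norm_sum_addExp_sign (D : Finset ℕ) {s : ℝ} (hs : s = 1 ∨ s = -1) (z : ℝ) :
    ‖∑ n ∈ D, addExp (s * √(n : ℝ) * z)‖ = ‖rootSum D z‖ := by
  rcases hs with rfl | rfl
  · simp [rootSum]
  · rw [← Complex.norm_conj (rootSum D z), rootSum, map_sum]
    simp_rw [conj_addExp]
    congr 1
    refine Finset.sum_congr rfl fun n _ => ?_
    congr 1
    ring

/-- Each Gaussian weight is the mean of a cosine. The cosines add up to the real part of a product
of seven exponential sums, and a sign `-1` only conjugates a factor, leaving its modulus unchanged.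
-/
theorem sum_exp_neg_sq_signed_le (hΔ : 0 < Δ) (D : Fin 7 → Finset ℕ) {s : Fin 7 → ℝ}
    (hs : ∀ j, s j = 1 ∨ s j = -1) :
    ∑ n ∈ Fintype.piFinset D, Real.exp (-((∑ j, s j * √(n j : ℝ)) / Δ) ^ 2) ≤
      gaussianMean Δ (fun z => ∏ j, ‖rootSum (D j) z‖) := by
  simp_rw [← gaussianMean_cos hΔ]
  simp only [gaussianMean, ← Finset.mul_sum]
  have hint : ∀ w : ℝ, Integrable fun z : ℝ => Real.exp (-(Real.pi * Δ) ^ 2 * z ^ 2) *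
      Real.cos (2 * Real.pi * w * z) := fun w =>
    integrable_exp_neg_mul_sq_mul_of_bdd (B := 1) (by positivity) (by fun_prop) fun z =>
      Real.abs_cos_le_one _
  rw [← integral_finsetSum _ fun n _ => hint _]
  refine mul_le_mul_of_nonneg_left ?_ (by positivity)
  refine integral_mono (integrable_finsetSum _ fun n _ => hint _)
    (integrable_exp_neg_mul_sq_mul_of_bdd (B := ∏ j, ((D j).card : ℝ)) (by positivity)
      (continuous_finsetProd _ fun j _ => (continuous_rootSum (D j)).norm) fun z => ?_) fun z => ?_
  · rw [abs_of_nonneg (by positivity)]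
    exact Finset.prod_le_prod (fun _ _ => norm_nonneg _) fun j _ => norm_rootSum_le (D j) z
  · simp only [← Finset.mul_sum]
    refine mul_le_mul_of_nonneg_left ?_ (Real.exp_pos _).le
    have h1 : ∏ j, ∑ m ∈ D j, addExp (s j * √(m : ℝ) * z) =
        ∑ n ∈ Fintype.piFinset D, addExp ((∑ j, s j * √(n j : ℝ)) * z) := by
      rw [Finset.prod_univ_sum]
      refine Finset.sum_congr rfl fun n _ => ?_
      simp only [addExp]
      rw [← Complex.exp_sum, Finset.sum_mul, Finset.mul_sum]
      push_cast
      rw [Finset.sum_mul]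
    calc ∑ n ∈ Fintype.piFinset D, Real.cos (2 * Real.pi * (∑ j, s j * √(n j : ℝ)) * z) =
          (∏ j, ∑ m ∈ D j, addExp (s j * √(m : ℝ) * z)).re := by
          rw [h1, Complex.re_sum]
          refine Finset.sum_congr rfl fun n _ => ?_
          rw [addExp, Complex.exp_ofReal_mul_I_re, mul_assoc (2 * Real.pi)]
      _ ≤ ‖∏ j, ∑ m ∈ D j, addExp (s j * √(m : ℝ) * z)‖ := Complex.re_le_norm _
      _ = _ := by
          rw [norm_prod]
          exact Finset.prod_congr rfl fun j _ => norm_sum_addExp_sign (D j) (hs j) z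

end

/-! ### The count of solutions. -/

theorem sqrtForm_eq_sum (σ τ : ℤˣ) (n : Fin 7 → ℕ) :
    sqrtForm σ τ n =
      ∑ j, (![1, 1, 1, 1, ((σ : ℤ) : ℝ), ((τ : ℤ) : ℝ), -1] : Fin 7 → ℝ) j * √(n j : ℝ) := by
  rw [Fin.sum_univ_seven]
  simp [sqrtForm]
  ring

/-- The natural numbers `n` with `N < n ≤ 2 N`. -/
noncomputable def dyadicRange (N : ℝ) : Finset ℕ :=
  (Finset.range (⌊2 * N⌋₊ + 1)).filter fun n => N < n

theorem mem_dyadicRange {N : ℝ} (hN : 0 ≤ N) {n : ℕ} :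
    n ∈ dyadicRange N ↔ N < n ∧ (n : ℝ) ≤ 2 * N := by
  rw [dyadicRange, Finset.mem_filter, Finset.mem_range, Nat.lt_succ_iff,
    Nat.le_floor_iff (by positivity)]
  exact and_comm

theorem card_dyadicRange_le {N : ℝ} (hN : 2 ≤ N) : ((dyadicRange N).card : ℝ) ≤ 2 * N := by
  have h1 : dyadicRange N ⊆ Finset.Icc 1 ⌊2 * N⌋₊ := by
    intro n hn
    obtain ⟨h2, h3⟩ := (mem_dyadicRange (by linarith)).1 hn
    refine Finset.mem_Icc.2 ⟨?_, Nat.le_floor h3⟩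
    have : (0 : ℝ) < n := by linarith
    exact_mod_cast this
  have h2 := Finset.card_le_card h1
  rw [Nat.card_Icc, Nat.add_sub_cancel] at h2
  calc ((dyadicRange N).card : ℝ) ≤ (⌊2 * N⌋₊ : ℝ) := by exact_mod_cast h2
    _ ≤ 2 * N := Nat.floor_le (by linarith)

theorem sqrtCount_le_gaussianMean (σ τ : ℤˣ) (N : Fin 7 → ℝ) {Δ : ℝ} (hN : ∀ j, 2 ≤ N j)
    (hΔ : 0 < Δ) :
    (sqrtCount σ τ N Δ : ℝ) ≤
      Real.exp 1 * gaussianMean Δ (fun z => ∏ j, ‖rootSum (dyadicRange (N j)) z‖) := by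
  classical
  set D := fun j => dyadicRange (N j) with hD
  set s : Fin 7 → ℝ := ![1, 1, 1, 1, ((σ : ℤ) : ℝ), ((τ : ℤ) : ℝ), -1] with hs
  have hunit : ∀ u : ℤˣ, ((u : ℤ) : ℝ) = 1 ∨ ((u : ℤ) : ℝ) = -1 := by
    intro u
    rcases Int.units_eq_one_or u with rfl | rfl <;> simp
  have hs1 : ∀ j, s j = 1 ∨ s j = -1 := by
    intro j
    fin_cases j
    · exact Or.inl rfl
    · exact Or.inl rfl
    · exact Or.inl rfl
    · exact Or.inl rfl
    · exact hunit σ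
    · exact hunit τ
    · exact Or.inr rfl
  set F := (Fintype.piFinset D).filter fun n => |sqrtForm σ τ n| < Δ with hF
  have h1 : sqrtCount σ τ N Δ ≤ F.card := by
    rw [sqrtCount, ← Set.ncard_coe_finset]
    refine Set.ncard_le_ncard (fun n hn => ?_) (Finset.finite_toSet _)
    rw [Finset.mem_coe, hF, Finset.mem_filter, Fintype.mem_piFinset]
    exact ⟨fun j => (mem_dyadicRange (by linarith [hN j])).2 (hn.1 j).2, hn.2.2⟩
  -- The majorant is `1 ≤ e * exp (-(x / Δ)²)` for `|x| < Δ`.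
  have h2 : (F.card : ℝ) ≤
      ∑ n ∈ F, Real.exp 1 * Real.exp (-((∑ j, s j * √(n j : ℝ)) / Δ) ^ 2) := by
    rw [Finset.card_eq_sum_ones]
    push_cast
    refine Finset.sum_le_sum fun n hn => ?_
    rw [← Real.exp_add, ← sqrtForm_eq_sum]
    refine Real.one_le_exp ?_
    have h3 : |sqrtForm σ τ n / Δ| ≤ 1 := by
      rw [abs_div, abs_of_pos hΔ, div_le_one hΔ]
      exact (Finset.mem_filter.1 hn).2.le
    linarith [(sq_le_one_iff_abs_le_one _).2 h3]
  calc (sqrtCount σ τ N Δ : ℝ) ≤ F.card := by exact_mod_cast h1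
    _ ≤ _ := h2
    _ ≤ ∑ n ∈ Fintype.piFinset D,
        Real.exp 1 * Real.exp (-((∑ j, s j * √(n j : ℝ)) / Δ) ^ 2) :=
        Finset.sum_le_sum_of_subset_of_nonneg (Finset.filter_subset _ _) fun _ _ _ => by positivity
    _ ≤ _ := by
        rw [← Finset.mul_sum]
        exact mul_le_mul_of_nonneg_left (sum_exp_neg_sq_signed_le hΔ D hs1) (Real.exp_pos _).le

theorem gaussianMean_rootSum_pow_seven_le {Δ N : ℝ} (hΔ : 0 < Δ) (hN : 2 ≤ N) :
    gaussianMean Δ (fun z => ‖rootSum (dyadicRange N) z‖ ^ 7) ≤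
      (2 * N) ^ 3 * gaussianMean Δ (fun z => ‖rootSum (dyadicRange N) z‖ ^ 4) := by
  rw [gaussianMean, gaussianMean, mul_left_comm]
  refine mul_le_mul_of_nonneg_left ?_ (by positivity)
  rw [← integral_const_mul]
  refine integral_mono (integrable_exp_mul_norm_rootSum_pow hΔ _ 7)
    ((integrable_exp_mul_norm_rootSum_pow hΔ _ 4).const_mul _) fun z => ?_
  have h1 := (norm_rootSum_le (dyadicRange N) z).trans (card_dyadicRange_le hN)
  calc Real.exp (-(Real.pi * Δ) ^ 2 * z ^ 2) * ‖rootSum (dyadicRange N) z‖ ^ 7 =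
        ‖rootSum (dyadicRange N) z‖ ^ 3 *
          (Real.exp (-(Real.pi * Δ) ^ 2 * z ^ 2) * ‖rootSum (dyadicRange N) z‖ ^ 4) := by ring
    _ ≤ _ := by gcongr

theorem lemma10 (ε : ℝ) (hε : 0 < ε) :
    ∃ C : ℝ, 0 < C ∧
      ∀ (σ τ : ℤˣ) (N : Fin 7 → ℝ) (Δ : ℝ), (∀ j, 2 ≤ N j) → 0 < Δ →
        (sqrtCount σ τ N Δ : ℝ) ≤
          C * ∏ j : Fin 7,
            ((Δ ^ (1 / 7 : ℝ) * N j ^ (13 / 14 : ℝ) + N j ^ (5 / 7 : ℝ)) * N j ^ ε) := by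
  -- The loss `7 ε` in the fourth moment becomes `ε` after the seventh root, and `(2 n)³` accounts
  -- for the `8` in the constant.
  obtain ⟨C, hC, H⟩ := exists_gaussianMean_rootSum_pow_four_le (by positivity : 0 < 7 * ε)
  refine ⟨Real.exp 1 * ((8 * C) ^ (1 / 7 : ℝ)) ^ 7, by positivity, fun σ τ N Δ hN hΔ => ?_⟩
  refine (sqrtCount_le_gaussianMean σ τ N hN hΔ).trans ?_
  rw [mul_assoc]
  refine mul_le_mul_of_nonneg_left ?_ (Real.exp_pos 1).le
  refine (gaussianMean_prod_norm_rootSum_le hΔ _).trans ?_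
  have h7 : ((8 * C) ^ (1 / 7 : ℝ)) ^ 7 = ∏ _j : Fin 7, (8 * C) ^ (1 / 7 : ℝ) := by
    rw [Finset.prod_const, Finset.card_univ, Fintype.card_fin]
  rw [h7, ← Finset.prod_mul_distrib]
  have hM0 : ∀ j, 0 ≤ gaussianMean Δ (fun z => ‖rootSum (dyadicRange (N j)) z‖ ^ 7) := fun j =>
    gaussianMean_nonneg hΔ fun z => by positivity
  refine Finset.prod_le_prod (fun j _ => Real.rpow_nonneg (hM0 j) _) fun j _ => ?_
  have hj := hN j
  generalize N j = n at hj
  have hn0 : 0 < n := by linarith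
  have h1 : gaussianMean Δ (fun z => ‖rootSum (dyadicRange n) z‖ ^ 7) ≤
      8 * C * ((Δ * n ^ (13 / 2 : ℝ) + n ^ (5 : ℝ)) * n ^ (7 * ε)) := by
    refine (gaussianMean_rootSum_pow_seven_le hΔ hj).trans ?_
    have h2 := H n Δ (dyadicRange n) hj hΔ fun m hm => (mem_dyadicRange hn0.le).1 hm
    have h3 : n ^ (13 / 2 : ℝ) = n ^ 3 * n ^ (7 / 2 : ℝ) := by
      rw [← Real.rpow_natCast, ← Real.rpow_add hn0]
      norm_num
    have h4 : n ^ (5 : ℝ) = n ^ 3 * n ^ 2 := by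
      rw [← pow_add, ← Real.rpow_natCast]
      norm_num
    rw [h3, h4]
    calc _ ≤ (2 * n) ^ 3 * (C * n ^ (7 * ε) * (Δ * n ^ (7 / 2 : ℝ) + n ^ 2)) := by gcongr
      _ = _ := by ring
  have hj0 : 0 ≤ gaussianMean Δ (fun z => ‖rootSum (dyadicRange n) z‖ ^ 7) :=
    gaussianMean_nonneg hΔ fun z => by positivity
  calc _ ≤ (8 * C * ((Δ * n ^ (13 / 2 : ℝ) + n ^ (5 : ℝ)) * n ^ (7 * ε))) ^ (1 / 7 : ℝ) := by gcongr
    _ = (8 * C) ^ (1 / 7 : ℝ) * ((Δ * n ^ (13 / 2 : ℝ) + n ^ (5 : ℝ)) ^ (1 / 7 : ℝ) * n ^ ε) := by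
        have h2 : (n ^ (7 * ε)) ^ (1 / 7 : ℝ) = n ^ ε := by
          rw [← Real.rpow_mul hn0.le]
          congr 1
          ring
        rw [Real.mul_rpow (x := 8 * C) (by positivity) (by positivity),
          Real.mul_rpow (y := n ^ (7 * ε)) (by positivity) (by positivity), h2]
    _ ≤ _ := by
        gcongr
        -- Subadditivity of `x ↦ x^(1/7)` separates `Δ n^(13/2)` from `n⁵`.
        refine (Real.rpow_add_le_add_rpow (by positivity) (by positivity) (by norm_num)
          (by norm_num)).trans (le_of_eq ?_)
        rw [Real.mul_rpow hΔ.le (by positivity), ← Real.rpow_mul hn0.le, ← Real.rpow_mul hn0.le]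
        norm_num
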